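/- Let $\Omega\subseteq\mathbb{C}$ be a simply connected domain. Equip $\hat{\mathbb C}=\mathbb C\cup\{\infty\}$ with the chordal metric $\chi(z,w)=\frac{|z-w|}{\sqrt{1+|z|^2}\sqrt{1+|w|^2}}$ for $z,w\in\mathbb C$, $\chi(z,\infty)=\chi(\infty,z)=\frac1{\sqrt{1+|z|^2}}$ for $z\in\mathbb C$, and $\chi(\infty,\infty)=0$. Let $\mathcal M_{l.u.}(\Omega)$ be the set of locally univalent meromorphic functions on $\Omega$, that is, of the meromorphic functions $f$ on $\Omega$ that have at most simple poles and satisfy $f'(z)\neq 0$ for all $z\in\Omega$ with $f(z)\ne\infty$; it carries the topology of locally uniform convergence on $\Omega$ with respect to $\chi$. A locally univalent self-map of $\Omega$ is a holomorphic map $\phi:\Omega\to\Omega$ with $\phi'(z)\ne0$ for all $z\in\Omega$. Let $\Phi$ be a family of locally univalent self-maps of $\Omega$ which contains a sequence $(\phi_n)$ that is * run-away: for every compact set $K\subseteq\Omega$ there is an $n\in\mathbb N$ with $\phi_n(K)\cap K=\emptyset$; and * eventually injective: for every compact set $K\subseteq\Omega$ there is an $N\in\mathbb N$ such that $\phi_n|_K$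 is injective for all $n\ge N$. Call $f\in\mathcal M_{l.u.}(\Omega)$ $\Phi$-universal in $\mathcal M_{l.u.}(\Omega)$ if $\{f\circ\phi:\phi\in\Phi\}$ is a dense subset of $\mathcal M_{l.u.}(\Omega)$. Then there is a $\Phi$-universal function in $\mathcal M_{l.u.}(\Omega)$, and the set of all such functions is a dense $G_\delta$-subset of $\mathcal M_{l.u.}(\Omega)$. -/

import Mathlib

open Set Filter Topology
open scoped OnePoint

noncomputable section

namespace ChordalSphere

/-- The chordal metric `χ` on the Riemann sphere `ℂ ∪ {∞}`. -/
def chi : OnePoint ℂ → OnePoint ℂ → ℝ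
  | OnePoint.some z, OnePoint.some w => ‖z - w‖ / (√(1 + ‖z‖ ^ 2) * √(1 + ‖w‖ ^ 2))
  | OnePoint.some z, ∞ => 1 / √(1 + ‖z‖ ^ 2)
  | ∞, OnePoint.some w => 1 / √(1 + ‖w‖ ^ 2)
  | ∞, ∞ => 0

/-- Stereographic projection onto the sphere of diameter one; used only to prove that `chi` is a
metric for the usual topology. -/
def stereo : OnePoint ℂ → WithLp 2 (ℂ × ℝ)
  | OnePoint.some z => WithLp.toLp 2 (((1 + ‖z‖ ^ 2)⁻¹ : ℝ) • z, 1 - (1 + ‖z‖ ^ 2)⁻¹)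
  | ∞ => WithLp.toLp 2 (0, 1)

theorem dist_toLp (a b : ℂ) (s t : ℝ) :
    dist (WithLp.toLp 2 (a, s)) (WithLp.toLp 2 (b, t)) = √(‖a - b‖ ^ 2 + ‖s - t‖ ^ 2) := by
  rw [WithLp.prod_dist_eq_of_L2, dist_eq_norm, dist_eq_norm]
  rfl

theorem chi_eq_dist (x y : OnePoint ℂ) : chi x y = dist (stereo x) (stereo y) := by
  have key : ∀ z : ℂ, 0 < 1 + ‖z‖ ^ 2 := fun z => by positivity
  induction x with
  | infty =>
    induction y with
    | infty => simp [chi]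
    | coe w =>
      have hw := key w
      simp only [chi, stereo]
      rw [dist_toLp]
      rw [eq_comm, Real.sqrt_eq_iff_mul_self_eq (by positivity) (by positivity)]
      rw [div_mul_div_comm, Real.mul_self_sqrt hw.le]
      simp only [zero_sub, norm_neg, norm_smul, Real.norm_eq_abs, mul_pow, sq_abs]
      field_simp
      ring
  | coe z =>
    have hz := key z
    induction y with
    | infty =>
      simp only [chi, stereo]
      rw [dist_toLp]
      rw [eq_comm, Real.sqrt_eq_iff_mul_self_eq (by positivity) (by positivity)]
      rw [div_mul_div_comm, Real.mul_self_sqrt hz.le]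
      simp only [sub_zero, norm_smul, Real.norm_eq_abs, mul_pow, sq_abs]
      field_simp
      ring
    | coe w =>
      have hw := key w
      simp only [chi, stereo]
      rw [dist_toLp]
      rw [eq_comm, Real.sqrt_eq_iff_mul_self_eq (by positivity) (by positivity)]
      rw [div_mul_div_comm, mul_mul_mul_comm, Real.mul_self_sqrt hz.le, Real.mul_self_sqrt hw.le]
      have h1 : ∀ u : ℂ, ‖u‖ ^ 2 = u.re ^ 2 + u.im ^ 2 := fun u => by
        rw [Complex.sq_norm, Complex.normSq_apply]; ring
      rw [← sq ‖z - w‖]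
      simp only [h1] at hz hw ⊢
      simp only [Complex.sub_re, Complex.sub_im, Complex.smul_re, Complex.smul_im, smul_eq_mul,
        Real.norm_eq_abs, sq_abs]
      field_simp
      ring

theorem stereo_injective : Function.Injective stereo := by
  intro x y h
  have h0 : chi x y = 0 := by rw [chi_eq_dist, h, dist_self]
  have key : ∀ z : ℂ, 0 < √(1 + ‖z‖ ^ 2) := fun z => by positivity
  induction x with
  | infty =>
    induction y with
    | infty => rfl
    | coe w => exact absurd h0 (one_div_pos.2 (key w)).ne'
  | coe z =>
    induction y with
    | infty => exact absurd h0 (one_div_pos.2 (key z)).ne'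
    | coe w =>
      have h1 : ‖z - w‖ / (√(1 + ‖z‖ ^ 2) * √(1 + ‖w‖ ^ 2)) = 0 := h0
      rw [div_eq_zero_iff, or_iff_left (mul_pos (key z) (key w)).ne', norm_eq_zero,
        sub_eq_zero] at h1
      rw [h1]

theorem stereo_continuous : Continuous stereo := by
  rw [OnePoint.continuous_iff]
  constructor
  · rw [tendsto_iff_dist_tendsto_zero, coclosedCompact_eq_cocompact]
    simp only [← chi_eq_dist]
    have h1 : Tendsto (fun z : ℂ => (√(1 + ‖z‖ ^ 2))⁻¹) (cocompact ℂ) (𝓝 0) := by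
      refine tendsto_inv_atTop_zero.comp (Real.tendsto_sqrt_atTop.comp ?_)
      exact tendsto_atTop_add_const_left _ _
        ((tendsto_pow_atTop two_ne_zero).comp (tendsto_norm_cocompact_atTop (E := ℂ)))
    refine h1.congr fun z => ?_
    change _ = 1 / √(1 + ‖z‖ ^ 2)
    exact (one_div (√(1 + ‖z‖ ^ 2))).symm
  · have h0 : ∀ z : ℂ, 1 + ‖z‖ ^ 2 ≠ 0 := fun z => by positivity
    have h1 : Continuous fun z : ℂ => (1 + ‖z‖ ^ 2)⁻¹ :=
      (by fun_prop : Continuous fun z : ℂ => 1 + ‖z‖ ^ 2).inv₀ h0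
    exact (WithLp.prod_continuous_toLp 2 ℂ ℝ).comp
      ((h1.smul continuous_id).prodMk (continuous_const.sub h1))

/-- The chordal metric as a metric space structure, with the topology it induces. -/
abbrev chordalMetricSpaceAux : MetricSpace (OnePoint ℂ) where
  dist := chi
  dist_self := fun x => by rw [chi_eq_dist, dist_self]
  dist_comm := fun x y => by rw [chi_eq_dist, chi_eq_dist, dist_comm]
  dist_triangle := fun x y z => by simp only [chi_eq_dist]; exact dist_triangle _ _ _
  eq_of_dist_eq_zero := fun {x y} h => by
    have h' : chi x y = 0 := h
    rw [chi_eq_dist] at h'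
    exact stereo_injective (dist_eq_zero.1 h')

theorem topology_eq : (inferInstance : TopologicalSpace (OnePoint ℂ)) =
    chordalMetricSpaceAux.toUniformSpace.toTopologicalSpace := by
  have h1 := (stereo_continuous.isClosedEmbedding stereo_injective).isInducing.eq_induced
  have h2 : @Isometry (OnePoint ℂ) (WithLp 2 (ℂ × ℝ))
      chordalMetricSpaceAux.toPseudoMetricSpace.toPseudoEMetricSpace _ stereo :=
    @Isometry.of_dist_eq _ _ chordalMetricSpaceAux.toPseudoMetricSpace _ stereo
      fun x y => (chi_eq_dist x y).symm
  exact h1.trans (@Topology.IsInducing.eq_induced _ _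
    chordalMetricSpaceAux.toUniformSpace.toTopologicalSpace _ _
    (@IsUniformInducing.isInducing _ _ chordalMetricSpaceAux.toUniformSpace _ _
      (@Isometry.isUniformInducing _ _
        chordalMetricSpaceAux.toPseudoMetricSpace.toPseudoEMetricSpace _ _ h2))).symm

/-- The Riemann sphere is a metric space under the chordal metric; the metric topology is the
topology of the one-point compactification. -/
instance chordalMetricSpace : MetricSpace (OnePoint ℂ) :=
  chordalMetricSpaceAux.replaceTopology topology_eq

theorem dist_eq_chi (x y : OnePoint ℂ) : dist x y = chi x y := rfl

end ChordalSphere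

/-- All functions from `Ω` to the Riemann sphere, with the topology of uniform convergence
with respect to the chordal metric on the compact subsets of `Ω`. For open `Ω` this is the topology
of locally uniform convergence. -/
abbrev SphereMap (Ω : Set ℂ) : Type :=
  UniformOnFun Ω (OnePoint ℂ) {K : Set Ω | IsCompact K}

/-- The underlying function. -/
abbrev SphereMap.toFun {Ω : Set ℂ} (f : SphereMap Ω) : Ω → OnePoint ℂ :=
  UniformOnFun.toFun {K : Set Ω | IsCompact K} f

/-- Composition `f ∘ φ` with a self-map of `Ω`. -/
def SphereMap.comp {Ω : Set ℂ} (f : SphereMap Ω) (φ : Ω → Ω) : SphereMap Ω :=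
  UniformOnFun.ofFun {K : Set Ω | IsCompact K} (f.toFun ∘ φ)

/-- Extension by `0` of a function on `Ω` to all of `ℂ`. -/
def extendZero {Ω : Set ℂ} (h : Ω → ℂ) : ℂ → ℂ := Function.extend Subtype.val h 0

/-- The complex-valued function on `ℂ` that agrees with `f` at the points of `Ω` where `f` is finite
(and has the irrelevant value `0` elsewhere). -/
def finitePart {Ω : Set ℂ} (f : SphereMap Ω) : ℂ → ℂ :=
  extendZero fun z => (f.toFun z).elim 0 id

/-- `f` is meromorphic on `Ω`: at every point, either `f` is finite and holomorphic, or `f` has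
the value `∞` and a pole. (The order at a point only depends on a punctured neighbourhood.) -/
def IsMeromorphic {Ω : Set ℂ} (f : SphereMap Ω) : Prop :=
  ∀ z : Ω, (f.toFun z ≠ ∞ ∧ AnalyticAt ℂ (finitePart f) z) ∨
    (f.toFun z = ∞ ∧ MeromorphicAt (finitePart f) z ∧ meromorphicOrderAt (finitePart f) z < 0)

/-- The set `M_{l.u.}(Ω)` of locally univalent meromorphic functions on `Ω`: meromorphic functions
with at most simple poles and with nonvanishing derivative at all points that are not poles. -/
def locallyUnivalentMeromorphic (Ω : Set ℂ) : Set (SphereMap Ω) :=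
  {f | IsMeromorphic f ∧
    (∀ z : Ω, f.toFun z = ∞ → meromorphicOrderAt (finitePart f) z = -1) ∧
    (∀ z : Ω, f.toFun z ≠ ∞ → deriv (finitePart f) z ≠ 0)}

/-- `φ` is a locally univalent (holomorphic) self-map of `Ω`. -/
def IsLocallyUnivalentSelfMap {Ω : Set ℂ} (φ : Ω → Ω) : Prop :=
  DifferentiableOn ℂ (extendZero fun z => (φ z : ℂ)) Ω ∧
    ∀ z ∈ Ω, deriv (extendZero fun z => (φ z : ℂ)) z ≠ 0

/-- The sequence `(φ n)` of self-maps is run-away. -/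
def IsRunAway {Ω : Set ℂ} (φ : ℕ → Ω → Ω) : Prop :=
  ∀ K : Set Ω, IsCompact K → ∃ n, φ n '' K ∩ K = ∅

/-- The sequence `(φ n)` of self-maps is eventually injective. -/
def IsEventuallyInjective {Ω : Set ℂ} (φ : ℕ → Ω → Ω) : Prop :=
  ∀ K : Set Ω, IsCompact K → ∃ N, ∀ n ≥ N, InjOn (φ n) K

/-- `g` is `Φ`-universal in `𝒢`: `g` belongs to `𝒢` and `{g ∘ φ | φ ∈ Φ}` is a dense subset
of `𝒢`. -/
def IsUniversalIn {Ω : Set ℂ} (Φ : Set (Ω → Ω)) (𝒢 : Set (SphereMap Ω)) (g : SphereMap Ω) :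
    Prop :=
  g ∈ 𝒢 ∧ {h | ∃ φ ∈ Φ, h = g.comp φ} ⊆ 𝒢 ∧ 𝒢 ⊆ closure {h | ∃ φ ∈ Φ, h = g.comp φ}

end

/-! The proof is a Baire category argument (Birkhoff transitivity). Let M be the family of locally
univalent meromorphic functions on Ω. By Hurwitz's theorem a locally uniform chordal limit of
members of M is a member or a constant, so M is open in its closure in the Polish space of
continuous maps from Ω to the sphere. Hence M is a Baire space, and it is second countable. A
function is universal exactly when its compositions with Φ meet every nonempty set U of a countable
basis, so the universal functions are the intersection over U of the open sets of all f with f ∘ φ ∈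
U for some φ ∈ Φ. It remains to see that each of these sets is dense
(`dense_setOf_exists_compSelfMap_mem`): given f, g in M and a compact K, some F in M must be close
to f on K while F ∘ φ n is close to g on K (`exists_mem_dist_lt`).

The Riemann mapping theorem replaces Ω by a disc or the plane and K by a disc. For a suitable large
n the map φ n is injective on the disc and moves it off itself. The task becomes to approximate a
locally univalent H, given near two disjoint closed conformal discs A₁ and A₂, by a locally
univalent meromorphic function on the whole plane (`exists_isLocUnivAt_dist_lt`).

Let P be the polynomial with simple zeros at the poles of H. Since H' has no zeros and only double
poles, H' = exp(-2l) / P² with l holomorphic near the discs. Division by P² gives l = q + P² k with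
a polynomial q. If a polynomial u approximates k, then D = exp(-2(q + P² u)) / P² differs from H' by
a small function that is holomorphic across the poles. So D has the same principal parts as H', in
particular no residues, and it has no zeros: it is the derivative of a locally univalent F.
Normalised at a point x of A₁, F is close to H on A₁. On A₂ it is close to H only up to an additive
constant, so the integral of D along a segment from x to y ∈ A₂ must also be close to H(y) - H(x).
This is arranged in `exists_polynomial_approx_integral` by prescribing u along the segment too.

That calls for polynomial approximation on A₁ ∪ segment ∪ A₂ (`exists_polynomial_norm_sub_lt`). The
set does not separate the plane, by a criterion in terms of continuous logarithms. The approximated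
function is smooth and satisfies the Cauchy-Riemann equation off the segment, which is a null set,
so the Cauchy-Pompeiu formula writes it, up to a small error, as an integral of Cauchy kernels with
poles off the set. Each such kernel is a uniform limit of polynomials. -/

namespace LocallyUnivalent

/-! ### Holomorphic logarithms, Hurwitz's theorem and the Riemann mapping theorem. -/

open Metric

/-- A holomorphic nonvanishing function on a simply connected open set has a holomorphic
logarithm. -/
theorem exists_differentiableOn_exp_eq {U : Set ℂ} (hU : IsOpen U) (hsc : IsSimplyConnected U)
    {g : ℂ → ℂ} (hg : DifferentiableOn ℂ g U) (h0 : ∀ z ∈ U, g z ≠ 0) :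
    ∃ l : ℂ → ℂ, DifferentiableOn ℂ l U ∧ ∀ z ∈ U, Complex.exp (l z) = g z := by
  obtain ⟨l, hlc, hl⟩ := Complex.exists_continuousOn_eqOn_exp_comp hsc hU hg.continuousOn
    (by rintro ⟨z, hz, h⟩; exact h0 z hz h)
  refine ⟨l, fun z hz => ?_, fun z hz => hl hz⟩
  have hgz : HasDerivAt g (deriv g z) z := (hg.differentiableAt (hU.mem_nhds hz)).hasDerivAt
  have hexp : HasStrictDerivAt Complex.exp (Complex.exp (l z)) (l z) :=
    Complex.hasStrictDerivAt_exp _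
  have hlc' : ContinuousAt l z := hlc.continuousAt (hU.mem_nhds hz)
  -- Near `z` the continuous logarithm is a local inverse of `exp` applied to `g`, hence
  -- differentiable.
  set L := hexp.localInverse Complex.exp (Complex.exp (l z)) (l z) (Complex.exp_ne_zero _)
  have h1 : ∀ᶠ w in 𝓝 (l z), L (Complex.exp w) = w :=
    hexp.eventually_left_inverse (Complex.exp_ne_zero _)
  have h2 : ∀ᶠ w in 𝓝 z, L (g w) = l w := by
    filter_upwards [hlc'.eventually h1, hU.mem_nhds hz] with w hw hwU
    rw [← hl hwU]; exact hw
  have h3 : HasDerivAt L (Complex.exp (l z))⁻¹ (g z) := by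
    rw [← hl hz]
    exact (hexp.to_localInverse (Complex.exp_ne_zero _)).hasDerivAt
  exact ((h3.comp z hgz).congr_of_eventuallyEq
    (h2.mono fun w hw => hw.symm)).differentiableAt.differentiableWithinAt

/-- Hurwitz's theorem: a zero of a locally uniform limit of nonvanishing holomorphic functions is
not isolated. -/
theorem eventually_eq_zero_of_tendstoLocallyUniformlyOn {ι : Type*} {p : Filter ι} [p.NeBot]
    {U : Set ℂ} (hU : IsOpen U) {f : ι → ℂ → ℂ} {g : ℂ → ℂ}
    (hfg : TendstoLocallyUniformlyOn f g p U) (hf : ∀ᶠ n in p, DifferentiableOn ℂ (f n) U)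
    (hf0 : ∀ᶠ n in p, ∀ z ∈ U, f n z ≠ 0) {z : ℂ} (hz : z ∈ U) (hgz : g z = 0) :
    ∀ᶠ w in 𝓝 z, g w = 0 := by
  have hg : DifferentiableOn ℂ g U := hfg.differentiableOn hf hU
  have han : AnalyticAt ℂ g z := hg.analyticAt (hU.mem_nhds hz)
  refine han.eventually_eq_zero_or_eventually_ne_zero.resolve_right fun hne => ?_
  rw [eventually_nhdsWithin_iff] at hne
  obtain ⟨s, hs, hsub⟩ := nhds_basis_closedBall.mem_iff.1 (hne.and (hU.mem_nhds hz))
  have hsU : closedBall z s ⊆ U := fun w hw => (hsub hw).2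
  obtain ⟨m, hm, hmle⟩ : ∃ m > 0, ∀ w ∈ sphere z s, m ≤ ‖g w‖ := by
    obtain ⟨w, hw, hmin⟩ := (isCompact_sphere z s).exists_isMinOn
      (NormedSpace.sphere_nonempty.2 hs.le)
      (f := fun w => ‖g w‖) (hg.continuousOn.norm.mono (sphere_subset_closedBall.trans hsU))
    refine ⟨‖g w‖, norm_pos_iff.2 ((hsub (sphere_subset_closedBall hw)).1 ?_),
      fun v hv => hmin hv⟩
    rintro rfl
    simp [hs.ne] at hw
  have hu := (tendstoLocallyUniformlyOn_iff_forall_isCompact hU).1 hfg _ hsU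
    (isCompact_closedBall z s)
  rw [Metric.tendstoUniformlyOn_iff] at hu
  obtain ⟨n, hn, hd, h0⟩ := ((hu (m / 2) (by positivity)).and (hf.and hf0)).exists
  -- On the circle `f n` has modulus at least `m / 2`. The maximum principle for `1 / f n` carries
  -- this bound to the centre, where `f n` is within `m / 2` of `g z = 0`.
  have hd' : DiffContOnCl ℂ (fun w => (f n w)⁻¹) (ball z s) := by
    refine DifferentiableOn.diffContOnCl ?_
    rw [closure_ball _ hs.ne']
    exact (hd.mono hsU).inv fun w hw => h0 w (hsU hw)
  have hmax : ‖(f n z)⁻¹‖ ≤ (m / 2)⁻¹ := by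
    refine Complex.norm_le_of_forall_mem_frontier_norm_le isBounded_ball hd' (fun w hw => ?_)
      (subset_closure (mem_ball_self hs))
    rw [frontier_ball _ hs.ne'] at hw
    rw [norm_inv]
    refine inv_anti₀ (by positivity) ?_
    have h1 := hn w (sphere_subset_closedBall hw)
    have h2 := hmle w hw
    rw [dist_eq_norm] at h1
    have h3 := norm_sub_norm_le (g w) (f n w)
    linarith
  have h1 := hn z (mem_closedBall_self hs.le)
  rw [hgz, dist_zero_left] at h1
  rw [norm_inv] at hmax
  have h4 := (inv_le_inv₀ (norm_pos_iff.2 (h0 z hz)) (by positivity)).1 hmax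
  linarith

/-- A pointwise limit of uniformly bounded holomorphic functions is a locally uniform limit. -/
theorem tendstoLocallyUniformlyOn_of_tendsto_of_mapsTo {ι : Type*} {p : Filter ι} [p.NeBot]
    {U : Set ℂ} (hU : IsOpen U) {f : ι → ℂ → ℂ} {g : ℂ → ℂ}
    (hf : ∀ n, DifferentiableOn ℂ (f n) U) (hm : ∀ n, MapsTo (f n) U (ball 0 1))
    (hlim : ∀ z ∈ U, Tendsto (fun n => f n z) p (𝓝 (g z))) :
    TendstoLocallyUniformlyOn f g p U := by
  rw [Metric.tendstoLocallyUniformlyOn_iff]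
  intro ε hε z hz
  obtain ⟨d, hd, hdU⟩ := Metric.isOpen_iff.1 hU z hz
  -- Schwarz's lemma: the Lipschitz constant at `z` does not depend on `n`, and this equicontinuity
  -- upgrades pointwise to locally uniform convergence.
  have hlip : ∀ n, ∀ w ∈ ball z d, dist (f n w) (f n z) ≤ 2 / d * dist w z := by
    intro n w hw
    refine Complex.dist_le_div_mul_dist_of_mapsTo_ball ((hf n).mono hdU) (fun v hv => ?_) hw
    rw [mem_closedBall]
    have h1 := hm n (hdU hv)
    have h2 := hm n hz
    rw [mem_ball_zero_iff] at h1 h2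
    calc dist (f n v) (f n z) ≤ ‖f n v‖ + ‖f n z‖ := dist_le_norm_add_norm _ _
      _ ≤ 2 := by linarith
  have hlipg : ∀ w ∈ ball z d, dist (g w) (g z) ≤ 2 / d * dist w z := fun w hw =>
    le_of_tendsto ((hlim w (hdU hw)).dist (hlim z hz)) (Eventually.of_forall fun n => hlip n w hw)
  have hη : 0 < min d (ε * d / 8) := by positivity
  refine ⟨ball z (min d (ε * d / 8)), mem_nhdsWithin_of_mem_nhds (ball_mem_nhds z hη), ?_⟩
  filter_upwards [(Metric.tendsto_nhds.1 (hlim z hz)) (ε / 4) (by positivity)] with n hn w hw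
  have hwd : w ∈ ball z d := ball_subset_ball (min_le_left _ _) hw
  have hw2 : dist w z < ε * d / 8 := lt_of_lt_of_le hw (min_le_right _ _)
  have hb : 2 / d * dist w z < ε / 4 := by
    rw [div_mul_eq_mul_div, div_lt_iff₀ hd]; linarith
  calc dist (g w) (f n w) ≤ dist (g w) (g z) + dist (g z) (f n z) + dist (f n z) (f n w) :=
        dist_triangle4 _ _ _ _
    _ < ε := by
      have h1 := hlipg w hwd
      have h2 := hlip n w hwd
      rw [dist_comm] at hn
      rw [dist_comm (f n z)]
      linarith

/-- The disc automorphism that takes `w` to zero. -/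
noncomputable def discAut (w z : ℂ) : ℂ := (z - w) / (1 - (starRingEnd ℂ) w * z)

theorem one_sub_conj_mul_ne_zero {w z : ℂ} (hw : ‖w‖ < 1) (hz : ‖z‖ < 1) :
    1 - (starRingEnd ℂ) w * z ≠ 0 := by
  intro h
  have h1 : ‖(starRingEnd ℂ) w * z‖ = 1 := by
    rw [← sub_eq_zero.1 h, norm_one]
  rw [norm_mul, RCLike.norm_conj] at h1
  nlinarith [norm_nonneg w, norm_nonneg z]

/-- This rests on |1 - w̄z|² - |z - w|² = (1 - |w|²)(1 - |z|²) > 0. -/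
theorem norm_discAut_lt_one {w z : ℂ} (hw : ‖w‖ < 1) (hz : ‖z‖ < 1) : ‖discAut w z‖ < 1 := by
  have h0 := one_sub_conj_mul_ne_zero hw hz
  rw [discAut, norm_div, div_lt_one (norm_pos_iff.2 h0)]
  refine lt_of_pow_lt_pow_left₀ 2 (norm_nonneg _) ?_
  have hw' : w.re * w.re + w.im * w.im < 1 := by
    have := Complex.sq_norm w; rw [Complex.normSq_apply] at this
    rw [← this]; nlinarith [norm_nonneg w]
  have hz' : z.re * z.re + z.im * z.im < 1 := by
    have := Complex.sq_norm z; rw [Complex.normSq_apply] at this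
    rw [← this]; nlinarith [norm_nonneg z]
  rw [Complex.sq_norm, Complex.sq_norm, Complex.normSq_apply, Complex.normSq_apply]
  simp
  nlinarith

theorem hasDerivAt_discAut {w z : ℂ} (hw : ‖w‖ < 1) (hz : ‖z‖ < 1) :
    HasDerivAt (discAut w) ((1 - (‖w‖ : ℂ) ^ 2) / (1 - (starRingEnd ℂ) w * z) ^ 2) z := by
  have h0 := one_sub_conj_mul_ne_zero hw hz
  have h1 := ((hasDerivAt_id z).sub_const w).div
    (((hasDerivAt_id z).const_mul ((starRingEnd ℂ) w)).const_sub 1) h0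
  refine h1.congr_deriv ?_
  congr 1
  rw [← Complex.conj_mul']
  simp
  ring

theorem injOn_discAut {w : ℂ} (hw : ‖w‖ < 1) : InjOn (discAut w) (ball 0 1) := by
  intro x hx y hy h
  rw [mem_ball_zero_iff] at hx hy
  have hx0 := one_sub_conj_mul_ne_zero hw hx
  have hy0 := one_sub_conj_mul_ne_zero hw hy
  rw [discAut, discAut, div_eq_div_iff hx0 hy0] at h
  have h1 : (x - y) * (1 - (starRingEnd ℂ) w * w) = 0 := by linear_combination h
  exact sub_eq_zero.1 ((mul_eq_zero.1 h1).resolve_right (one_sub_conj_mul_ne_zero hw hw))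

theorem one_sub_sq_norm_ne_zero {w : ℂ} (hw : ‖w‖ < 1) : (1 - (‖w‖ : ℂ) ^ 2) ≠ 0 := by
  rw [← Complex.conj_mul']; exact one_sub_conj_mul_ne_zero hw hw

/-- The competitors in the extremal problem of the Riemann mapping theorem. -/
structure IsNormalizedEmbedding (U : Set ℂ) (z₀ : ℂ) (f : ℂ → ℂ) : Prop where
  differentiableOn : DifferentiableOn ℂ f U
  mapsTo : MapsTo f U (ball 0 1)
  injOn : InjOn f U
  deriv_ne_zero : ∀ z ∈ U, deriv f z ≠ 0
  map_zero : f z₀ = 0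

/-- For an omitted point `a` let `s` be a branch of the square root of `z - a`. The sets `s(U)` and
`-s(U)` are disjoint because `s²` is injective and `s` has no zeros. Since `s(U)` contains a disc
about `s x`, the function `s` stays away from `-s x`, and the reciprocal of `s + s x` is bounded. -/
theorem exists_mapsTo_ball_injOn_deriv_ne_zero {U : Set ℂ} (hU : IsOpen U)
    (hsc : IsSimplyConnected U) (hne : U ≠ univ) :
    ∃ f : ℂ → ℂ, MapsTo f U (ball 0 1) ∧ InjOn f U ∧ ∀ z ∈ U, deriv f z ≠ 0 := by
  obtain ⟨a, ha⟩ := (ne_univ_iff_exists_notMem U).1 hne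
  obtain ⟨l, hl, hle⟩ := exists_differentiableOn_exp_eq hU hsc (g := fun z => z - a)
    (by fun_prop) (fun z hz h => ha (by rwa [← sub_eq_zero.1 h]))
  set s : ℂ → ℂ := fun z => Complex.exp (l z / 2) with hs
  have hs2 : ∀ z ∈ U, s z * s z = z - a := fun z hz => by
    rw [hs, ← hle z hz]
    simp only [← Complex.exp_add]
    congr 1; ring
  have hs0 : ∀ z, s z ≠ 0 := fun z => Complex.exp_ne_zero _
  have hsdiff : DifferentiableOn ℂ s U := (hl.div_const 2).cexp
  have hsan : ∀ z ∈ U, AnalyticAt ℂ s z := fun z hz => hsdiff.analyticAt (hU.mem_nhds hz)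
  have hder : ∀ z ∈ U, deriv s z ≠ 0 := fun z hz h => by
    have h1 := (hsan z hz).differentiableAt.hasDerivAt
    have h2 : HasDerivAt (fun z => z - a) (deriv s z * s z + s z * deriv s z) z :=
      (h1.mul h1).congr_of_eventuallyEq (by
        filter_upwards [hU.mem_nhds hz] with v hv using (hs2 v hv).symm)
    have h3 := h2.unique ((hasDerivAt_id z).sub_const a)
    simp [h] at h3
  obtain ⟨x, hx⟩ := hsc.nonempty
  have hnhds : s '' U ∈ 𝓝 (s x) := by
    rw [← ((hsan x hx).hasStrictDerivAt).map_nhds_eq (hder x hx)]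
    exact image_mem_map (hU.mem_nhds hx)
  obtain ⟨ε, hε, hball⟩ := Metric.mem_nhds_iff.1 hnhds
  have hfar : ∀ z ∈ U, ε ≤ ‖s z + s x‖ := by
    intro z hz
    by_contra hlt
    obtain ⟨v, hv, hvs⟩ := hball (show -s z ∈ ball (s x) ε by
      rw [mem_ball, dist_eq_norm, ← norm_neg, neg_sub, sub_neg_eq_add, add_comm]
      exact not_le.1 hlt)
    have h1 : v = z := by
      have h2 := hs2 v hv
      rw [hvs, neg_mul_neg, hs2 z hz] at h2
      exact (sub_left_injective h2).symm
    rw [h1] at hvs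
    exact hs0 z (self_eq_neg.1 hvs)
  have hne0 : ∀ z ∈ U, s z + s x ≠ 0 := fun z hz =>
    norm_pos_iff.1 (hε.trans_le (hfar z hz))
  refine ⟨fun z => (ε / 2 : ℝ) / (s z + s x), fun z hz => ?_, fun z hz w hw h => ?_,
    fun z hz => ?_⟩
  · rw [mem_ball_zero_iff, norm_div, Complex.norm_real, Real.norm_of_nonneg (by positivity),
      div_lt_one (norm_pos_iff.2 (hne0 z hz))]
    linarith [hfar z hz]
  · have hε' : ((ε / 2 : ℝ) : ℂ) ≠ 0 := by exact_mod_cast (by positivity : ε / 2 ≠ 0)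
    have h1 : s z = s w := by
      rw [div_eq_div_iff (hne0 z hz) (hne0 w hw)] at h
      have := mul_left_cancel₀ hε' h
      linear_combination -this
    have h2 := hs2 z hz
    rw [h1, hs2 w hw] at h2
    exact (sub_left_injective h2).symm
  · have h1 := ((hsan z hz).differentiableAt.hasDerivAt.add_const (s x)).fun_inv (hne0 z hz)
    have h2 := h1.const_mul ((ε / 2 : ℝ) : ℂ)
    simp only [← div_eq_mul_inv] at h2
    rw [h2.deriv]
    have hε' : ((ε / 2 : ℝ) : ℂ) ≠ 0 := by exact_mod_cast (by positivity : ε / 2 ≠ 0)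
    exact mul_ne_zero hε' (div_ne_zero (neg_ne_zero.2 (hder z hz)) (pow_ne_zero 2 (hne0 z hz)))

theorem exists_isNormalizedEmbedding {U : Set ℂ} (hU : IsOpen U) (hsc : IsSimplyConnected U)
    (hne : U ≠ univ) {z₀ : ℂ} (hz₀ : z₀ ∈ U) : ∃ f, IsNormalizedEmbedding U z₀ f := by
  obtain ⟨f, hm, hi, hd⟩ := exists_mapsTo_ball_injOn_deriv_ne_zero hU hsc hne
  have hdf : ∀ z ∈ U, DifferentiableAt ℂ f z := fun z hz =>
    differentiableAt_of_deriv_ne_zero (hd z hz)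
  refine ⟨fun z => (f z - f z₀) / 2, fun z hz => (((hdf z hz).sub_const _).div_const
    _).differentiableWithinAt, fun z hz => ?_, fun x hx y hy h => ?_, fun z hz => ?_, by simp⟩
  · have h1 := hm hz
    have h2 := hm hz₀
    rw [mem_ball_zero_iff] at h1 h2 ⊢
    rw [norm_div, Complex.norm_ofNat, div_lt_one two_pos]
    exact (norm_sub_le _ _).trans_lt (by linarith)
  · refine hi hx hy ?_
    simpa using! h
  · rw [(((hdf z hz).hasDerivAt.sub_const (f z₀)).div_const 2).deriv]
    exact div_ne_zero (hd z hz) two_ne_zero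

/-- Compactness comes from an ultrafilter limit of a maximising sequence, which exists pointwise
because the values lie in a compact disc and is locally uniform by equicontinuity. The supremum is
positive, so the limit is not constant. Hurwitz's theorem then keeps injectivity and the
nonvanishing of the derivative, and the maximum principle keeps the values in the open disc. -/
theorem exists_isNormalizedEmbedding_isMax {U : Set ℂ} (hU : IsOpen U) (hsc : IsSimplyConnected U)
    (hne : U ≠ univ) {z₀ : ℂ} (hz₀ : z₀ ∈ U) :
    ∃ g, IsNormalizedEmbedding U z₀ g ∧
      ∀ f, IsNormalizedEmbedding U z₀ f → ‖deriv f z₀‖ ≤ ‖deriv g z₀‖ := by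
  obtain ⟨f₀, hf₀⟩ := exists_isNormalizedEmbedding hU hsc hne hz₀
  set D : Set ℝ := {x | ∃ f, IsNormalizedEmbedding U z₀ f ∧ x = ‖deriv f z₀‖} with hD
  have hDne : D.Nonempty := ⟨_, f₀, hf₀, rfl⟩
  have hDb : BddAbove D := by
    obtain ⟨d, hd, hdU⟩ := Metric.isOpen_iff.1 hU z₀ hz₀
    refine ⟨1 / d, ?_⟩
    rintro _ ⟨f, hf, rfl⟩
    refine Complex.norm_deriv_le_div_of_mapsTo_ball (hf.differentiableOn.mono hdU) ?_ hd
    rw [hf.map_zero]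
    exact fun v hv => ball_subset_closedBall (hf.mapsTo (hdU hv))
  obtain ⟨u, -, hut, hu⟩ := exists_seq_tendsto_sSup hDne hDb
  choose f hf hfu using hu
  set p : Filter ℕ := (hyperfilter ℕ : Filter ℕ)
  have hp : p ≤ atTop := Nat.hyperfilter_le_atTop
  have hex : ∀ z : ℂ, ∃ y, z ∈ U → Tendsto (fun n => f n z) p (𝓝 y) := by
    intro z
    by_cases hz : z ∈ U
    · have hc : IsCompact (closedBall (0 : ℂ) 1) := isCompact_closedBall 0 1
      obtain ⟨y, -, hy⟩ := hc.ultrafilter_le_nhds ((hyperfilter ℕ).map fun n => f n z) (by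
        rw [Ultrafilter.coe_map, le_principal_iff, mem_map]
        exact Eventually.of_forall fun n => ball_subset_closedBall ((hf n).mapsTo hz))
      exact ⟨y, fun _ => hy⟩
    · exact ⟨0, fun h => absurd h hz⟩
  choose g hg using hex
  have hloc : TendstoLocallyUniformlyOn f g p U :=
    tendstoLocallyUniformlyOn_of_tendsto_of_mapsTo hU (fun n => (hf n).differentiableOn)
      (fun n => (hf n).mapsTo) hg
  have hfd : ∀ᶠ n in p, DifferentiableOn ℂ (f n) U :=
    Eventually.of_forall fun n => (hf n).differentiableOn
  have hgd : DifferentiableOn ℂ g U := hloc.differentiableOn hfd hU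
  have hder := hloc.deriv hfd hU
  have hmax : ‖deriv g z₀‖ = sSup D := by
    have h1 : Tendsto (fun n => ‖deriv (f n) z₀‖) p (𝓝 ‖deriv g z₀‖) :=
      (hder.tendsto_at hz₀).norm
    refine tendsto_nhds_unique h1 ?_
    refine (hut.mono_left hp).congr fun n => ?_
    rw [hfu n]
  have hle : ∀ f, IsNormalizedEmbedding U z₀ f → ‖deriv f z₀‖ ≤ ‖deriv g z₀‖ := fun f hf => by
    rw [hmax]; exact le_csSup hDb ⟨f, hf, rfl⟩
  have hg0 : deriv g z₀ ≠ 0 := by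
    rw [← norm_pos_iff]
    exact (norm_pos_iff.2 (hf₀.deriv_ne_zero z₀ hz₀)).trans_le (hle f₀ hf₀)
  have hconn : IsPreconnected U := hsc.isPathConnected.isConnected.isPreconnected
  have hnc : ∀ c : ℂ, ¬ EqOn g (fun _ => c) U := by
    intro c hc
    refine hg0 ?_
    have : g =ᶠ[𝓝 z₀] fun _ => c := by
      filter_upwards [hU.mem_nhds hz₀] with w hw using hc hw
    rw [this.deriv_eq, deriv_const]
  have hle1 : ∀ z ∈ U, ‖g z‖ ≤ 1 := fun z hz =>
    le_of_tendsto (hg z hz).norm (Eventually.of_forall fun n =>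
      (mem_ball_zero_iff.1 ((hf n).mapsTo hz)).le)
  refine ⟨g, ⟨hgd, fun z hz => ?_, fun x hx y hy hxy => ?_, fun z hz h0 => ?_, ?_⟩, hle⟩
  · rw [mem_ball_zero_iff]
    refine (hle1 z hz).lt_of_ne fun h1 => hnc (g z) ?_
    exact Complex.eqOn_of_isPreconnected_of_isMaxOn_norm hconn hU hgd hz
      fun w hw => by simpa [h1] using hle1 w hw
  · by_contra hne'
    -- The differences `f n w - f n x` have no zero once `x` is removed from `U`, so a zero of the
    -- limit at `y` forces `g` to be constant.
    have hloc' : TendstoLocallyUniformlyOn (fun n w => f n w - f n x) (fun w => g w - g x) p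
        (U ∩ {x}ᶜ) := by
      have h1 : TendstoLocallyUniformlyOn (fun n _ => f n x) (fun _ : ℂ => g x) p U := by
        rw [Metric.tendstoLocallyUniformlyOn_iff]
        intro ε hε z hz
        refine ⟨univ, univ_mem, ?_⟩
        filter_upwards [(Metric.tendsto_nhds.1 (hg x hx)) ε hε] with n hn w _
        rwa [dist_comm]
      exact (TendstoLocallyUniformlyOn.sub hloc h1).mono inter_subset_left
    have hev := eventually_eq_zero_of_tendstoLocallyUniformlyOn
      (hU.inter isOpen_compl_singleton) hloc'
      (Eventually.of_forall fun n => ((hf n).differentiableOn.sub_const _).mono inter_subset_left)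
      (Eventually.of_forall fun n w hw h =>
        hw.2 ((hf n).injOn hw.1 hx (sub_eq_zero.1 h)))
      (z := y) ⟨hy, Ne.symm hne'⟩ (by rw [hxy, sub_self])
    refine hnc (g x) ?_
    exact (hgd.analyticOnNhd hU).eqOn_of_preconnected_of_eventuallyEq analyticOnNhd_const hconn hy
      (hev.mono fun w hw => sub_eq_zero.1 hw)
  · have hev := eventually_eq_zero_of_tendstoLocallyUniformlyOn hU hder
      (Eventually.of_forall fun n => (hf n).differentiableOn.deriv hU)
      (Eventually.of_forall fun n w hw => (hf n).deriv_ne_zero w hw) hz h0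
    exact hg0 (((hgd.deriv hU).analyticOnNhd hU).eqOn_of_preconnected_of_eventuallyEq
      analyticOnNhd_const hconn hz hev hz₀)
  · refine tendsto_nhds_unique (hg z₀ hz₀) ?_
    exact tendsto_const_nhds.congr fun n => ((hf n).map_zero).symm

/-- Koebe's square root trick: move the omitted value `w` to 0, take a square root `s`, and move `s
z₀` back to 0. With b = |s z₀| one has |w| = b², and the derivative at `z₀` grows by the factor (1 +
b²) / (2b) > 1. -/
theorem IsNormalizedEmbedding.exists_lt_of_notMem {U : Set ℂ} (hU : IsOpen U)
    (hsc : IsSimplyConnected U) {z₀ : ℂ} (hz₀ : z₀ ∈ U) {g : ℂ → ℂ}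
    (hg : IsNormalizedEmbedding U z₀ g) {w : ℂ} (hw : ‖w‖ < 1) (hwU : w ∉ g '' U) :
    ∃ f, IsNormalizedEmbedding U z₀ f ∧ ‖deriv g z₀‖ < ‖deriv f z₀‖ := by
  have hgU : ∀ z ∈ U, ‖g z‖ < 1 := fun z hz => mem_ball_zero_iff.1 (hg.mapsTo hz)
  have hgd : ∀ z ∈ U, HasDerivAt g (deriv g z) z := fun z hz =>
    (hg.differentiableOn.differentiableAt (hU.mem_nhds hz)).hasDerivAt
  have hq : ∀ z ∈ U, discAut w (g z) ≠ 0 := fun z hz h => by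
    rw [discAut, div_eq_zero_iff, or_iff_left (one_sub_conj_mul_ne_zero hw (hgU z hz)),
      sub_eq_zero] at h
    exact hwU ⟨z, hz, h⟩
  have hqd : ∀ z ∈ U, HasDerivAt (fun z => discAut w (g z)) _ z := fun z hz =>
    (hasDerivAt_discAut hw (hgU z hz)).comp z (hgd z hz)
  obtain ⟨l, hl, hle⟩ := exists_differentiableOn_exp_eq hU hsc
    (fun z hz => (hqd z hz).differentiableAt.differentiableWithinAt) hq
  set s : ℂ → ℂ := fun z => Complex.exp (l z / 2) with hs
  have hs2 : ∀ z ∈ U, s z * s z = discAut w (g z) := fun z hz => by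
    rw [hs, ← hle z hz]
    simp only [← Complex.exp_add]
    congr 1; ring
  have hs0 : ∀ z, s z ≠ 0 := fun z => Complex.exp_ne_zero _
  have hs1 : ∀ z ∈ U, ‖s z‖ < 1 := fun z hz => by
    have h1 := norm_discAut_lt_one hw (hgU z hz)
    rw [← hs2 z hz, norm_mul] at h1
    nlinarith [norm_nonneg (s z)]
  have hsdiff : DifferentiableOn ℂ s U := (hl.div_const 2).cexp
  have hsd : ∀ z ∈ U, HasDerivAt s (deriv s z) z := fun z hz =>
    (hsdiff.differentiableAt (hU.mem_nhds hz)).hasDerivAt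
  have hder : ∀ z ∈ U, 2 * s z * deriv s z =
      (1 - (‖w‖ : ℂ) ^ 2) / (1 - (starRingEnd ℂ) w * g z) ^ 2 * deriv g z := fun z hz => by
    have h1 : HasDerivAt (fun z => discAut w (g z)) (deriv s z * s z + s z * deriv s z) z :=
      ((hsd z hz).mul (hsd z hz)).congr_of_eventuallyEq (by
        filter_upwards [hU.mem_nhds hz] with v hv using (hs2 v hv).symm)
    rw [(hqd z hz).unique h1]; ring
  have hsder0 : ∀ z ∈ U, deriv s z ≠ 0 := fun z hz h => by
    have h1 := hder z hz
    rw [h, mul_zero, eq_comm, mul_eq_zero, div_eq_zero_iff] at h1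
    rcases h1 with (h1 | h1) | h1
    · exact one_sub_sq_norm_ne_zero hw h1
    · exact one_sub_conj_mul_ne_zero hw (hgU z hz) (pow_eq_zero_iff two_ne_zero |>.1 h1)
    · exact hg.deriv_ne_zero z hz h1
  have hb := hs1 z₀ hz₀
  have htd : ∀ z ∈ U, HasDerivAt (fun z => discAut (s z₀) (s z)) _ z := fun z hz =>
    (hasDerivAt_discAut hb (hs1 z hz)).comp z (hsd z hz)
  refine ⟨fun z => discAut (s z₀) (s z), ⟨fun z hz =>
    (htd z hz).differentiableAt.differentiableWithinAt, fun z hz => ?_, fun x hx y hy h => ?_,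
    fun z hz => ?_, by simp [discAut]⟩, ?_⟩
  · exact mem_ball_zero_iff.2 (norm_discAut_lt_one hb (hs1 z hz))
  · have h1 := injOn_discAut hb (mem_ball_zero_iff.2 (hs1 x hx)) (mem_ball_zero_iff.2 (hs1 y hy)) h
    have h2 : discAut w (g x) = discAut w (g y) := by rw [← hs2 x hx, ← hs2 y hy, h1]
    exact hg.injOn hx hy (injOn_discAut hw (hg.mapsTo hx) (hg.mapsTo hy) h2)
  · rw [(htd z hz).deriv]
    exact mul_ne_zero (div_ne_zero (one_sub_sq_norm_ne_zero hb)
      (pow_ne_zero 2 (one_sub_conj_mul_ne_zero hb (hs1 z hz)))) (hsder0 z hz)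
  · rw [(htd z₀ hz₀).deriv]
    set b := ‖s z₀‖ with hbdef
    have hb0 : 0 < b := norm_pos_iff.2 (hs0 z₀)
    have hwb : ‖w‖ = b ^ 2 := by
      have h1 := hs2 z₀ hz₀
      rw [hg.map_zero] at h1
      have h2 := congrArg norm h1
      simp only [discAut, norm_mul, mul_zero, sub_zero, div_one, zero_sub, norm_neg] at h2
      rw [← h2, sq]
    have h1 := hder z₀ hz₀
    rw [hg.map_zero, mul_zero, sub_zero, one_pow, div_one, hwb] at h1
    have h3 : ‖((1 : ℂ) - (((b ^ 2 : ℝ) : ℂ)) ^ 2)‖ = 1 - b ^ 4 := by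
      have : ((1 : ℂ) - (((b ^ 2 : ℝ) : ℂ)) ^ 2) = ((1 - b ^ 4 : ℝ) : ℂ) := by push_cast; ring
      rw [this, Complex.norm_real, Real.norm_of_nonneg]
      nlinarith [pow_le_one₀ (n := 4) hb0.le hb.le]
    have h2 := congrArg norm h1
    rw [norm_mul, norm_mul, norm_mul, h3, Complex.norm_ofNat, ← hbdef] at h2
    have hconj : 1 - (starRingEnd ℂ) (s z₀) * s z₀ = ((1 - b ^ 2 : ℝ) : ℂ) := by
      rw [Complex.conj_mul']; push_cast; rfl
    have hbb : 0 < 1 - b ^ 2 := by nlinarith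
    have h4 : (1 - ((b : ℝ) : ℂ) ^ 2) / (1 - (starRingEnd ℂ) (s z₀) * s z₀) ^ 2 =
        (((1 - b ^ 2)⁻¹ : ℝ) : ℂ) := by
      have : ((1 - b ^ 2 : ℝ) : ℂ) ≠ 0 := by exact_mod_cast hbb.ne'
      rw [hconj]
      push_cast at this ⊢
      field_simp
    rw [h4, norm_mul, Complex.norm_real, Real.norm_of_nonneg (inv_nonneg.2 hbb.le)]
    have hs' : 0 < ‖deriv s z₀‖ := norm_pos_iff.2 (hsder0 z₀ hz₀)
    rw [inv_mul_eq_div, lt_div_iff₀ hbb]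
    have h5 : ‖deriv g z₀‖ * (1 - b ^ 2) * (1 + b ^ 2) = 2 * b * ‖deriv s z₀‖ := by
      rw [h2]; ring
    have h6 : 2 * b < 1 + b ^ 2 := by nlinarith [sq_pos_of_pos (sub_pos.2 hb)]
    have h7 : ‖deriv g z₀‖ * (1 - b ^ 2) * (1 + b ^ 2) < ‖deriv s z₀‖ * (1 + b ^ 2) := by
      rw [h5]; nlinarith
    exact lt_of_mul_lt_mul_right h7 (by positivity)

/-- The **Riemann mapping theorem**. -/
theorem exists_riemann_map {U : Set ℂ} (hU : IsOpen U) (hsc : IsSimplyConnected U)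
    (hne : U ≠ univ) : ∃ g : ℂ → ℂ, DifferentiableOn ℂ g U ∧ BijOn g U (ball 0 1) ∧
      ∀ z ∈ U, deriv g z ≠ 0 := by
  obtain ⟨z₀, hz₀⟩ := hsc.nonempty
  obtain ⟨g, hg, hmax⟩ := exists_isNormalizedEmbedding_isMax hU hsc hne hz₀
  refine ⟨g, hg.differentiableOn, ⟨hg.mapsTo, hg.injOn, fun w hw => ?_⟩, hg.deriv_ne_zero⟩
  by_contra hwU
  obtain ⟨f, hf, hlt⟩ := hg.exists_lt_of_notMem hU hsc hz₀ (mem_ball_zero_iff.1 hw) hwU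
  exact absurd (hmax f hf) (not_le.2 hlt)

end LocallyUnivalent

/-! ### The Cauchy-Pompeiu formula and polynomial approximation on compact sets. -/

namespace LocallyUnivalent

open Metric MeasureTheory

/-- The Wirtinger derivative `∂F/∂z̄`. -/
noncomputable def dbar (F : ℂ → ℂ) (z : ℂ) : ℂ :=
  (1 / 2) * (fderiv ℝ F z 1 + Complex.I * fderiv ℝ F z Complex.I)

theorem continuous_dbar {F : ℂ → ℂ} (hF : ContDiff ℝ 1 F) : Continuous (dbar F) := by
  have h := hF.continuous_fderiv one_ne_zero
  unfold dbar
  fun_prop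

theorem dbar_eq_zero_of_eventuallyEq {F g : ℂ → ℂ} {z : ℂ} (h : F =ᶠ[𝓝 z] g)
    (hg : DifferentiableAt ℂ g z) : dbar F z = 0 := by
  have h1 : HasFDerivAt g ((fderiv ℂ g z).restrictScalars ℝ) z :=
    hg.hasFDerivAt.restrictScalars ℝ
  rw [dbar, h.fderiv_eq, h1.fderiv]
  have h2 : fderiv ℂ g z Complex.I = Complex.I * fderiv ℂ g z 1 := by
    rw [← smul_eq_mul, ← map_smul, smul_eq_mul, mul_one]
  simp only [ContinuousLinearMap.coe_restrictScalars', h2]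
  rw [← mul_assoc, Complex.I_mul_I]
  ring

theorem dbar_eq_zero_of_notMem_tsupport {F : ℂ → ℂ} {z : ℂ} (h : z ∉ tsupport F) :
    dbar F z = 0 :=
  dbar_eq_zero_of_eventuallyEq (notMem_tsupport_iff_eventuallyEq.1 h) (differentiableAt_const 0)

/-- Integration in polar coordinates of the `∂̄`-derivative against the Cauchy kernel. -/
theorem integral_dbar_div {F : ℂ → ℂ} (hF : ContDiff ℝ 1 F) (hc : HasCompactSupport F) (z : ℂ) :
    ∫ ζ, dbar F ζ / (z - ζ) = Real.pi * F z := by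
  have hcf := hF.continuous_fderiv one_ne_zero
  have hdiff : ∀ w, HasFDerivAt F (fderiv ℝ F w) w := fun w =>
    (hF.differentiable one_ne_zero w).hasFDerivAt
  obtain ⟨R, hR0, hR⟩ : ∃ R : ℝ, 0 < R ∧ ∀ w, R ≤ ‖w - z‖ → w ∉ tsupport F := by
    obtain ⟨R, hR⟩ := (Metric.isBounded_iff_subset_closedBall z).1 hc.isCompact.isBounded
    refine ⟨max R 0 + 1, by positivity, fun w hw hwt => ?_⟩
    have := hR hwt
    rw [mem_closedBall, dist_eq_norm] at this
    linarith [le_max_left R 0]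
  set u : ℝ → ℂ := fun θ => Real.cos θ + Real.sin θ * Complex.I with hu
  set u' : ℝ → ℂ := fun θ => -Real.sin θ + Real.cos θ * Complex.I with hu'
  have hud : ∀ θ, HasDerivAt u (u' θ) θ := fun θ =>
    (Real.hasDerivAt_cos θ).ofReal_comp.add
      ((Real.hasDerivAt_sin θ).ofReal_comp.mul_const Complex.I) |>.congr_deriv (by simp [hu'])
  have huc : Continuous u := by fun_prop
  have huc' : Continuous u' := by fun_prop
  have hun : ∀ θ, ‖u θ‖ = 1 := fun θ => by
    have := Complex.norm_exp_ofReal_mul_I θ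
    rwa [Complex.exp_mul_I, ← Complex.ofReal_cos, ← Complex.ofReal_sin] at this
  -- `A` is the radial derivative of `F` about `z`, and `r B` is the angular one. The Jacobian `r`
  -- cancels the Cauchy kernel, so the integrand becomes -(A + iB) / 2. Integration of `A` over the
  -- radius gives `-F z`, and integration of `B` over the angle gives 0 by periodicity.
  set A : ℝ × ℝ → ℂ := fun p => fderiv ℝ F (z + p.1 * u p.2) (u p.2) with hA
  set B : ℝ × ℝ → ℂ := fun p => fderiv ℝ F (z + p.1 * u p.2) (u' p.2) with hB
  have hAc : Continuous A := by
    have : Continuous fun p : ℝ × ℝ => fderiv ℝ F (z + p.1 * u p.2) := hcf.comp (by fun_prop)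
    exact this.clm_apply (by fun_prop)
  have hBc : Continuous B := by
    have : Continuous fun p : ℝ × ℝ => fderiv ℝ F (z + p.1 * u p.2) := hcf.comp (by fun_prop)
    exact this.clm_apply (by fun_prop)
  set Q : Set (ℝ × ℝ) := Ioc 0 R ×ˢ Ioo (-Real.pi) Real.pi with hQ
  have hint : ∀ D : ℝ × ℝ → ℂ, Continuous D → IntegrableOn D Q (volume.prod volume) :=
    fun D hD => (hD.continuousOn.integrableOn_compact
      (isCompact_Icc.prod isCompact_Icc : IsCompact (Icc 0 R ×ˢ Icc (-Real.pi) Real.pi))).mono_set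
      (prod_mono Ioc_subset_Icc_self Ioo_subset_Icc_self)
  have hint' : ∀ D : ℝ × ℝ → ℂ, Continuous D → Integrable D (volume.restrict Q) := hint
  have hAint : ∫ p in Q, A p = -(2 * Real.pi * F z) := by
    rw [Measure.volume_eq_prod, ← setIntegral_prod_swap, setIntegral_prod _
      (show IntegrableOn (fun p : ℝ × ℝ => A p.swap) _ _ from (hint A hAc).swap)]
    have h1 : ∀ θ : ℝ, ∫ r in Ioc 0 R, A (r, θ) = -F z := by
      intro θ
      rw [← intervalIntegral.integral_of_le hR0.le,
        intervalIntegral.integral_eq_sub_of_hasDerivAt (f := fun r : ℝ => F (z + r * u θ))]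
      · have : F (z + R * u θ) = 0 := by
          refine image_eq_zero_of_notMem_tsupport (hR _ ?_)
          rw [add_sub_cancel_left, norm_mul, hun, mul_one, Complex.norm_real,
            Real.norm_of_nonneg hR0.le]
        simp [this]
      · intro r _
        have h2 : HasDerivAt (fun r : ℝ => z + r * u θ) (u θ) r := by
          simpa using ((Complex.ofRealCLM.hasDerivAt (x := r)).mul_const (u θ)).const_add z
        exact (hdiff (z + r * u θ)).comp_hasDerivAt r h2
      · exact (by fun_prop : Continuous fun r : ℝ => A (r, θ)).intervalIntegrable _ _
    simp only [Prod.swap_prod_mk, h1]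
    rw [setIntegral_const, measureReal_def, Real.volume_Ioo,
      ENNReal.toReal_ofReal (by linarith [Real.pi_pos]), Complex.real_smul]
    push_cast; ring
  have hBint : ∫ p in Q, B p = 0 := by
    rw [Measure.volume_eq_prod, setIntegral_prod _ (hint B hBc)]
    refine setIntegral_eq_zero_of_forall_eq_zero fun r hr => ?_
    rw [← integral_Ioc_eq_integral_Ioo, ← intervalIntegral.integral_of_le
      (by linarith [Real.pi_pos])]
    have h2 : ∫ θ in (-Real.pi)..Real.pi, (r : ℝ) • B (r, θ) = 0 := by
      rw [intervalIntegral.integral_eq_sub_of_hasDerivAt (f := fun θ : ℝ => F (z + r * u θ))]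
      · simp [hu]
      · intro θ _
        have h2 : HasDerivAt (fun θ : ℝ => z + r * u θ) (r * u' θ) θ :=
          ((hud θ).const_mul (r : ℂ)).const_add z
        refine ((hdiff (z + r * u θ)).comp_hasDerivAt θ h2).congr_deriv ?_
        change fderiv ℝ F (z + r * u θ) (r * u' θ) = _
        exact (congrArg _ Complex.real_smul.symm).trans (map_smul _ _ _)
      · exact (by fun_prop : Continuous fun θ : ℝ => r • B (r, θ)).intervalIntegrable _ _
    rw [intervalIntegral.integral_smul] at h2
    exact (smul_eq_zero.1 h2).resolve_left hr.1.ne'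
  rw [← integral_add_left_eq_self _ z, ← Complex.integral_comp_polarCoord_symm]
  have hsub : Q ⊆ polarCoord.target := prod_mono (fun r hr => hr.1) subset_rfl
  have hpt : ∀ p ∈ polarCoord.target, p.1 • (dbar F (z + Complex.polarCoord.symm p) /
      (z - (z + Complex.polarCoord.symm p))) = -(1 / 2) * (A p + Complex.I * B p) := by
    intro p hp
    have hp1 : (p.1 : ℂ) ≠ 0 := by exact_mod_cast (show (0 : ℝ) < p.1 from hp.1).ne'
    have hup : u p.2 ≠ 0 := norm_pos_iff.1 (by rw [hun]; exact one_pos)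
    rw [Complex.polarCoord_symm_apply]
    change p.1 • (dbar F (z + p.1 * u p.2) / (z - (z + p.1 * u p.2))) = _
    set L := fderiv ℝ F (z + p.1 * u p.2) with hL
    have hlin : ∀ a b : ℝ, L (a + b * Complex.I) = a * L 1 + b * L Complex.I := fun a b => by
      have : (a + b * Complex.I : ℂ) = a • (1 : ℂ) + b • Complex.I := by simp
      rw [this, map_add, map_smul, map_smul, Complex.real_smul, Complex.real_smul]
    have hAp : A p = Real.cos p.2 * L 1 + Real.sin p.2 * L Complex.I := hlin _ _
    have hBp : B p = -Real.sin p.2 * L 1 + Real.cos p.2 * L Complex.I := by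
      have := hlin (-Real.sin p.2) (Real.cos p.2)
      rw [Complex.ofReal_neg] at this
      rw [← this]
    rw [hAp, hBp, dbar, ← hL, Complex.real_smul]
    have hcs : (Real.cos p.2 : ℂ) ^ 2 + (Real.sin p.2 : ℂ) ^ 2 = 1 := by
      rw [add_comm]; exact_mod_cast Real.sin_sq_add_cos_sq p.2
    have hI := Complex.I_sq
    have key : u p.2 * (Real.cos p.2 - Real.sin p.2 * Complex.I) = 1 := by
      simp only [hu]
      linear_combination hcs - (Real.sin p.2 : ℂ) ^ 2 * hI
    field_simp
    rw [show z - (z + (p.1 : ℂ) * u p.2) = -(p.1 * u p.2) by ring]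
    linear_combination (-(p.1 : ℂ) * (L 1 + Complex.I * L Complex.I)) * key -
      (p.1 * u p.2 * (L Complex.I * Real.sin p.2)) * hI
  rw [setIntegral_congr_fun polarCoord.open_target.measurableSet hpt,
    setIntegral_eq_of_subset_of_forall_sdiff_eq_zero polarCoord.open_target.measurableSet hsub]
  · rw [integral_const_mul, integral_add (hint' A hAc) ((hint' B hBc).const_mul _),
      integral_const_mul, hAint, hBint]
    ring
  · intro p hp
    have h0 : R < p.1 := by
      by_contra hle
      exact hp.2 ⟨⟨hp.1.1, not_lt.1 hle⟩, hp.1.2⟩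
    have h1 : fderiv ℝ F (z + p.1 * u p.2) = 0 := by
      have hnt : z + p.1 * u p.2 ∉ tsupport F := by
        refine hR _ ?_
        rw [add_sub_cancel_left, norm_mul, hun, mul_one, Complex.norm_real,
          Real.norm_of_nonneg (hR0.le.trans h0.le)]
        exact h0.le
      rw [(notMem_tsupport_iff_eventuallyEq.1 hnt).fderiv_eq]
      simp
    simp [hA, hB, h1]

/-- In polar coordinates the Jacobian cancels the singularity, which leaves the area of a rectangle
with sides `s` and 2π. -/
theorem lintegral_ball_inv_norm_le (z : ℂ) {s : ℝ} (hs : 0 < s) :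
    ∫⁻ ζ in ball z s, ENNReal.ofReal ‖z - ζ‖⁻¹ ≤ ENNReal.ofReal (2 * Real.pi * s) := by
  have h1 : ∫⁻ ζ in ball z s, ENNReal.ofReal ‖z - ζ‖⁻¹ =
      ∫⁻ ζ, (ball (0 : ℂ) s).indicator (fun ζ => ENNReal.ofReal ‖ζ‖⁻¹) ζ := by
    rw [← lintegral_indicator measurableSet_ball,
      ← lintegral_add_left_eq_self (μ := (volume : Measure ℂ)) _ z]
    congr 1 with ζ
    simp [indicator, mem_ball, dist_eq_norm]
  rw [h1, ← Complex.lintegral_comp_polarCoord_symm]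
  calc _ ≤ ∫⁻ p in polarCoord.target, (Ioo 0 s ×ˢ Ioo (-Real.pi) Real.pi).indicator 1 p := by
        refine setLIntegral_mono' polarCoord.open_target.measurableSet fun p hp => ?_
        have hp1 : 0 < p.1 := hp.1
        by_cases hps : p.1 < s
        · rw [indicator_of_mem (show p ∈ Ioo 0 s ×ˢ Ioo (-Real.pi) Real.pi from
            ⟨⟨hp1, hps⟩, hp.2⟩), indicator_of_mem (by
              rw [mem_ball_zero_iff, Complex.norm_polarCoord_symm, abs_of_pos hp1]; exact hps),
            Complex.norm_polarCoord_symm, abs_of_pos hp1, smul_eq_mul,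
            ← ENNReal.ofReal_mul hp1.le, mul_inv_cancel₀ hp1.ne']
          simp
        · rw [indicator_of_notMem (by
              rw [mem_ball_zero_iff, Complex.norm_polarCoord_symm, abs_of_pos hp1]; exact hps)]
          simp
    _ ≤ ∫⁻ p, (Ioo 0 s ×ˢ Ioo (-Real.pi) Real.pi).indicator 1 p := setLIntegral_le_lintegral _ _
    _ = volume (Ioo 0 s ×ˢ Ioo (-Real.pi) Real.pi) := by
        rw [lintegral_indicator_one (measurableSet_Ioo.prod measurableSet_Ioo)]
    _ ≤ _ := by
        rw [Measure.volume_eq_prod, Measure.prod_prod, Real.volume_Ioo, Real.volume_Ioo,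
          ← ENNReal.ofReal_mul (by linarith)]
        refine ENNReal.ofReal_le_ofReal (le_of_eq ?_)
        ring

/-- The kernel is integrated over the ball of radius `s` and bounded by `s⁻¹` outside. The bound is
uniform in `z` and becomes small by choosing first `s` and then `N` of small area. -/
theorem lintegral_inv_norm_le (z : ℂ) {s : ℝ} (hs : 0 < s) (N : Set ℂ) :
    ∫⁻ ζ in N, ENNReal.ofReal ‖z - ζ‖⁻¹ ≤
      ENNReal.ofReal (2 * Real.pi * s) + ENNReal.ofReal s⁻¹ * volume N := by
  calc ∫⁻ ζ in N, ENNReal.ofReal ‖z - ζ‖⁻¹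
      ≤ ∫⁻ ζ in N, ((ball z s).indicator (fun ζ => ENNReal.ofReal ‖z - ζ‖⁻¹) ζ +
          ENNReal.ofReal s⁻¹) := by
        refine lintegral_mono fun ζ => ?_
        by_cases hζ : ζ ∈ ball z s
        · rw [indicator_of_mem hζ]; exact le_self_add
        · rw [indicator_of_notMem hζ, zero_add]
          refine ENNReal.ofReal_le_ofReal (inv_anti₀ hs ?_)
          rw [mem_ball, dist_comm, dist_eq_norm, not_lt] at hζ
          exact hζ
    _ = (∫⁻ ζ in N, (ball z s).indicator (fun ζ => ENNReal.ofReal ‖z - ζ‖⁻¹) ζ) +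
          ENNReal.ofReal s⁻¹ * volume N := by
        rw [lintegral_add_right _ measurable_const, setLIntegral_const]
    _ ≤ _ := by
        gcongr
        refine (setLIntegral_le_lintegral _ _).trans ?_
        rw [lintegral_indicator measurableSet_ball]
        exact lintegral_ball_inv_norm_le z hs

-- The spectrum of the coordinate function in C(C, ℂ) is `C`. Passing to the closed subalgebra
-- generated by the polynomials can add to the spectrum only bounded components of the complement.
-- So `a - z` remains invertible within the subalgebra when the component of `a` is unbounded.
open Polynomial in
theorem exists_mem_closure_polynomialFunctions {C : Set ℂ} [CompactSpace C]
    {a : ℂ} (ha : a ∉ C) (hunb : ¬ Bornology.IsBounded (connectedComponentIn Cᶜ a)) :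
    ∃ r ∈ (polynomialFunctions C).topologicalClosure, ∀ z : C, r z = ((z : ℂ) - a)⁻¹ := by
  set S := (polynomialFunctions C).topologicalClosure with hS
  have : IsClosed (S : Set C(C, ℂ)) := Subalgebra.isClosed_topologicalClosure _
  let x : S := ⟨toContinuousMapOn X C,
    Subalgebra.le_topologicalClosure _ ⟨X, trivial, rfl⟩⟩
  have hsp : spectrum ℂ (x : C(C, ℂ)) = C := by
    rw [ContinuousMap.spectrum_eq_range]
    ext w
    simp [x]
  have hxa : a ∉ spectrum ℂ x := fun h => hunb (by
    have := Subalgebra.spectrum_isBounded_connectedComponentIn S x h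
    rwa [hsp] at this)
  rw [spectrum.notMem_iff] at hxa
  obtain ⟨v, hv⟩ := hxa.exists_right_inv
  refine ⟨-(v : C(C, ℂ)), neg_mem v.2, fun z => ?_⟩
  have h1 := congrArg (fun y : S => (y : C(C, ℂ)) z) hv
  have h2 : (a - z) * (v : C(C, ℂ)) z = 1 := by simpa [x] using h1
  have h3 : (z : ℂ) - a ≠ 0 := fun h => ha (by rw [← sub_eq_zero.1 h]; exact z.2)
  refine eq_inv_of_mul_eq_one_left ?_
  rw [← h2, ContinuousMap.neg_apply]
  ring

/-- Polynomial approximation on a compact set that does not separate the plane, of smooth functions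
that satisfy the Cauchy-Riemann equation almost everywhere on the set. -/
theorem exists_polynomial_norm_sub_lt {C : Set ℂ} (hC : IsCompact C)
    (hunb : ∀ a ∉ C, ¬ Bornology.IsBounded (connectedComponentIn Cᶜ a)) {F : ℂ → ℂ}
    (hF : ContDiff ℝ 1 F) (hc : HasCompactSupport F)
    (hnull : volume {z ∈ C | dbar F z ≠ 0} = 0) {ε : ℝ} (hε : 0 < ε) :
    ∃ p : Polynomial ℂ, ∀ z ∈ C, ‖p.eval z - F z‖ < ε := by
  have : CompactSpace C := isCompact_iff_compactSpace.1 hC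
  set S := (polynomialFunctions C).topologicalClosure with hS
  have hScl : IsClosed (S : Set C(C, ℂ)) := Subalgebra.isClosed_topologicalClosure _
  have : CompleteSpace S := hScl.completeSpace_coe
  have hdc := continuous_dbar hF
  have hds : HasCompactSupport (dbar F) :=
    hc.mono' fun z hz => by_contra fun h => hz (dbar_eq_zero_of_notMem_tsupport h)
  obtain ⟨M, hM⟩ := hds.exists_bound_of_continuous hdc
  have hM0 : 0 ≤ M := (norm_nonneg _).trans (hM 0)
  -- `s` and `η` are chosen so that M (2πs + η / s) < ε / 2, which bounds the contribution of a set
  -- of area `η`. The summand 1 in the denominators covers `M = 0`.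
  obtain ⟨s, hs, hsε⟩ : ∃ s > 0, M * (2 * Real.pi * s) < ε / 4 :=
    ⟨ε / 4 / (M * (2 * Real.pi) + 1), by positivity, by
      rw [← mul_assoc, mul_div_assoc', div_lt_iff₀ (by positivity)]
      nlinarith⟩
  obtain ⟨η, hη, hηε⟩ : ∃ η > 0, M * (s⁻¹ * η) < ε / 4 :=
    ⟨ε / 4 / (M * s⁻¹ + 1), by positivity, by
      rw [← mul_assoc, mul_div_assoc', div_lt_iff₀ (by positivity)]
      nlinarith⟩
  obtain ⟨E, hCE, hEo, hE⟩ := hC.exists_isOpen_lt_add (μ := volume)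
    (ENNReal.ofReal_pos.2 hη).ne'
  have hEC : volume (E \ C) ≤ ENNReal.ofReal η := by
    rw [measure_sdiff hCE hC.measurableSet.nullMeasurableSet hC.measure_ne_top]
    exact tsub_le_iff_left.2 hE.le
  -- The kernels with pole in `K` are continuous on `C`. The rest of the support lies in `E`, that
  -- is, in `C` or in the set `E \ C` of small area.
  set K := tsupport F \ E with hK
  have hKc : IsCompact K := hc.isCompact.diff hEo
  have hKC : ∀ ζ ∈ K, ζ ∉ C := fun ζ hζ h => hζ.2 (hCE h)
  have hmeas : ∀ z : ℂ, AEStronglyMeasurable (fun ζ => dbar F ζ / (z - ζ)) volume := fun z =>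
    (hdc.measurable.div (measurable_const.sub measurable_id)).aestronglyMeasurable
  have henorm : ∀ z ζ : ℂ, ‖dbar F ζ / (z - ζ)‖ₑ ≤
      ENNReal.ofReal M * ENNReal.ofReal ‖z - ζ‖⁻¹ := fun z ζ => by
    rw [← ENNReal.ofReal_mul hM0, ← ofReal_norm, norm_div, div_eq_mul_inv]
    exact ENNReal.ofReal_le_ofReal (mul_le_mul_of_nonneg_right (hM ζ) (by positivity))
  have hint : ∀ z : ℂ, Integrable (fun ζ => dbar F ζ / (z - ζ)) := fun z => by
    have h1 : IntegrableOn (fun ζ => dbar F ζ / (z - ζ)) (tsupport F) := by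
      refine ⟨(hmeas z).restrict, ?_⟩
      calc ∫⁻ ζ in tsupport F, ‖dbar F ζ / (z - ζ)‖ₑ
          ≤ ∫⁻ ζ in tsupport F, ENNReal.ofReal M * ENNReal.ofReal ‖z - ζ‖⁻¹ :=
            lintegral_mono fun ζ => henorm z ζ
        _ = ENNReal.ofReal M * ∫⁻ ζ in tsupport F, ENNReal.ofReal ‖z - ζ‖⁻¹ :=
            lintegral_const_mul' _ _ ENNReal.ofReal_ne_top
        _ < ⊤ := by
            refine ENNReal.mul_lt_top ENNReal.ofReal_lt_top
              ((lintegral_inv_norm_le z one_pos _).trans_lt ?_)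
            exact ENNReal.add_lt_top.2 ⟨ENNReal.ofReal_lt_top,
              ENNReal.mul_lt_top ENNReal.ofReal_lt_top hc.isCompact.measure_lt_top⟩
    exact (integrableOn_iff_integrable_of_support_subset fun ζ hζ => by
      by_contra h
      exact hζ (by simp [dbar_eq_zero_of_notMem_tsupport h])).1 h1
  have hex : ∀ ζ, ∃ r : S, ζ ∉ C → ∀ z : C, (r : C(C, ℂ)) z = ((z : ℂ) - ζ)⁻¹ := fun ζ => by
    by_cases h : ζ ∈ C
    · exact ⟨0, fun h' => absurd h h'⟩
    · obtain ⟨r, hr, hr'⟩ := exists_mem_closure_polynomialFunctions h (hunb ζ h)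
      exact ⟨⟨r, hr⟩, fun _ => hr'⟩
  choose r hr using hex
  have hrc : ContinuousOn r K := by
    rw [continuousOn_iff_continuous_domRestrict, Topology.IsInducing.subtypeVal.continuous_iff]
    refine ContinuousMap.continuous_of_continuous_uncurry _ ?_
    have h1 : Continuous fun q : K × C => ((q.2 : ℂ) - (q.1 : ℂ))⁻¹ :=
      (by fun_prop : Continuous fun q : K × C => ((q.2 : ℂ) - (q.1 : ℂ))).inv₀ fun q h =>
        hKC q.1 q.1.2 (by rw [← sub_eq_zero.1 h]; exact q.2.2)
    refine h1.congr fun q => ?_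
    simp [Function.uncurry, Set.domRestrict, hr q.1 (hKC q.1 q.1.2) q.2]
  have hGi : IntegrableOn (fun ζ => dbar F ζ • r ζ) K :=
    (hdc.continuousOn.smul hrc).integrableOn_compact hKc
  -- A Bochner integral in the complete space `S`, so the superposition of Cauchy kernels is itself
  -- a uniform limit of polynomials.
  set v : S := ∫ ζ in K, dbar F ζ • r ζ with hv
  have hvz : ∀ z : C, (v : C(C, ℂ)) z = ∫ ζ in K, dbar F ζ / ((z : ℂ) - ζ) := fun z => by
    let L : S →L[ℂ] ℂ := (ContinuousMap.evalCLM ℂ z).comp (Subalgebra.toSubmodule S).subtypeL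
    have h1 : L v = (v : C(C, ℂ)) z := rfl
    rw [← h1, hv, ← ContinuousLinearMap.integral_comp_comm L hGi]
    refine setIntegral_congr_fun hKc.measurableSet fun ζ hζ => ?_
    have h2 : L (dbar F ζ • r ζ) = dbar F ζ * (r ζ : C(C, ℂ)) z := by
      rw [map_smul]; rfl
    simp only [h2, hr ζ (hKC ζ hζ) z, div_eq_mul_inv]
  have hclose : ∀ z : C, ‖(v : C(C, ℂ)) z - Real.pi * F z‖ ≤ ε / 2 := fun z => by
    rw [hvz, ← integral_dbar_div hF hc, ← integral_add_compl hKc.measurableSet (hint z),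
      sub_add_cancel_left, norm_neg]
    -- Outside `K` the derivative `dbar F` is almost everywhere supported in `E \ C`: on `C` it
    -- vanishes almost everywhere, and off the support of `F` it vanishes.
    have hae : ∀ᵐ ζ ∂(volume : Measure ℂ), ζ ∈ Kᶜ → ζ ∉ E \ C → dbar F ζ = 0 := by
      filter_upwards [measure_eq_zero_iff_ae_notMem.1 hnull] with ζ hζ hζK hζE
      by_cases hζC : ζ ∈ C
      · by_contra h0; exact hζ ⟨hζC, h0⟩
      · refine dbar_eq_zero_of_notMem_tsupport fun ht => ?_
        exact hζK ⟨ht, fun hE => hζE ⟨hE, hζC⟩⟩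
    have h1 : ∫⁻ ζ in Kᶜ, ‖dbar F ζ / ((z : ℂ) - ζ)‖ₑ ≤
        ENNReal.ofReal M * (ENNReal.ofReal (2 * Real.pi * s) +
          ENNReal.ofReal s⁻¹ * ENNReal.ofReal η) := by
      calc ∫⁻ ζ in Kᶜ, ‖dbar F ζ / ((z : ℂ) - ζ)‖ₑ
          ≤ ∫⁻ ζ in Kᶜ, (E \ C).indicator
              (fun ζ => ENNReal.ofReal M * ENNReal.ofReal ‖(z : ℂ) - ζ‖⁻¹) ζ := by
            refine setLIntegral_mono_ae' hKc.measurableSet.compl ?_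
            filter_upwards [hae] with ζ hζ hζK
            by_cases h : ζ ∈ E \ C
            · rw [indicator_of_mem h]; exact henorm z ζ
            · simp [hζ hζK h]
        _ ≤ ∫⁻ ζ in E \ C, ENNReal.ofReal M * ENNReal.ofReal ‖(z : ℂ) - ζ‖⁻¹ := by
            refine (setLIntegral_le_lintegral _ _).trans ?_
            rw [lintegral_indicator (hEo.measurableSet.diff hC.measurableSet)]
        _ = ENNReal.ofReal M * ∫⁻ ζ in E \ C, ENNReal.ofReal ‖(z : ℂ) - ζ‖⁻¹ :=
            lintegral_const_mul' _ _ ENNReal.ofReal_ne_top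
        _ ≤ _ := by
            gcongr
            refine (lintegral_inv_norm_le z hs _).trans ?_
            gcongr
    have h2 : ENNReal.ofReal M * (ENNReal.ofReal (2 * Real.pi * s) +
          ENNReal.ofReal s⁻¹ * ENNReal.ofReal η) ≤ ENNReal.ofReal (ε / 2) := by
      rw [← ENNReal.ofReal_mul (by positivity), ← ENNReal.ofReal_add (by positivity)
        (by positivity), ← ENNReal.ofReal_mul hM0]
      refine ENNReal.ofReal_le_ofReal ?_
      linarith
    have h3 := (enorm_integral_le_lintegral_enorm _).trans (h1.trans h2)
    rw [← ofReal_norm, ENNReal.ofReal_le_ofReal_iff (by positivity)] at h3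
    exact h3
  have hw : ((1 / Real.pi : ℂ) • (v : C(C, ℂ))) ∈ S := S.smul_mem v.2 _
  have hw' : ((1 / Real.pi : ℂ) • (v : C(C, ℂ))) ∈
      closure ((polynomialFunctions C : Subalgebra ℂ C(C, ℂ)) : Set C(C, ℂ)) := hw
  obtain ⟨q, hq, hqd⟩ := Metric.mem_closure_iff.1 hw' (ε / 2) (by positivity)
  obtain ⟨p, -, rfl⟩ := hq
  refine ⟨p, fun z hz => ?_⟩
  have h1 : ‖(1 / Real.pi : ℂ) * (v : C(C, ℂ)) ⟨z, hz⟩ - p.eval z‖ < ε / 2 := by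
    have := (ContinuousMap.dist_apply_le_dist (f := (1 / Real.pi : ℂ) • (v : C(C, ℂ)))
      (g := Polynomial.toContinuousMapOnAlgHom C p) ⟨z, hz⟩).trans_lt hqd
    rw [dist_eq_norm] at this
    simpa using this
  have hpi : (Real.pi : ℂ) ≠ 0 := by exact_mod_cast Real.pi_ne_zero
  have h2 : ‖(1 / Real.pi : ℂ) * (v : C(C, ℂ)) ⟨z, hz⟩ - F z‖ ≤ ε / 2 := by
    have h3 : (1 / Real.pi : ℂ) * (v : C(C, ℂ)) ⟨z, hz⟩ - F z =
        (Real.pi : ℂ)⁻¹ * ((v : C(C, ℂ)) ⟨z, hz⟩ - Real.pi * F z) := by field_simp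
    rw [h3, norm_mul, norm_inv, Complex.norm_real, Real.norm_of_nonneg Real.pi_pos.le]
    have h4 : Real.pi⁻¹ ≤ 1 := inv_le_one_of_one_le₀ (by linarith [Real.pi_gt_three])
    exact (mul_le_of_le_one_left (norm_nonneg _) h4).trans (hclose ⟨z, hz⟩)
  calc ‖p.eval z - F z‖ ≤ ‖p.eval z - (1 / Real.pi : ℂ) * (v : C(C, ℂ)) ⟨z, hz⟩‖ +
        ‖(1 / Real.pi : ℂ) * (v : C(C, ℂ)) ⟨z, hz⟩ - F z‖ := norm_sub_le_norm_sub_add_norm_sub _ _ _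
    _ < ε := by rw [norm_sub_rev]; linarith

end LocallyUnivalent

/-! ### Compact sets that do not separate the plane, by continuous logarithms. -/

namespace LocallyUnivalent

open Metric

theorem _root_.Convex.isSimplyConnected {E : Type*} [AddCommGroup E] [Module ℝ E]
    [TopologicalSpace E] [ContinuousAdd E] [ContinuousSMul ℝ E] {s : Set E} (hs : Convex ℝ s)
    (hne : s.Nonempty) : IsSimplyConnected s := by
  have := hs.contractibleSpace hne
  exact SimplyConnectedSpace.ofContractible s

/-- The function `z - a` has a continuous logarithm on `C`. -/
def HasLogOn (C : Set ℂ) (a : ℂ) : Prop :=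
  ∃ l : ℂ → ℂ, ContinuousOn l C ∧ ∀ z ∈ C, Complex.exp (l z) = z - a

/-- There is no continuous logarithm on a circle around `a`. -/
theorem not_continuous_exp_eq_sub {L : ℂ → ℂ} (hL : Continuous L) {a : ℂ} {R : ℝ} (hR : 0 < R)
    (h : ∀ z, ‖z - a‖ = R → Complex.exp (L z) = z - a) : False := by
  set c : ℝ → ℂ := fun θ => a + R * Complex.exp (θ * Complex.I) with hc
  have hcc : Continuous c := by fun_prop
  -- The integer `n θ` varies continuously and so is constant. But `L (c θ)` is 2π-periodic while `θ
  -- * I` grows by 2πi over one turn.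
  have hn : ∀ θ, ∃ n : ℤ, L (c θ) - θ * Complex.I - Real.log R = n * (2 * Real.pi * Complex.I) :=
    fun θ => by
      rw [← Complex.exp_eq_one_iff, Complex.exp_sub, Complex.exp_sub, h]
      · have hR' : (R : ℂ) ≠ 0 := by exact_mod_cast hR.ne'
        rw [← Complex.ofReal_exp, Real.exp_log hR]
        simp only [hc, add_sub_cancel_left]
        have := Complex.exp_ne_zero (θ * Complex.I)
        field_simp
      · simp [hc, Complex.norm_exp_ofReal_mul_I, abs_of_pos hR]
  choose n hn using hn
  have h2 : (2 * Real.pi * Complex.I : ℂ) ≠ 0 := Complex.two_pi_I_ne_zero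
  have hnc : Continuous n := by
    rw [Int.isClosedEmbedding_coe_real.isInducing.continuous_iff]
    have h1 : Continuous fun θ : ℝ =>
        ((L (c θ) - θ * Complex.I - Real.log R) / (2 * Real.pi * Complex.I)).re :=
      Complex.continuous_re.comp (by fun_prop)
    refine h1.congr fun θ => ?_
    rw [hn, mul_div_assoc, div_self h2, mul_one]
    simp
  have hconst : n 0 = n (2 * Real.pi) :=
    PreconnectedSpace.constant inferInstance hnc
  have h0 := hn 0
  have h1 := hn (2 * Real.pi)
  have hper : c (2 * Real.pi) = c 0 := by
    simp [hc, Complex.exp_two_pi_mul_I]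
  rw [hper, ← hconst, ← h0] at h1
  push_cast at h1
  apply h2
  linear_combination -h1

/-- A half of Borsuk's separation criterion. -/
theorem HasLogOn.not_isBounded_connectedComponentIn {C : Set ℂ} (hC : IsCompact C) {a : ℂ}
    (ha : a ∉ C) (h : HasLogOn C a) : ¬ Bornology.IsBounded (connectedComponentIn Cᶜ a) := by
  intro hb
  set V := connectedComponentIn Cᶜ a with hV
  have haV : a ∈ V := mem_connectedComponentIn ha
  have hVo : IsOpen V := hC.isClosed.isOpen_compl.connectedComponentIn
  -- The component of a frontier point outside `C` would meet `V`, hence equal `V`, although the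
  -- open set `V` contains none of its frontier points.
  have hfr : frontier V ⊆ C := by
    intro z hz
    by_contra hzC
    have hzo : IsOpen (connectedComponentIn Cᶜ z) := hC.isClosed.isOpen_compl.connectedComponentIn
    obtain ⟨w, hw1, hw2⟩ := mem_closure_iff.1 (frontier_subset_closure hz) _ hzo
      (mem_connectedComponentIn hzC)
    have : z ∈ V := by
      rw [hV, connectedComponentIn_eq hw2, ← connectedComponentIn_eq hw1]
      exact mem_connectedComponentIn hzC
    rw [hVo.frontier_eq] at hz
    exact hz.2 this
  obtain ⟨l, hlc, hl⟩ := h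
  -- Tietze extends the logarithm to `m` on the plane. Replacing `z - a` by `exp m` on the closure
  -- of the bounded component removes the zero at `a`. The resulting function has a global
  -- logarithm, yet it equals `z - a` on a large circle.
  obtain ⟨m, hm⟩ := ContinuousMap.exists_restrict_eq (Y := ℂ) hC.isClosed
    ⟨C.domRestrict l, continuousOn_iff_continuous_domRestrict.1 hlc⟩
  have hml : ∀ z ∈ C, m z = l z := fun z hz => DFunLike.congr_fun hm ⟨z, hz⟩
  classical
  set g : ℂ → ℂ := fun z => if z ∈ closure V then Complex.exp (m z) else z - a with hg
  have hgc : Continuous g := by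
    refine Continuous.if (fun z hz => ?_) (by fun_prop) (by fun_prop)
    have hzC : z ∈ C := hfr (frontier_closure_subset hz)
    rw [hml z hzC, hl z hzC]
  have hg0 : ∀ z, g z ≠ 0 := fun z => by
    simp only [hg]
    split_ifs with hz
    · exact Complex.exp_ne_zero _
    · intro h
      exact hz (subset_closure (by rwa [sub_eq_zero.1 h]))
  obtain ⟨L, hLc, hL⟩ := Complex.exists_continuousOn_eqOn_exp_comp
    (convex_univ.isSimplyConnected (univ_nonempty (α := ℂ))) isOpen_univ
    hgc.continuousOn (by rintro ⟨z, -, h⟩; exact hg0 z h)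
  obtain ⟨R, hR⟩ := hb.closure.subset_ball a
  refine not_continuous_exp_eq_sub (a := a) (R := max R 1) (continuousOn_univ.1 hLc) (by positivity)
    fun z hz => ?_
  have hzV : z ∉ closure V := fun h => by
    have := hR h
    rw [mem_ball, dist_eq_norm, hz] at this
    exact absurd (le_max_left R 1) (not_le.2 this)
  have := hL (mem_univ z)
  simpa [hg, hzV] using this

/-- The radial retraction `r` onto the disc makes `θ ∘ r - a` a nonvanishing continuous function on
the plane, which has a logarithm. Its restriction to the disc is carried to the image by the
embedding `θ` and Tietze's theorem. -/
theorem HasLogOn.image_closedBall {θ : ℂ → ℂ} {ρ : ℝ} (hρ : 0 < ρ)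
    (hθ : ContinuousOn θ (closedBall 0 ρ)) (hinj : InjOn θ (closedBall 0 ρ)) {a : ℂ}
    (ha : a ∉ θ '' closedBall 0 ρ) : HasLogOn (θ '' closedBall 0 ρ) a := by
  set r : ℂ → ℂ := fun w => (ρ / max ρ ‖w‖ : ℝ) • w with hr
  have hpos : ∀ w : ℂ, 0 < max ρ ‖w‖ := fun w => lt_max_of_lt_left hρ
  have hrc : Continuous r := by
    refine Continuous.smul (continuous_const.div (by fun_prop) fun w => (hpos w).ne') continuous_id
  have hrm : ∀ w, r w ∈ closedBall (0 : ℂ) ρ := fun w => by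
    rw [mem_closedBall_zero_iff, hr, norm_smul, Real.norm_of_nonneg (by positivity),
      div_mul_eq_mul_div, div_le_iff₀ (hpos w)]
    exact mul_le_mul_of_nonneg_left (le_max_right _ _) hρ.le
  have hrid : ∀ w ∈ closedBall (0 : ℂ) ρ, r w = w := fun w hw => by
    rw [mem_closedBall_zero_iff] at hw
    simp [hr, max_eq_left hw, hρ.ne']
  obtain ⟨l, hlc, hl⟩ := Complex.exists_continuousOn_eqOn_exp_comp
    (convex_univ.isSimplyConnected (univ_nonempty (α := ℂ))) isOpen_univ
    (g := fun w => θ (r w) - a)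
    ((hθ.comp_continuous hrc hrm).sub continuous_const).continuousOn
    (by rintro ⟨z, -, h⟩; exact ha ⟨r z, hrm z, sub_eq_zero.1 h⟩)
  have hcont := continuousOn_iff_continuous_domRestrict.1 hθ
  have hcomp : CompactSpace (closedBall (0 : ℂ) ρ) :=
    isCompact_iff_compactSpace.1 (isCompact_closedBall 0 ρ)
  have hemb : IsClosedEmbedding ((closedBall 0 ρ).domRestrict θ) :=
    hcont.isClosedEmbedding (injOn_iff_injective.1 hinj)
  obtain ⟨m, hm⟩ := ContinuousMap.exists_extension (Y := ℂ) hemb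
    ⟨fun w => l w, (continuousOn_univ.1 hlc).comp continuous_subtype_val⟩
  refine ⟨m, m.continuous.continuousOn, ?_⟩
  rintro _ ⟨w, hw, rfl⟩
  have h1 : m (θ w) = l w := DFunLike.congr_fun hm ⟨w, hw⟩
  have h2 := hl (mem_univ w)
  simp only [Function.comp, hrid w hw] at h2
  rw [h1, h2]

/-- If (z - a) / (p - a) were a real number s ≤ 0, then `a` would lie between `z` and `p`. So the
quotient stays in the slit plane. -/
theorem HasLogOn.segment {p q a : ℂ} (ha : a ∉ segment ℝ p q) : HasLogOn (segment ℝ p q) a := by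
  have hpa : p - a ≠ 0 := fun h => ha (by rw [← sub_eq_zero.1 h]; exact left_mem_segment ℝ p q)
  refine ⟨fun z => Complex.log ((z - a) / (p - a)) + Complex.log (p - a), ?_, fun z hz => ?_⟩
  · refine ContinuousOn.add (ContinuousOn.clog (by fun_prop) fun z hz => ?_) continuousOn_const
    rw [Complex.mem_slitPlane_iff_not_le_zero]
    intro hle
    obtain ⟨s, hs⟩ : ∃ s : ℝ, (z - a) / (p - a) = s ∧ s ≤ 0 := by
      rw [Complex.le_def] at hle
      exact ⟨((z - a) / (p - a)).re, Complex.ext rfl (by simpa using hle.2), by simpa using hle.1⟩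
    obtain ⟨hs, hs0⟩ := hs
    rw [div_eq_iff hpa] at hs
    refine ha ((convex_segment p q).segment_subset hz (left_mem_segment ℝ p q) ?_)
    refine ⟨1 / (1 - s), -s / (1 - s), by apply div_nonneg <;> linarith,
      by apply div_nonneg <;> linarith, by rw [← add_div, div_eq_one_iff_eq] <;> linarith, ?_⟩
    have h1 : ((1 - s : ℝ) : ℂ) ≠ 0 := by exact_mod_cast (by linarith : (1 - s : ℝ) ≠ 0)
    rw [Complex.real_smul, Complex.real_smul]
    push_cast at h1 ⊢
    field_simp
    linear_combination hs
  · have hza : z - a ≠ 0 := fun h => ha (by rwa [← sub_eq_zero.1 h])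
    simp only [Complex.exp_add]
    rw [Complex.exp_log (div_ne_zero hza hpa), Complex.exp_log hpa, div_mul_cancel₀ _ hpa]

/-- The sets meet in one point only, so shifting one logarithm by the constant `l p - m p`, an
integral multiple of 2πi, makes the two agree. -/
theorem HasLogOn.union {A B : Set ℂ} (hA : IsClosed A) (hB : IsClosed B) {p a : ℂ}
    (hAB : A ∩ B ⊆ {p}) (hp : p ∈ A ∩ B) (h1 : HasLogOn A a) (h2 : HasLogOn B a) :
    HasLogOn (A ∪ B) a := by
  obtain ⟨l, hlc, hl⟩ := h1
  obtain ⟨m, hmc, hm⟩ := h2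
  classical
  set g : ℂ → ℂ := fun z => if z ∈ A then l z else m z + (l p - m p) with hg
  have hgA : EqOn g l A := fun z hz => by simp [hg, hz]
  have hgB : EqOn g (fun z => m z + (l p - m p)) B := fun z hz => by
    by_cases hzA : z ∈ A
    · obtain rfl : z = p := hAB ⟨hzA, hz⟩
      simp [hg, hzA]
    · simp [hg, hzA]
  refine ⟨g, ContinuousOn.union_of_isClosed (hlc.congr hgA)
    ((hmc.add continuousOn_const).congr hgB) hA hB, ?_⟩
  rintro z (hz | hz)
  · rw [hgA hz, hl z hz]
  · have h3 : Complex.exp (l p - m p) = 1 := by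
      rw [Complex.exp_sub, hl p hp.1, hm p hp.2, div_self]
      rw [← hl p hp.1]
      exact Complex.exp_ne_zero _
    rw [hgB hz, Complex.exp_add, h3, mul_one, hm z hz]

end LocallyUnivalent

/-! ### Local normal forms of locally univalent meromorphic functions. -/

namespace LocallyUnivalent

open Metric

/-- Inversion, as a map from the plane to the sphere. -/
noncomputable def cinv (w : ℂ) : OnePoint ℂ :=
  open Classical in if w = 0 then ∞ else ((w⁻¹ : ℂ) : OnePoint ℂ)

@[simp] theorem cinv_zero : cinv 0 = ∞ := by simp [cinv]

theorem cinv_of_ne_zero {w : ℂ} (h : w ≠ 0) : cinv w = ((w⁻¹ : ℂ) : OnePoint ℂ) := by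
  simp [cinv, h]

theorem cinv_eq_infty_iff {w : ℂ} : cinv w = ∞ ↔ w = 0 := by
  by_cases h : w = 0 <;> simp [cinv, h]

/-- `F` is meromorphic and locally univalent at `z`. -/
def IsLocUnivAt (F : ℂ → OnePoint ℂ) (z : ℂ) : Prop :=
  ∃ g : ℂ → ℂ, AnalyticAt ℂ g z ∧ deriv g z ≠ 0 ∧
    (F =ᶠ[𝓝 z] (fun w => (g w : OnePoint ℂ)) ∨ F =ᶠ[𝓝 z] fun w => cinv (g w))

theorem IsLocUnivAt.congr {F G : ℂ → OnePoint ℂ} {z : ℂ} (hF : IsLocUnivAt F z)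
    (h : F =ᶠ[𝓝 z] G) : IsLocUnivAt G z := by
  obtain ⟨g, hg, hg', h1⟩ := hF
  exact ⟨g, hg, hg', h1.imp h.symm.trans h.symm.trans⟩

theorem IsLocUnivAt.comp {F : ℂ → OnePoint ℂ} {φ : ℂ → ℂ} {z : ℂ} (hF : IsLocUnivAt F (φ z))
    (hφ : AnalyticAt ℂ φ z) (hφ' : deriv φ z ≠ 0) : IsLocUnivAt (fun w => F (φ w)) z := by
  obtain ⟨g, hg, hg', h1⟩ := hF
  refine ⟨g ∘ φ, hg.comp hφ, ?_, h1.imp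
    (fun h => h.comp_tendsto hφ.continuousAt) (fun h => h.comp_tendsto hφ.continuousAt)⟩
  rw [deriv_comp z hg.differentiableAt hφ.differentiableAt]
  exact mul_ne_zero hg' hφ'

theorem IsLocUnivAt.exists_eventuallyEq_coe {F : ℂ → OnePoint ℂ} {z : ℂ} (hF : IsLocUnivAt F z)
    (hz : F z ≠ ∞) : ∃ g : ℂ → ℂ, AnalyticAt ℂ g z ∧ deriv g z ≠ 0 ∧
      F =ᶠ[𝓝 z] fun w => (g w : OnePoint ℂ) := by
  obtain ⟨g, hg, hg', h | h⟩ := hF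
  · exact ⟨g, hg, hg', h⟩
  · have hg0 : g z ≠ 0 := fun h0 => hz (by rw [h.eq_of_nhds, h0, cinv_zero])
    refine ⟨fun w => (g w)⁻¹, hg.inv hg0, ?_, ?_⟩
    · rw [(hg.differentiableAt.hasDerivAt.fun_inv hg0).deriv]
      exact div_ne_zero (neg_ne_zero.2 hg') (pow_ne_zero 2 hg0)
    · filter_upwards [h, hg.continuousAt.eventually_ne hg0] with w hw hw0
      rw [hw, cinv_of_ne_zero hw0]

theorem IsLocUnivAt.exists_eventuallyEq_cinv {F : ℂ → OnePoint ℂ} {z : ℂ} (hF : IsLocUnivAt F z)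
    (hz : F z = ∞) : ∃ g : ℂ → ℂ, AnalyticAt ℂ g z ∧ g z = 0 ∧ deriv g z ≠ 0 ∧
      F =ᶠ[𝓝 z] fun w => cinv (g w) := by
  obtain ⟨g, hg, hg', h | h⟩ := hF
  · exact absurd (h.eq_of_nhds.symm.trans hz) (OnePoint.coe_ne_infty _)
  · exact ⟨g, hg, cinv_eq_infty_iff.1 (h.eq_of_nhds.symm.trans hz), hg', h⟩

/-- An analytic function divided by a linear factor at a zero. -/
theorem exists_analyticAt_eq_sub_mul {g : ℂ → ℂ} {z : ℂ} (hg : AnalyticAt ℂ g z) :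
    ∃ k : ℂ → ℂ, AnalyticAt ℂ k z ∧ k z = deriv g z ∧ ∀ w, g w = g z + (w - z) * k w := by
  refine ⟨dslope g z, ?_, dslope_same g z, fun w => ?_⟩
  · obtain ⟨s, hs, hd⟩ := hg.exists_mem_nhds_analyticOnNhd
    exact ((Complex.differentiableOn_dslope hs).2 hd.differentiableOn).analyticAt hs
  · have := sub_smul_dslope g z w
    rw [smul_eq_mul] at this
    rw [this]; ring

/-- Near a pole F = 1/g with g = (w - z) k and k(z) ≠ 0. Expanding 1/k at `z` to first order
separates the simple pole from an analytic remainder. -/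
theorem IsLocUnivAt.exists_polar_part {F : ℂ → OnePoint ℂ} {z : ℂ} (hF : IsLocUnivAt F z)
    (hz : F z = ∞) : ∃ (c : ℂ) (β : ℂ → ℂ), c ≠ 0 ∧ AnalyticAt ℂ β z ∧
      ∀ᶠ w in 𝓝[≠] z, F w = ((c / (w - z) + β w : ℂ) : OnePoint ℂ) := by
  obtain ⟨g, hg, hg0, hg', h⟩ := hF.exists_eventuallyEq_cinv hz
  obtain ⟨k, hk, hkz, hgk⟩ := exists_analyticAt_eq_sub_mul hg
  have hkz0 : k z ≠ 0 := by rwa [hkz]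
  obtain ⟨b, hb, -, hkb⟩ := exists_analyticAt_eq_sub_mul (hk.fun_inv hkz0)
  refine ⟨(k z)⁻¹, b, inv_ne_zero hkz0, hb, ?_⟩
  filter_upwards [h.filter_mono nhdsWithin_le_nhds,
    (hk.continuousAt.eventually_ne hkz0).filter_mono nhdsWithin_le_nhds,
    self_mem_nhdsWithin] with w hw hkw hwz
  have hwz' : w - z ≠ 0 := sub_ne_zero.2 hwz
  have hgw : g w = (w - z) * k w := by rw [hgk w, hg0, zero_add]
  rw [hw, cinv_of_ne_zero (by rw [hgw]; exact mul_ne_zero hwz' hkw), hgw, mul_inv, hkb w]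
  congr 1
  field_simp

theorem isLocUnivAt_of_polar_part {F : ℂ → OnePoint ℂ} {z c : ℂ} {β : ℂ → ℂ} (hz : F z = ∞)
    (hc : c ≠ 0) (hβ : AnalyticAt ℂ β z)
    (h : ∀ᶠ w in 𝓝[≠] z, F w = ((c / (w - z) + β w : ℂ) : OnePoint ℂ)) : IsLocUnivAt F z := by
  set d : ℂ → ℂ := fun w => c + (w - z) * β w with hd
  have hda : AnalyticAt ℂ d z := by fun_prop
  have hdz : d z ≠ 0 := by simpa [hd] using hc
  refine ⟨fun w => (w - z) * (d w)⁻¹, (by fun_prop : AnalyticAt ℂ (fun w => w - z) z).mul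
    (hda.inv hdz), ?_, Or.inr ?_⟩
  · have h1 := ((hasDerivAt_id z).sub_const z).mul (hda.differentiableAt.hasDerivAt.fun_inv hdz)
    have h2 := h1.deriv
    simp only [id, sub_self, zero_mul, add_zero, one_mul] at h2
    exact h2.trans_ne (inv_ne_zero hdz)
  · rw [eventually_nhdsWithin_iff] at h
    filter_upwards [h, hda.continuousAt.eventually_ne hdz] with w hw hdw
    by_cases hwz : w = z
    · simp [hwz, hz]
    · have hwz' : w - z ≠ 0 := sub_ne_zero.2 hwz
      rw [hw hwz, cinv_of_ne_zero (mul_ne_zero hwz' (inv_ne_zero hdw))]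
      congr 1
      simp only [hd]
      field_simp

theorem isLocUnivAt_coe {g : ℂ → ℂ} {z : ℂ} (hg : AnalyticAt ℂ g z) (hg' : deriv g z ≠ 0) :
    IsLocUnivAt (fun w => (g w : OnePoint ℂ)) z :=
  ⟨g, hg, hg', Or.inl EventuallyEq.rfl⟩

/-- The extension of `f` to the plane, by the value `∞`. -/
noncomputable def extendInfty {Ω : Set ℂ} (f : SphereMap Ω) : ℂ → OnePoint ℂ :=
  Function.extend Subtype.val f.toFun fun _ => ∞

theorem extendInfty_apply {Ω : Set ℂ} (f : SphereMap Ω) (z : Ω) :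
    extendInfty f z = f.toFun z :=
  Subtype.val_injective.extend_apply _ _ _

theorem extendZero_apply {Ω : Set ℂ} (h : Ω → ℂ) (z : Ω) : extendZero h z = h z :=
  Subtype.val_injective.extend_apply _ _ _

theorem finitePart_apply {Ω : Set ℂ} (f : SphereMap Ω) {z : ℂ} (hz : z ∈ Ω) :
    finitePart f z = (extendInfty f z).elim 0 id := by
  rw [finitePart, extendInfty_apply f ⟨z, hz⟩]
  exact extendZero_apply _ ⟨z, hz⟩

theorem extendInfty_eq_coe {Ω : Set ℂ} (f : SphereMap Ω) {z : ℂ} (hz : z ∈ Ω)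
    (h : extendInfty f z ≠ ∞) : extendInfty f z = (finitePart f z : OnePoint ℂ) := by
  rw [finitePart_apply f hz]
  obtain ⟨w, hw⟩ := OnePoint.ne_infty_iff_exists.1 h
  rw [← hw]; rfl

/-- `finitePart` has the value 0 at poles, so its analyticity alone does not exclude the value `∞`;
the negative order that is required at poles does. -/
theorem extendInfty_ne_infty_of_analyticAt {Ω : Set ℂ} {f : SphereMap Ω}
    (hf : IsMeromorphic f) {z : ℂ} (hz : z ∈ Ω) (h : AnalyticAt ℂ (finitePart f) z) :
    extendInfty f z ≠ ∞ := by
  intro h1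
  rw [extendInfty_apply f ⟨z, hz⟩] at h1
  obtain ⟨h2, -⟩ | ⟨-, -, h2⟩ := hf ⟨z, hz⟩
  · exact h2 h1
  · exact absurd h.meromorphicOrderAt_nonneg (not_le.2 h2)

/-- Membership becomes one local condition, F = g or F = 1/g with g' ≠ 0, which treats poles and
finite points alike and is stable under conformal changes of variable and under inversion. -/
theorem mem_locallyUnivalentMeromorphic_iff {Ω : Set ℂ} (hΩ : IsOpen Ω) (f : SphereMap Ω) :
    f ∈ locallyUnivalentMeromorphic Ω ↔ ∀ z ∈ Ω, IsLocUnivAt (extendInfty f) z := by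
  constructor
  · rintro ⟨hm, hp, hd⟩ z hz
    by_cases hfz : f.toFun ⟨z, hz⟩ = ∞
    · have hmer : MeromorphicAt (finitePart f) z := by
        obtain ⟨h2, -⟩ | ⟨-, h2, -⟩ := hm ⟨z, hz⟩
        · exact absurd hfz h2
        · exact h2
      obtain ⟨g, hg, hgz, h⟩ := (meromorphicOrderAt_eq_int_iff hmer (n := -1)).1
        (hp ⟨z, hz⟩ hfz)
      refine ⟨fun w => (w - z) * (g w)⁻¹, (by fun_prop : AnalyticAt ℂ (fun w => w - z) z).mul
        (hg.inv hgz), ?_, Or.inr ?_⟩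
      · have h1 := ((hasDerivAt_id z).sub_const z).mul (hg.differentiableAt.hasDerivAt.fun_inv hgz)
        have h2 := h1.deriv
        simp only [id, sub_self, zero_mul, add_zero, one_mul] at h2
        exact h2.trans_ne (inv_ne_zero hgz)
      · have hev := h.and (hmer.eventually_analyticAt)
        rw [eventually_nhdsWithin_iff] at hev
        filter_upwards [hev, hg.continuousAt.eventually_ne hgz, hΩ.mem_nhds hz] with w hw hgw hwΩ
        by_cases hwz : w = z
        · subst hwz
          rw [extendInfty_apply f ⟨w, hz⟩, hfz, sub_self, zero_mul, cinv_zero]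
        · obtain ⟨h1, h2⟩ := hw hwz
          have hwz' : w - z ≠ 0 := sub_ne_zero.2 hwz
          rw [extendInfty_eq_coe f hwΩ (extendInfty_ne_infty_of_analyticAt hm hwΩ h2), h1,
            cinv_of_ne_zero (mul_ne_zero hwz' (inv_ne_zero hgw))]
          simp [mul_comm]
    · have han : AnalyticAt ℂ (finitePart f) z := by
        obtain ⟨-, h2⟩ | ⟨h2, -⟩ := hm ⟨z, hz⟩
        · exact h2
        · exact absurd h2 hfz
      refine ⟨finitePart f, han, hd ⟨z, hz⟩ hfz, Or.inl ?_⟩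
      filter_upwards [han.eventually_analyticAt, hΩ.mem_nhds hz] with w hw hwΩ
      exact extendInfty_eq_coe f hwΩ (extendInfty_ne_infty_of_analyticAt hm hwΩ hw)
  · intro h
    have hfin : ∀ z : Ω, f.toFun z ≠ ∞ → AnalyticAt ℂ (finitePart f) z ∧
        deriv (finitePart f) z ≠ 0 := fun z hz => by
      obtain ⟨g, hg, hg', hev⟩ := (h z z.2).exists_eventuallyEq_coe
        (by rwa [extendInfty_apply])
      have h1 : finitePart f =ᶠ[𝓝 (z : ℂ)] g := by
        filter_upwards [hev, hΩ.mem_nhds z.2] with w hw hwΩ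
        rw [finitePart_apply f hwΩ, hw]; rfl
      exact ⟨hg.congr h1.symm, by rwa [h1.deriv_eq]⟩
    have hinf : ∀ z : Ω, f.toFun z = ∞ → MeromorphicAt (finitePart f) z ∧
        meromorphicOrderAt (finitePart f) z = -1 := fun z hz => by
      obtain ⟨c, β, hc, hβ, hev⟩ := (h z z.2).exists_polar_part (by rwa [extendInfty_apply])
      have h1 : finitePart f =ᶠ[𝓝[≠] (z : ℂ)] fun w => (w - z) ^ (-1 : ℤ) •
          (c + (w - z) * β w) := by
        filter_upwards [hev, nhdsWithin_le_nhds (hΩ.mem_nhds z.2), self_mem_nhdsWithin]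
          with w hw hwΩ hwz
        have hwz' : w - (z : ℂ) ≠ 0 := sub_ne_zero.2 hwz
        rw [finitePart_apply f hwΩ, hw]
        change c / (w - z) + β w = _
        rw [zpow_neg_one, smul_eq_mul]
        field_simp
      have han : AnalyticAt ℂ (fun w => c + (w - (z : ℂ)) * β w) z := by fun_prop
      have hmer : MeromorphicAt (finitePart f) (z : ℂ) := by
        refine MeromorphicAt.congr ?_ h1.symm
        exact (by fun_prop : MeromorphicAt (fun w => w - (z : ℂ)) z).zpow (-1) |>.smul
          han.meromorphicAt
      refine ⟨hmer, ?_⟩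
      exact (meromorphicOrderAt_eq_int_iff hmer (n := -1)).2 ⟨_, han, by simpa using hc, h1⟩
    refine ⟨fun z => ?_, fun z hz => (hinf z hz).2, fun z hz => (hfin z hz).2⟩
    by_cases hz : f.toFun z = ∞
    · refine Or.inr ⟨hz, (hinf z hz).1, ?_⟩
      rw [(hinf z hz).2]
      decide
    · exact Or.inl ⟨hz, (hfin z hz).1⟩

/-- The chordal distance is at most the Euclidean distance. -/
theorem dist_coe_le (a b : ℂ) : dist (a : OnePoint ℂ) (b : OnePoint ℂ) ≤ ‖a - b‖ := by
  rw [ChordalSphere.dist_eq_chi]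
  refine div_le_self (norm_nonneg _) ?_
  have h : ∀ z : ℂ, 1 ≤ √(1 + ‖z‖ ^ 2) := fun z => by
    rw [Real.one_le_sqrt]; nlinarith [norm_nonneg z]
  exact one_le_mul_of_one_le_of_one_le (h a) (h b)

end LocallyUnivalent

/-! ### Auxiliary facts on removable singularities, division by polynomials, cutoffs and null sets.
-/

namespace LocallyUnivalent

open Metric

/-- Removing finitely many removable singularities. -/
theorem exists_differentiableOn_eventuallyEq {V : Set ℂ} {E : ℂ → ℂ}
    (h : ∀ z ∈ V, ∃ e : ℂ → ℂ, AnalyticAt ℂ e z ∧ E =ᶠ[𝓝[≠] z] e) :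
    ∃ G : ℂ → ℂ, (∀ z ∈ V, ∀ e : ℂ → ℂ, AnalyticAt ℂ e z → E =ᶠ[𝓝[≠] z] e → G z = e z) ∧
      (IsOpen V → DifferentiableOn ℂ G V) := by
  have h' : ∀ z, ∃ e : ℂ → ℂ, z ∈ V → AnalyticAt ℂ e z ∧ E =ᶠ[𝓝[≠] z] e := fun z => by
    by_cases hz : z ∈ V
    · obtain ⟨e, he⟩ := h z hz
      exact ⟨e, fun _ => he⟩
    · exact ⟨0, fun h => absurd h hz⟩
  choose e he using h'
  have huniq : ∀ z ∈ V, ∀ e' : ℂ → ℂ, AnalyticAt ℂ e' z → E =ᶠ[𝓝[≠] z] e' →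
      e z z = e' z := by
    intro z hz e' he' hE
    have h1 : e z =ᶠ[𝓝[≠] z] e' := (he z hz).2.symm.trans hE
    exact tendsto_nhds_unique (((he z hz).1.continuousAt.tendsto.mono_left
      nhdsWithin_le_nhds).congr' h1) (he'.continuousAt.tendsto.mono_left nhdsWithin_le_nhds)
  refine ⟨fun z => e z z, huniq, fun hV z hz => ?_⟩
  -- The single function `e z` also extends `E` at all nearby points, and an extension is unique, so
  -- the pointwise choices fit together.
  have h1 : (fun w => e w w) =ᶠ[𝓝 z] e z := by
    have h2 := eventually_eventually_nhdsWithin.2 (he z hz).2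
    rw [eventually_nhdsWithin_iff] at h2
    filter_upwards [h2, (he z hz).1.eventually_analyticAt, hV.mem_nhds hz] with w hw hwa hwV
    by_cases hwz : w = z
    · rw [hwz]
    · refine huniq w hwV (e z) hwa ?_
      have h3 := hw hwz
      rw [isOpen_compl_singleton.nhdsWithin_eq hwz] at h3
      exact h3.filter_mono nhdsWithin_le_nhds
  exact ((he z hz).1.congr h1.symm).differentiableAt.differentiableWithinAt

/-- Division with remainder of a holomorphic function by a polynomial. -/
theorem exists_eq_eval_add_mul {V : Set ℂ} (hV : IsOpen V) {h : ℂ → ℂ}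
    (hh : DifferentiableOn ℂ h V) (m : Multiset ℂ) (hm : ∀ a ∈ m, a ∈ V) :
    ∃ (q : Polynomial ℂ) (k : ℂ → ℂ), DifferentiableOn ℂ k V ∧
      ∀ z, h z = q.eval z + ((m.map fun a => Polynomial.X - Polynomial.C a).prod).eval z * k z := by
  induction m using Multiset.induction_on with
  | empty => exact ⟨0, h, hh, fun z => by simp⟩
  | cons a m ih =>
    obtain ⟨q, k, hk, hq⟩ := ih fun b hb => hm b (Multiset.mem_cons_of_mem hb)
    have haV : a ∈ V := hm a (Multiset.mem_cons_self a m)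
    refine ⟨q + (m.map fun a => Polynomial.X - Polynomial.C a).prod * Polynomial.C (k a),
      dslope k a, (Complex.differentiableOn_dslope (hV.mem_nhds haV)).2 hk, fun z => ?_⟩
    have h1 := sub_smul_dslope k a z
    rw [smul_eq_mul] at h1
    rw [hq z, Multiset.map_cons, Multiset.prod_cons]
    simp only [Polynomial.eval_add, Polynomial.eval_mul, Polynomial.eval_sub, Polynomial.eval_X,
      Polynomial.eval_C]
    linear_combination (-((m.map fun a => Polynomial.X - Polynomial.C a).prod.eval z)) * h1

/-- The ball is homeomorphic to the plane, and the plane without a countable set is connected. -/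
theorem isPreconnected_ball_diff {R : ℝ} (hR : 0 < R) {S : Set ℂ} (hS : S.Countable) :
    IsPreconnected (ball (0 : ℂ) R \ S) := by
  set e := OpenPartialHomeomorph.univBall (0 : ℂ) R
  have hsrc : e.source = univ := OpenPartialHomeomorph.univBall_source _ _
  have htgt : e.target = ball 0 R := OpenPartialHomeomorph.univBall_target _ hR
  have hinj : Function.Injective e := fun x y h =>
    e.injOn (by rw [hsrc]; trivial) (by rw [hsrc]; trivial) h
  have hcont : Continuous e := by
    rw [← continuousOn_univ, ← hsrc]; exact e.continuousOn
  have hc : (e ⁻¹' S).Countable := hS.preimage hinj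
  have h1 := (hc.isConnected_compl_of_one_lt_rank (E := ℂ)
    (by rw [Complex.rank_real_complex]; exact Nat.one_lt_ofNat)).isPreconnected.image e
    hcont.continuousOn
  convert h1 using 1
  ext w
  constructor
  · rintro ⟨hw, hwS⟩
    rw [← htgt] at hw
    refine ⟨e.symm w, ?_, e.right_inv hw⟩
    rwa [mem_compl_iff, mem_preimage, e.right_inv hw]
  · rintro ⟨v, hv, rfl⟩
    refine ⟨?_, hv⟩
    rw [← htgt]
    exact e.map_source (by rw [hsrc]; trivial)

/-- Smooth cutoff functions. -/
theorem exists_cutoff {K U : Set ℂ} (hK : IsCompact K) (hU : IsOpen U) (hKU : K ⊆ U) :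
    ∃ χ : ℂ → ℝ, ContDiff ℝ 1 χ ∧ HasCompactSupport χ ∧ tsupport χ ⊆ U ∧
      (∀ᶠ z in 𝓝ˢ K, χ z = 1) ∧ ∀ z, χ z ∈ Icc (0 : ℝ) 1 := by
  obtain ⟨K', hK', hKK', hK'U⟩ := exists_compact_between hK hU hKU
  obtain ⟨f, hf1, hf0, hf⟩ := exists_contMDiffMap_one_nhds_of_subset_interior
    (modelWithCornersSelf ℝ ℂ) (n := 1) hK.isClosed hKK'
  have hsub : tsupport f ⊆ K' := closure_minimal (fun z hz => by
    by_contra h; exact hz (hf0 z h)) hK'.isClosed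
  exact ⟨f, f.contMDiff.contDiff, HasCompactSupport.of_support_subset_isCompact hK'
    (subset_tsupport _ |>.trans hsub), hsub.trans hK'U, hf1, hf⟩

theorem contDiff_cutoff_smul {χ : ℂ → ℝ} (hχ : ContDiff ℝ 1 χ) {V : Set ℂ} (hV : IsOpen V)
    (hs : tsupport χ ⊆ V) {k : ℂ → ℂ} (hk : DifferentiableOn ℂ k V) :
    ContDiff ℝ 1 fun z => χ z • k z := by
  rw [contDiff_iff_contDiffAt]
  intro z
  by_cases hz : z ∈ V
  · have h1 : ContDiffAt ℂ 1 k z := (hk.analyticAt (hV.mem_nhds hz)).contDiffAt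
    exact hχ.contDiffAt.smul (h1.restrict_scalars ℝ)
  · have h1 : (fun z => χ z • k z) =ᶠ[𝓝 z] fun _ => (0 : ℂ) := by
      filter_upwards [notMem_tsupport_iff_eventuallyEq.1 fun h => hz (hs h)] with w hw
      rw [hw]; simp
    exact contDiffAt_const.congr_of_eventuallyEq h1

/-- Needed because the function to be approximated by polynomials violates the Cauchy-Riemann
equation on the joining segment. -/
theorem volume_segment_eq_zero (p q : ℂ) : MeasureTheory.volume (segment ℝ p q) = 0 := by
  have hne : (line[ℝ, p, q]) ≠ ⊤ := by
    intro h
    have h1 := congrArg AffineSubspace.direction h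
    rw [direction_affineSpan, AffineSubspace.direction_top] at h1
    have h2 : Module.finrank ℝ (vectorSpan ℝ ({p, q} : Set ℂ)) ≤ 1 :=
      (collinear_iff_finrank_le_one).1 (collinear_pair ℝ p q)
    rw [h1, finrank_top, Complex.finrank_real_complex] at h2
    omega
  refine MeasureTheory.measure_mono_null ?_ (MeasureTheory.Measure.addHaar_affineSubspace
    MeasureTheory.volume _ hne)
  rw [← convexHull_pair]
  exact convexHull_subset_affineSpan _

end LocallyUnivalent

/-! ### Polynomial approximation with a prescribed integral along a segment. -/

namespace LocallyUnivalent

open Metric MeasureTheory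

/-- Dominated convergence for integrals of exponentials of bounded sequences. -/
theorem tendsto_integral_exp_mul {a b w : ℝ → ℂ} (ha : Continuous a) (hb : Continuous b)
    (hw : ContinuousOn w (Icc 0 1)) {g : ℕ → ℝ → ℂ} {g' : ℝ → ℂ}
    (hg : ∀ n, ContinuousOn (g n) (Icc 0 1)) {M : ℝ} (hM : ∀ n, ∀ t ∈ Icc (0 : ℝ) 1, ‖g n t‖ ≤ M)
    (hlim : ∀ t ∈ Ioo (0 : ℝ) 1, Tendsto (fun n => g n t) atTop (𝓝 (g' t))) :
    Tendsto (fun n => ∫ t in (0 : ℝ)..1, Complex.exp (a t + b t * g n t) * w t) atTop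
      (𝓝 (∫ t in (0 : ℝ)..1, Complex.exp (a t + b t * g' t) * w t)) := by
  obtain ⟨A, hA⟩ := (isCompact_Icc (a := (0 : ℝ)) (b := 1)).exists_bound_of_continuousOn
    ha.continuousOn
  obtain ⟨B, hB⟩ := (isCompact_Icc (a := (0 : ℝ)) (b := 1)).exists_bound_of_continuousOn
    hb.continuousOn
  obtain ⟨W, hW⟩ := (isCompact_Icc (a := (0 : ℝ)) (b := 1)).exists_bound_of_continuousOn hw
  have huIoc : uIoc (0 : ℝ) 1 = Ioc 0 1 := uIoc_of_le zero_le_one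
  refine intervalIntegral.tendsto_integral_filter_of_dominated_convergence
    (fun _ => Real.exp (A + B * M) * W) (Eventually.of_forall fun n => ?_)
    (Eventually.of_forall fun n => Eventually.of_forall fun t ht => ?_)
    intervalIntegrable_const ?_
  · rw [huIoc]
    refine (ContinuousOn.aestronglyMeasurable ?_ measurableSet_Icc).mono_set Ioc_subset_Icc_self
    exact ((ha.continuousOn.add (hb.continuousOn.mul (hg n))).cexp).mul hw
  · rw [huIoc] at ht
    have ht' : t ∈ Icc (0 : ℝ) 1 := Ioc_subset_Icc_self ht
    rw [norm_mul]
    refine mul_le_mul ?_ (hW t ht') (norm_nonneg _) (Real.exp_nonneg _)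
    refine (Complex.norm_exp_le_exp_norm _).trans (Real.exp_le_exp.2 ?_)
    refine (norm_add_le _ _).trans (add_le_add (hA t ht') ?_)
    rw [norm_mul]
    exact mul_le_mul (hB t ht') (hM n t ht') (norm_nonneg _) ((norm_nonneg _).trans (hB t ht'))
  · rw [huIoc]
    have hne : ∀ᵐ t : ℝ, t ≠ 1 := by
      simp [ae_iff, measure_singleton]
    filter_upwards [hne] with t ht1 ht
    refine Tendsto.mul_const _ ?_
    refine (Complex.continuous_exp.tendsto _).comp ?_
    exact tendsto_const_nhds.add ((hlim t ⟨ht.1, lt_of_le_of_ne ht.2 ht1⟩).const_mul _)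

set_option maxHeartbeats 1000000 in
open Polynomial in
/-- Approximation of `k` by a polynomial `u` on two disjoint compact sets, with a prescribed integral
of `exp (-2 * (q + P ^ 2 * u)) / P ^ 2` along a segment that joins them. -/
theorem exists_polynomial_approx_integral {A₁ A₂ V : Set ℂ} (hA₁ : IsCompact A₁)
    (hA₂ : IsCompact A₂) (hV : IsOpen V) (hAV : A₁ ∪ A₂ ⊆ V)
    (hdisj : Disjoint A₁ A₂) {k : ℂ → ℂ} (hk : DifferentiableOn ℂ k V)
    (hlog₁ : ∀ a ∉ A₁, HasLogOn A₁ a) (hlog₂ : ∀ a ∉ A₂, HasLogOn A₂ a) {x y : ℂ}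
    (hx : x ∈ A₁) (hy : y ∈ A₂) (hx' : segment ℝ x y ∩ A₁ ⊆ {x}) (hy' : segment ℝ x y ∩ A₂ ⊆ {y})
    (P q : ℂ[X]) (hP : ∀ z ∈ segment ℝ x y, P.eval z ≠ 0) (c : ℂ) {ε : ℝ} (hε : 0 < ε) :
    ∃ u : ℂ[X], (∀ z ∈ A₁ ∪ A₂, ‖u.eval z - k z‖ < ε) ∧
      ‖(∫ t in (0 : ℝ)..1, Complex.exp (-2 * (q.eval (x + t * (y - x)) +
        P.eval (x + t * (y - x)) ^ 2 * u.eval (x + t * (y - x)))) *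
          ((y - x) / P.eval (x + t * (y - x)) ^ 2)) - c‖ < ε := by
  -- A logarithm of a multiple of `c` is used below. The target `c = 0` is replaced by `ε / 2`.
  wlog hc : c ≠ 0 generalizing c ε with hgen
  · push Not at hc
    obtain ⟨u, hu1, hu2⟩ := hgen ((ε / 2 : ℝ) : ℂ) (ε := ε / 2) (by positivity)
      (by exact_mod_cast (by positivity : ε / 2 ≠ 0))
    refine ⟨u, fun z hz => (hu1 z hz).trans (by linarith), ?_⟩
    rw [hc, sub_zero]
    have h1 := norm_sub_norm_le
      (∫ t in (0 : ℝ)..1, Complex.exp (-2 * (q.eval (x + t * (y - x)) +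
        P.eval (x + t * (y - x)) ^ 2 * u.eval (x + t * (y - x)))) *
          ((y - x) / P.eval (x + t * (y - x)) ^ 2)) ((ε / 2 : ℝ) : ℂ)
    rw [Complex.norm_real, Real.norm_of_nonneg (by positivity)] at h1
    linarith
  have hxy : x ≠ y := fun h => hdisj.le_bot ⟨hx, h ▸ hy⟩
  have hyx : y - x ≠ 0 := sub_ne_zero.2 hxy.symm
  set s : ℝ → ℂ := fun t => x + t * (y - x) with hs
  have hsc : Continuous s := by fun_prop
  have hseg : segment ℝ x y = s '' Icc 0 1 := by
    rw [segment_eq_image']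
    simp [hs, Complex.real_smul]
  have hsmem : ∀ t ∈ Icc (0 : ℝ) 1, s t ∈ segment ℝ x y := fun t ht => by
    rw [hseg]; exact ⟨t, ht, rfl⟩
  have hsinj : Function.Injective s := fun t₁ t₂ h => by
    have h1 := mul_right_cancel₀ hyx (add_left_cancel h)
    exact_mod_cast h1
  have hs0 : s 0 = x := by simp [hs]
  have hs1 : s 1 = y := by simp [hs]
  have hsegc : IsCompact (segment ℝ x y) := by
    rw [hseg]; exact isCompact_Icc.image hsc
  set C : Set ℂ := A₁ ∪ segment ℝ x y ∪ A₂ with hC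
  have hCc : IsCompact C := (hA₁.union hsegc).union hA₂
  -- The three pieces form a chain in which consecutive ones meet in one point, so their logarithms
  -- glue.
  have hunb : ∀ a ∉ C, ¬ Bornology.IsBounded (connectedComponentIn Cᶜ a) := by
    intro a ha
    simp only [hC, mem_union, not_or] at ha
    refine HasLogOn.not_isBounded_connectedComponentIn hCc
      (by simp only [hC, mem_union, not_or]; exact ha) ?_
    refine HasLogOn.union (hA₁.union hsegc).isClosed hA₂.isClosed (p := y) ?_
      ⟨Or.inr (right_mem_segment ℝ x y), hy⟩ ?_ (hlog₂ a ha.2)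
    · rintro z ⟨hz | hz, hz2⟩
      · exact absurd ⟨hz, hz2⟩ fun h => hdisj.le_bot h
      · exact hy' ⟨hz, hz2⟩
    · refine HasLogOn.union hA₁.isClosed hsegc.isClosed (p := x) ?_
        ⟨hx, left_mem_segment ℝ x y⟩ (hlog₁ a ha.1.1) (HasLogOn.segment ha.1.2)
      rw [inter_comm]; exact hx'
  obtain ⟨δ, hδ, hδP⟩ := hsegc.exists_thickening_subset_open
    (isOpen_ne_fun P.continuous continuous_const) (fun z hz => hP z hz : segment ℝ x y ⊆
      {z | P.eval z ≠ 0})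
  set N := thickening δ (segment ℝ x y) with hN
  have hNo : IsOpen N := isOpen_thickening
  have hsegN : segment ℝ x y ⊆ N := self_subset_thickening hδ _
  obtain ⟨l, hl, hle⟩ := exists_differentiableOn_exp_eq hNo
    (((convex_segment x y).thickening δ).isSimplyConnected ⟨x, hsegN (left_mem_segment ℝ x y)⟩)
    (g := fun z => c * P.eval z ^ 2 / (y - x))
    (((P.differentiable.pow 2).const_mul c).div_const _).differentiableOn
    (fun z hz => div_ne_zero (mul_ne_zero hc (pow_ne_zero 2 (hδP hz))) hyx)
  -- `L` solves exp(-2(q + P² L)) (y - x) / P² = c, so with `L` in place of `u` the integrand is the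
  -- constant `c`.
  set L : ℂ → ℂ := fun z => (-(l z) / 2 - q.eval z) / P.eval z ^ 2 with hL
  have hLd : DifferentiableOn ℂ L N :=
    ((hl.neg.div_const 2).sub q.differentiable.differentiableOn).div
      (P.differentiable.pow 2).differentiableOn fun z hz => pow_ne_zero 2 (hδP hz)
  obtain ⟨χ, hχ, hχc, hχs, hχ1, hχI⟩ := exists_cutoff (hA₁.union hA₂) hV hAV
  have hχk := contDiff_cutoff_smul hχ hV hχs hk
  have hρ : ∀ n : ℕ, ∃ ρ : ℂ → ℝ, ContDiff ℝ 1 ρ ∧ HasCompactSupport ρ ∧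
      tsupport ρ ⊆ N \ (A₁ ∪ A₂) ∧
      (∀ᶠ z in 𝓝ˢ (s '' Icc (1 / ((n : ℝ) + 3)) (1 - 1 / ((n : ℝ) + 3))), ρ z = 1) ∧
      ∀ z, ρ z ∈ Icc (0 : ℝ) 1 := fun n => by
    refine exists_cutoff (isCompact_Icc.image hsc)
      (hNo.sdiff (hA₁.union hA₂).isClosed) ?_
    rintro _ ⟨t, ht, rfl⟩
    have hn : 0 < 1 / ((n : ℝ) + 3) := by positivity
    have ht01 : t ∈ Icc (0 : ℝ) 1 := ⟨hn.le.trans ht.1, ht.2.trans (by linarith)⟩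
    refine ⟨hsegN (hsmem t ht01), ?_⟩
    rintro (h | h)
    · have h1 : s t = s 0 := by rw [hs0]; exact hx' ⟨hsmem t ht01, h⟩
      have := hsinj h1
      rw [this] at ht
      exact absurd ht.1 (not_le.2 hn)
    · have h1 : s t = s 1 := by rw [hs1]; exact hy' ⟨hsmem t ht01, h⟩
      have := hsinj h1
      rw [this] at ht
      linarith [ht.2]
  choose ρ hρ hρc hρs hρ1 hρI using hρ
  -- `F n` equals `k` near `A₁ ∪ A₂` and `L` on the segment except near its ends. On the segment it
  -- is bounded uniformly in `n`, so dominated convergence brings the integral to `c`. Then `n` is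
  -- fixed and `F n` is approximated by polynomials on all of `C`.
  set F : ℕ → ℂ → ℂ := fun n z => (1 - ρ n z) • (χ z • k z) + ρ n z • L z with hF
  have hFd : ∀ n, ContDiff ℝ 1 (F n) := fun n =>
    ((contDiff_const.sub (hρ n)).smul hχk).add
      (contDiff_cutoff_smul (hρ n) hNo ((hρs n).trans sdiff_subset) hLd)
  have hFc : ∀ n, HasCompactSupport (F n) := fun n => by
    refine HasCompactSupport.add (f := fun z => (1 - ρ n z) • (χ z • k z))
      (f' := fun z => ρ n z • L z) (hχc.mono fun z hz h => hz ?_) ((hρc n).mono fun z hz h => hz ?_)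
    · simp [h]
    · simp [h]
  have hFA : ∀ n, ∀ z ∈ A₁ ∪ A₂, F n =ᶠ[𝓝 z] k := fun n z hz => by
    have h1 : ρ n =ᶠ[𝓝 z] 0 := notMem_tsupport_iff_eventuallyEq.1 fun h => (hρs n h).2 hz
    filter_upwards [h1, hχ1.filter_mono (nhds_le_nhdsSet hz)] with w hw1 hw2
    simp [hF, hw1, hw2]
  have hnull : ∀ n, volume {z ∈ C | dbar (F n) z ≠ 0} = 0 := fun n => by
    refine measure_mono_null ?_ (volume_segment_eq_zero x y)
    rintro z ⟨hz, hz0⟩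
    by_contra hzs
    have hzA : z ∈ A₁ ∪ A₂ := by
      rcases hz with (hz | hz) | hz
      · exact Or.inl hz
      · exact absurd hz hzs
      · exact Or.inr hz
    exact hz0 (dbar_eq_zero_of_eventuallyEq (hFA n z hzA)
      (hk.differentiableAt (hV.mem_nhds (hAV hzA))))
  set w : ℝ → ℂ := fun t => (y - x) / P.eval (s t) ^ 2 with hw
  have hwc : ContinuousOn w (Icc 0 1) :=
    continuousOn_const.div (by fun_prop) fun t ht => pow_ne_zero 2 (hP _ (hsmem t ht))
  set a : ℝ → ℂ := fun t => -2 * q.eval (s t) with ha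
  set b : ℝ → ℂ := fun t => -2 * P.eval (s t) ^ 2 with hb
  have hac : Continuous a := by fun_prop
  have hbc : Continuous b := by fun_prop
  have hFbound : ∃ M, ∀ n, ∀ t ∈ Icc (0 : ℝ) 1, ‖F n (s t)‖ ≤ M := by
    obtain ⟨M₁, hM₁⟩ := (isCompact_Icc (a := (0 : ℝ)) (b := 1)).exists_bound_of_continuousOn
      (hχk.continuous.comp hsc).continuousOn
    obtain ⟨M₂, hM₂⟩ := (isCompact_Icc (a := (0 : ℝ)) (b := 1)).exists_bound_of_continuousOn
      (f := fun t => L (s t)) (hLd.continuousOn.comp hsc.continuousOn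
        fun t ht => hsegN (hsmem t ht))
    refine ⟨M₁ + M₂, fun n t ht => ?_⟩
    refine (norm_add_le _ _).trans (add_le_add ?_ ?_)
    · rw [norm_smul, Real.norm_of_nonneg (by linarith [(hρI n (s t)).2])]
      exact (mul_le_of_le_one_left (norm_nonneg _) (by linarith [(hρI n (s t)).1])).trans (hM₁ t ht)
    · rw [norm_smul, Real.norm_of_nonneg (hρI n (s t)).1]
      exact (mul_le_of_le_one_left (norm_nonneg _) (hρI n (s t)).2).trans (hM₂ t ht)
  obtain ⟨M, hM⟩ := hFbound
  have hFlim : ∀ t ∈ Ioo (0 : ℝ) 1, Tendsto (fun n => F n (s t)) atTop (𝓝 (L (s t))) := by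
    intro t ht
    refine tendsto_const_nhds.congr' ?_
    have h1 : Tendsto (fun n : ℕ => 1 / ((n : ℝ) + 3)) atTop (𝓝 0) := by
      exact tendsto_const_nhds.div_atTop
        (tendsto_atTop_add_const_right _ _ tendsto_natCast_atTop_atTop)
    filter_upwards [h1.eventually_lt_const ht.1,
      h1.eventually_lt_const (sub_pos.2 ht.2)] with n hn1 hn2
    have h2 : ρ n (s t) = 1 := (hρ1 n).self_of_nhdsSet _ ⟨t, ⟨hn1.le, by linarith⟩, rfl⟩
    simp [hF, h2]
  have hlim1 := tendsto_integral_exp_mul hac hbc hwc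
    (fun n => ((hFd n).continuous.comp hsc).continuousOn) hM hFlim
  have hval : ∫ t in (0 : ℝ)..1, Complex.exp (a t + b t * L (s t)) * w t = c := by
    have h1 : ∀ t ∈ uIcc (0 : ℝ) 1, Complex.exp (a t + b t * L (s t)) * w t = c := by
      intro t ht
      rw [uIcc_of_le zero_le_one] at ht
      have hPt := hP _ (hsmem t ht)
      have h2 : a t + b t * L (s t) = l (s t) := by
        simp only [ha, hb, hL]
        field_simp
        ring
      rw [h2, hle _ (hsegN (hsmem t ht))]
      simp only [hw]
      field_simp
    rw [intervalIntegral.integral_congr h1]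
    simp
  rw [hval] at hlim1
  obtain ⟨n, hn⟩ := ((Metric.tendsto_nhds.1 hlim1) (ε / 2) (by positivity)).exists
  have hu : ∀ m : ℕ, ∃ u : ℂ[X], ∀ z ∈ C, ‖u.eval z - F n z‖ < 1 / ((m : ℝ) + 1) := fun m =>
    exists_polynomial_norm_sub_lt hCc hunb (hFd n) (hFc n) (hnull n) (by positivity)
  choose u hu using hu
  have hsC : ∀ t ∈ Icc (0 : ℝ) 1, s t ∈ C := fun t ht => Or.inl (Or.inr (hsmem t ht))
  have h0 : Tendsto (fun m : ℕ => 1 / ((m : ℝ) + 1)) atTop (𝓝 0) :=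
    tendsto_one_div_add_atTop_nhds_zero_nat
  have hlim2 := tendsto_integral_exp_mul hac hbc hwc (g := fun m t => (u m).eval (s t))
    (g' := fun t => F n (s t)) (M := M + 1) (fun m => by fun_prop)
    (fun m t ht => by
      have h1 := hu m _ (hsC t ht)
      have h2 : 1 / ((m : ℝ) + 1) ≤ 1 := by
        rw [div_le_one (by positivity)]; linarith [(Nat.cast_nonneg m : (0 : ℝ) ≤ m)]
      have h3 := norm_sub_norm_le ((u m).eval (s t)) (F n (s t))
      linarith [hM n t ht])
    (fun t ht => by
      rw [tendsto_iff_norm_sub_tendsto_zero]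
      exact squeeze_zero (fun _ => norm_nonneg _)
        (fun m => (hu m _ (hsC t (Ioo_subset_Icc_self ht))).le) h0)
  obtain ⟨m, hm, hmε⟩ := (((Metric.tendsto_nhds.1 hlim2) (ε / 2) (by positivity)).and
    (h0.eventually_lt_const hε)).exists
  refine ⟨u m, fun z hz => ?_, ?_⟩
  · rw [← (hFA n z hz).eq_of_nhds]
    refine (hu m z ?_).trans hmε
    rcases hz with hz | hz
    · exact Or.inl (Or.inl hz)
    · exact Or.inr hz
  · rw [dist_eq_norm] at hn hm
    have heq : ∀ t : ℝ, -2 * (q.eval (s t) + P.eval (s t) ^ 2 * (u m).eval (s t)) =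
        a t + b t * (u m).eval (s t) := fun t => by simp only [ha, hb]; ring
    have hn' : ‖(∫ t in (0 : ℝ)..1, Complex.exp (a t + b t * F n (s t)) * w t) - c‖ < ε / 2 := hn
    have hres : ‖(∫ t in (0 : ℝ)..1, Complex.exp (a t + b t * (u m).eval (s t)) * w t) - c‖ < ε :=
      (norm_sub_le_norm_sub_add_norm_sub _
        (∫ t in (0 : ℝ)..1, Complex.exp (a t + b t * F n (s t)) * w t) _).trans_lt (by linarith)
    change ‖(∫ t in (0 : ℝ)..1, Complex.exp (-2 * (q.eval (s t) +
      P.eval (s t) ^ 2 * (u m).eval (s t))) * w t) - c‖ < ε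
    simp only [heq]
    exact hres

end LocallyUnivalent

/-! ### Conformal embeddings; passing from a locally univalent function to its derivative and back.
-/

namespace LocallyUnivalent

open Metric

/-- `θ` maps the set `B` conformally and injectively into the plane. -/
structure IsConformalEmbedding (θ : ℂ → ℂ) (B : Set ℂ) : Prop where
  differentiableOn : DifferentiableOn ℂ θ B
  injOn : InjOn θ B
  deriv_ne_zero : ∀ z ∈ B, deriv θ z ≠ 0

theorem IsConformalEmbedding.mono {θ : ℂ → ℂ} {B B' : Set ℂ} (h : IsConformalEmbedding θ B)
    (hB : B' ⊆ B) : IsConformalEmbedding θ B' :=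
  ⟨h.differentiableOn.mono hB, h.injOn.mono hB, fun z hz => h.deriv_ne_zero z (hB hz)⟩

theorem IsConformalEmbedding.image_mem_nhds {θ : ℂ → ℂ} {B : Set ℂ} (h : IsConformalEmbedding θ B)
    (hB : IsOpen B) {z : ℂ} (hz : z ∈ B) {s : Set ℂ} (hs : s ∈ 𝓝 z) : θ '' s ∈ 𝓝 (θ z) := by
  have hst := (h.differentiableOn.analyticAt (hB.mem_nhds hz)).hasStrictDerivAt
  rw [← hst.map_nhds_eq (h.deriv_ne_zero z hz)]
  exact image_mem_map hs

theorem IsConformalEmbedding.isOpen_image {θ : ℂ → ℂ} {B : Set ℂ} (h : IsConformalEmbedding θ B)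
    (hB : IsOpen B) : IsOpen (θ '' B) := by
  rw [isOpen_iff_mem_nhds]
  rintro _ ⟨z, hz, rfl⟩
  exact h.image_mem_nhds hB hz (hB.mem_nhds hz)

theorem IsConformalEmbedding.exists_inverse {θ : ℂ → ℂ} {B : Set ℂ} (h : IsConformalEmbedding θ B)
    (hB : IsOpen B) : ∃ ψ : ℂ → ℂ, IsConformalEmbedding ψ (θ '' B) ∧ ∀ z ∈ B, ψ (θ z) = z := by
  set ψ := Function.invFunOn θ B
  have hψ : ∀ z ∈ B, ψ (θ z) = z := h.injOn.leftInvOn_invFunOn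
  have hder : ∀ z ∈ B, HasStrictDerivAt ψ (deriv θ z)⁻¹ (θ z) := by
    intro z hz
    refine HasStrictDerivAt.of_local_left_inverse (f := θ) ?_ ?_ (h.deriv_ne_zero z hz) ?_
    · rw [ContinuousAt, hψ z hz]
      intro s hs
      rw [mem_map]
      filter_upwards [h.image_mem_nhds hB hz (inter_mem hs (hB.mem_nhds hz))] with w hw
      obtain ⟨v, hv, rfl⟩ := hw
      rw [mem_preimage, hψ v hv.2]
      exact hv.1
    · rw [hψ z hz]
      exact (h.differentiableOn.analyticAt (hB.mem_nhds hz)).hasStrictDerivAt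
    · filter_upwards [h.image_mem_nhds hB hz (hB.mem_nhds hz)] with w hw
      obtain ⟨v, hv, rfl⟩ := hw
      rw [hψ v hv]
  refine ⟨ψ, ⟨?_, ?_, ?_⟩, hψ⟩
  · rintro _ ⟨z, hz, rfl⟩
    exact (hder z hz).hasDerivAt.differentiableAt.differentiableWithinAt
  · rintro _ ⟨z, hz, rfl⟩ _ ⟨w, hw, rfl⟩ hzw
    rw [hψ z hz, hψ w hw] at hzw
    rw [hzw]
  · rintro _ ⟨z, hz, rfl⟩
    rw [(hder z hz).hasDerivAt.deriv]
    exact inv_ne_zero (h.deriv_ne_zero z hz)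

theorem IsConformalEmbedding.isSimplyConnected_image {θ : ℂ → ℂ} {B : Set ℂ}
    (h : IsConformalEmbedding θ B) (hB : IsOpen B) (hsc : IsSimplyConnected B) :
    IsSimplyConnected (θ '' B) := by
  have hcont : Continuous (B.domRestrict θ) :=
    continuousOn_iff_continuous_domRestrict.1 h.differentiableOn.continuousOn
  have hopen : IsOpenMap (B.domRestrict θ) := by
    intro s hs
    rw [isOpen_iff_mem_nhds]
    rintro _ ⟨z, hz, rfl⟩
    have h1 : Subtype.val '' s ∈ 𝓝 (z : ℂ) :=
      (hB.isOpenMap_subtype_val s hs).mem_nhds ⟨z, hz, rfl⟩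
    have h2 := h.image_mem_nhds hB z.2 h1
    rwa [image_image] at h2
  have hemb := (IsOpenEmbedding.of_continuous_injective_isOpenMap hcont
    (injOn_iff_injective.1 h.injOn) hopen).isEmbedding
  have h1 := (hemb.isSimplyConnected_image (s := univ)).2 ?_
  · rwa [image_univ, range_domRestrict] at h1
  · have h2 := (Topology.IsEmbedding.subtypeVal (p := (· ∈ B))).isSimplyConnected_image (s := univ)
    rw [image_univ, Subtype.range_coe_subtype] at h2
    exact h2.1 hsc

/-- The finite values of a map into the sphere. -/
def finiteValue (F : ℂ → OnePoint ℂ) (z : ℂ) : ℂ := (F z).elim 0 id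

theorem coe_finiteValue {F : ℂ → OnePoint ℂ} {z : ℂ} (h : F z ≠ ∞) :
    (finiteValue F z : OnePoint ℂ) = F z := by
  obtain ⟨w, hw⟩ := OnePoint.ne_infty_iff_exists.1 h
  rw [finiteValue, ← hw]; rfl

theorem finiteValue_of_eq_coe {F : ℂ → OnePoint ℂ} {z w : ℂ} (h : F z = (w : OnePoint ℂ)) :
    finiteValue F z = w := by
  rw [finiteValue, h]; rfl

theorem IsLocUnivAt.analyticAt_finiteValue {F : ℂ → OnePoint ℂ} {z : ℂ} (hF : IsLocUnivAt F z)
    (hz : F z ≠ ∞) : AnalyticAt ℂ (finiteValue F) z ∧ deriv (finiteValue F) z ≠ 0 := by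
  obtain ⟨g, hg, hg', h⟩ := hF.exists_eventuallyEq_coe hz
  have h1 : finiteValue F =ᶠ[𝓝 z] g := h.mono fun w hw => finiteValue_of_eq_coe hw
  exact ⟨hg.congr h1.symm, by rwa [h1.deriv_eq]⟩

/-- The derivative of c/(w - z) has no term in 1/(w - z). This shape without residue is what permits
integration in `exists_isLocUnivAt_of_deriv`. -/
theorem IsLocUnivAt.exists_deriv_finiteValue {F : ℂ → OnePoint ℂ} {z : ℂ} (hF : IsLocUnivAt F z)
    (hz : F z = ∞) : ∃ (c : ℂ) (β : ℂ → ℂ), c ≠ 0 ∧ AnalyticAt ℂ β z ∧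
      deriv (finiteValue F) =ᶠ[𝓝[≠] z] fun w => -c / (w - z) ^ 2 + β w := by
  obtain ⟨c, β, hc, hβ, h⟩ := hF.exists_polar_part hz
  refine ⟨c, deriv β, hc, hβ.deriv, ?_⟩
  have h1 : finiteValue F =ᶠ[𝓝[≠] z] fun w => c / (w - z) + β w :=
    h.mono fun w hw => finiteValue_of_eq_coe hw
  filter_upwards [h1.nhdsNE_deriv, hβ.eventually_analyticAt.filter_mono nhdsWithin_le_nhds,
    self_mem_nhdsWithin] with w hw hβw hwz
  have hwz' : w - z ≠ 0 := sub_ne_zero.2 hwz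
  rw [hw]
  have h2 := (((hasDerivAt_id w).sub_const z).fun_inv hwz').const_mul c |>.add
    hβw.differentiableAt.hasDerivAt
  have h3 : HasDerivAt (fun w => c / (w - z) + β w) (-c / (w - z) ^ 2 + deriv β w) w :=
    h2.congr_deriv (by simp only [id]; ring)
  exact h3.deriv

/-- The derivative of a locally univalent meromorphic function, written as `exp (-2 * h) / P ^ 2`
with a polynomial `P` that has simple zeros at the poles. -/
theorem exists_hasDerivAt_exp_div {V : Set ℂ} (hV : IsOpen V) (hsc : IsSimplyConnected V)
    {F : ℂ → OnePoint ℂ} (hF : ∀ z ∈ V, IsLocUnivAt F z) (P : Polynomial ℂ)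
    (hP : ∀ z ∈ V, P.eval z = 0 ↔ F z = ∞)
    (hP' : ∀ z ∈ V, P.eval z = 0 → P.derivative.eval z ≠ 0) :
    ∃ h : ℂ → ℂ, DifferentiableOn ℂ h V ∧ ∀ z ∈ V, F z ≠ ∞ →
      HasDerivAt (finiteValue F) (Complex.exp (-2 * h z) / P.eval z ^ 2) z := by
  have hPan : ∀ z, AnalyticAt ℂ (fun w => P.eval w) z := fun z =>
    (P.differentiable.analyticAt z)
  -- The double zero of P² cancels the double pole of the derivative, so the product extends to a
  -- holomorphic function without zeros, which has a logarithm.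
  have hloc : ∀ z ∈ V, ∃ e : ℂ → ℂ, AnalyticAt ℂ e z ∧
      (fun w => deriv (finiteValue F) w * P.eval w ^ 2) =ᶠ[𝓝[≠] z] e ∧ e z ≠ 0 ∧
      (F z ≠ ∞ → e z = deriv (finiteValue F) z * P.eval z ^ 2) := by
    intro z hz
    by_cases hFz : F z = ∞
    · obtain ⟨c, β, hc, hβ, hev⟩ := (hF z hz).exists_deriv_finiteValue hFz
      obtain ⟨k, hk, hkz, hPk⟩ := exists_analyticAt_eq_sub_mul (hPan z)
      have hPz : P.eval z = 0 := (hP z hz).2 hFz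
      refine ⟨fun w => -c * k w ^ 2 + β w * P.eval w ^ 2,
        (analyticAt_const.mul (hk.pow 2)).add (hβ.mul ((hPan z).pow 2)), ?_, ?_,
        fun h => absurd hFz h⟩
      · filter_upwards [hev, self_mem_nhdsWithin] with w hw hwz
        have hwz' : w - z ≠ 0 := sub_ne_zero.2 hwz
        rw [hw, hPk w, hPz, zero_add]
        field_simp
      · simp only [hPz, ne_eq, OfNat.ofNat_ne_zero, not_false_eq_true, zero_pow, mul_zero, add_zero]
        refine mul_ne_zero (neg_ne_zero.2 hc) (pow_ne_zero 2 ?_)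
        rw [hkz, Polynomial.deriv]
        exact hP' z hz hPz
    · obtain ⟨h1, h2⟩ := (hF z hz).analyticAt_finiteValue hFz
      refine ⟨_, h1.deriv.mul ((hPan z).pow 2), EventuallyEq.rfl, ?_, fun _ => rfl⟩
      exact mul_ne_zero h2 (pow_ne_zero 2 fun h => hFz ((hP z hz).1 h))
  obtain ⟨G, hG, hGd⟩ := exists_differentiableOn_eventuallyEq (V := V) fun z hz =>
    let ⟨e, he, hE, _⟩ := hloc z hz
    ⟨e, he, hE⟩
  obtain ⟨l, hl, hle⟩ := exists_differentiableOn_exp_eq hV hsc (hGd hV) fun z hz => by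
    obtain ⟨e, he, hE, he0, -⟩ := hloc z hz
    rwa [hG z hz e he hE]
  refine ⟨fun z => -(l z) / 2, hl.neg.div_const 2, fun z hz hFz => ?_⟩
  obtain ⟨e, he, hE, he0, hez⟩ := hloc z hz
  have h1 := ((hF z hz).analyticAt_finiteValue hFz).1.differentiableAt.hasDerivAt
  refine h1.congr_deriv ?_
  have h2 : P.eval z ≠ 0 := fun h => hFz ((hP z hz).1 h)
  rw [show -2 * (-(l z) / 2) = l z by ring, hle z hz, hG z hz e he hE, hez hFz]
  field_simp

/-- A meromorphic function with double poles without residues, and without zeros, is the derivative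
of a locally univalent meromorphic function. -/
theorem exists_isLocUnivAt_of_deriv (D : ℂ → ℂ) (T : Finset ℂ)
    (hD : ∀ z ∉ T, AnalyticAt ℂ D z ∧ D z ≠ 0)
    (hT : ∀ a ∈ T, ∃ (c : ℂ) (β : ℂ → ℂ), c ≠ 0 ∧ AnalyticAt ℂ β a ∧
      D =ᶠ[𝓝[≠] a] fun w => -c / (w - a) ^ 2 + β w) (x : ℂ) (hx : x ∉ T) (v : ℂ) :
    ∃ F : ℂ → OnePoint ℂ, (∀ z, IsLocUnivAt F z) ∧ (∀ z, F z = ∞ ↔ z ∈ T) ∧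
      (∀ z ∉ T, HasDerivAt (finiteValue F) (D z) z) ∧ finiteValue F x = v := by
  have hT' : ∀ a, ∃ (c : ℂ) (β : ℂ → ℂ), a ∈ T → c ≠ 0 ∧ AnalyticAt ℂ β a ∧
      D =ᶠ[𝓝[≠] a] fun w => -c / (w - a) ^ 2 + β w := fun a => by
    by_cases ha : a ∈ T
    · obtain ⟨c, β, h⟩ := hT a ha
      exact ⟨c, β, fun _ => h⟩
    · exact ⟨0, 0, fun h => absurd h ha⟩
  choose c β hcβ using hT'
  have hsq : ∀ (S : Finset ℂ) (z : ℂ), z ∉ S →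
      AnalyticAt ℂ (fun w => ∑ a ∈ S, c a / (w - a) ^ 2) z := fun S z hz => by
    refine Finset.analyticAt_fun_sum _ fun a ha => ?_
    exact analyticAt_const.div (by fun_prop) (pow_ne_zero 2 (sub_ne_zero.2 fun h => hz (h ▸ ha)))
  have hinv : ∀ (S : Finset ℂ) (z : ℂ), z ∉ S →
      AnalyticAt ℂ (fun w => ∑ a ∈ S, c a / (w - a)) z := fun S z hz => by
    refine Finset.analyticAt_fun_sum _ fun a ha => ?_
    exact analyticAt_const.div (by fun_prop) (sub_ne_zero.2 fun h => hz (h ▸ ha))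
  classical
  -- With the principal parts removed, `D` becomes entire and has a primitive. Each removed term
  -- -c/(w - a)² has the primitive c/(w - a), and the constant `K` gives the value `v` at `x`.
  obtain ⟨G₀, hG₀, hG₀d⟩ := exists_differentiableOn_eventuallyEq (V := univ)
    (E := fun w => D w + ∑ a ∈ T, c a / (w - a) ^ 2) fun z _ => by
      by_cases hz : z ∈ T
      · obtain ⟨-, hβ, hev⟩ := hcβ z hz
        refine ⟨fun w => β z w + ∑ a ∈ T.erase z, c a / (w - a) ^ 2,
          hβ.add (hsq _ z (Finset.notMem_erase z T)), ?_⟩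
        filter_upwards [hev] with w hw
        rw [hw, ← Finset.add_sum_erase T _ hz]
        ring
      · exact ⟨_, (hD z hz).1.add (hsq T z hz), EventuallyEq.rfl⟩
  obtain ⟨G, hG⟩ := (differentiableOn_univ.1 (hG₀d isOpen_univ)).isExactOn_univ
  have hGan : ∀ z, AnalyticAt ℂ G z := fun z =>
    (show Differentiable ℂ G from fun w => (hG w trivial).differentiableAt).analyticAt z
  set K : ℂ := v - (G x + ∑ a ∈ T, c a / (x - a)) with hK
  set f : ℂ → ℂ := fun z => G z + ∑ a ∈ T, c a / (z - a) + K with hf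
  set F : ℂ → OnePoint ℂ := fun z => if z ∈ T then ∞ else ((f z : ℂ) : OnePoint ℂ) with hF
  have hFT : ∀ z ∈ T, F z = ∞ := fun z hz => by simp [hF, hz]
  have hFT' : ∀ z ∉ T, F z = ((f z : ℂ) : OnePoint ℂ) := fun z hz => by simp [hF, hz]
  have hTo : IsOpen ((T : Set ℂ)ᶜ) := T.finite_toSet.isClosed.isOpen_compl
  have hFev : ∀ z ∉ T, F =ᶠ[𝓝 z] fun w => ((f w : ℂ) : OnePoint ℂ) := fun z hz => by
    filter_upwards [hTo.mem_nhds (show z ∈ (T : Set ℂ)ᶜ from hz)] with w hw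
    exact hFT' w hw
  have hfd : ∀ z ∉ T, HasDerivAt f (D z) z := fun z hz => by
    have h1 : HasDerivAt (fun w => ∑ a ∈ T, c a / (w - a)) (∑ a ∈ T, -(c a / (z - a) ^ 2)) z := by
      refine HasDerivAt.fun_sum fun a ha => ?_
      have hza : z - a ≠ 0 := sub_ne_zero.2 fun h => hz (h ▸ ha)
      have h2 := (((hasDerivAt_id z).sub_const a).fun_inv hza).const_mul (c a)
      exact h2.congr_deriv (by simp only [id]; ring)
    refine (((hG z trivial).add h1).add_const K).congr_deriv ?_
    have h3 := hG₀ z trivial (fun w => D w + ∑ a ∈ T, c a / (w - a) ^ 2)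
      ((hD z hz).1.add (hsq T z hz)) EventuallyEq.rfl
    rw [h3, Finset.sum_neg_distrib]
    ring
  have hfan : ∀ z ∉ T, AnalyticAt ℂ f z := fun z hz =>
    ((hGan z).add (hinv T z hz)).add analyticAt_const
  refine ⟨F, fun z => ?_, fun z => ?_, fun z hz => ?_, ?_⟩
  · by_cases hz : z ∈ T
    · refine isLocUnivAt_of_polar_part (hFT z hz) (hcβ z hz).1
        (β := fun w => G w + ∑ a ∈ T.erase z, c a / (w - a) + K)
        (((hGan z).add (hinv _ z (Finset.notMem_erase z T))).add analyticAt_const) ?_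
      have h1 : ((T.erase z : Finset ℂ) : Set ℂ)ᶜ ∈ 𝓝 z :=
        (T.erase z).finite_toSet.isClosed.isOpen_compl.mem_nhds (Finset.notMem_erase z T)
      filter_upwards [nhdsWithin_le_nhds h1, self_mem_nhdsWithin] with w hw hwz
      have hwT : w ∉ T := fun h => hw (Finset.mem_coe.2 (Finset.mem_erase.2 ⟨hwz, h⟩))
      rw [hFT' w hwT, hf]
      simp only
      rw [← Finset.add_sum_erase T _ hz]
      congr 1
      ring
    · refine (isLocUnivAt_coe (hfan z hz) ?_).congr (hFev z hz).symm
      rw [(hfd z hz).deriv]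
      exact (hD z hz).2
  · by_cases hz : z ∈ T
    · simp [hFT z hz, hz]
    · simp [hFT' z hz, hz]
  · refine (hfd z hz).congr_of_eventuallyEq ?_
    filter_upwards [hFev z hz] with w hw
    exact finiteValue_of_eq_coe hw
  · rw [finiteValue_of_eq_coe (hFT' x hx)]
    simp only [hf, hK]
    ring

/-- A function on a punctured disc whose derivative extends to a small holomorphic function is
nearly constant. -/
theorem norm_sub_le_of_hasDerivAt_ball_diff {R ρ : ℝ} (hρ : 0 < ρ) (hρR : ρ < R) {S : Set ℂ}
    (hS : S.Finite) {f g : ℂ → ℂ} (hg : DifferentiableOn ℂ g (ball 0 R))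
    (hf : ∀ z ∈ ball (0 : ℂ) R \ S, HasDerivAt f (g z) z) {η : ℝ}
    (hη : ∀ z ∈ closedBall (0 : ℂ) ρ, ‖g z‖ ≤ η) {z w : ℂ} (hz : z ∈ closedBall (0 : ℂ) ρ \ S)
    (hw : w ∈ closedBall (0 : ℂ) ρ \ S) : ‖f z - f w‖ ≤ η * (2 * ρ) := by
  have hsub : closedBall (0 : ℂ) ρ ⊆ ball 0 R := closedBall_subset_ball hρR
  -- The punctured disc is connected, so `f` differs there by a constant from a primitive of `g` on
  -- the full disc. The mean value inequality can then be used on the convex disc, across the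
  -- punctures.
  obtain ⟨G, hG⟩ := hg.isExactOn_ball
  obtain ⟨K, hK⟩ := (isOpen_ball.sdiff hS.isClosed).exists_eq_add_of_deriv_eq
    (isPreconnected_ball_diff (hρ.trans hρR) hS.countable)
    (fun v hv => (hf v hv).differentiableAt.differentiableWithinAt)
    (fun v hv => (hG v hv.1).differentiableAt.differentiableWithinAt)
    (fun v hv => by rw [(hf v hv).deriv, (hG v hv.1).deriv])
  rw [hK ⟨hsub hz.1, hz.2⟩, hK ⟨hsub hw.1, hw.2⟩, add_sub_add_right_eq_sub]
  have hη0 : 0 ≤ η := (norm_nonneg _).trans (hη z hz.1)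
  refine ((convex_closedBall (0 : ℂ) ρ).norm_image_sub_le_of_norm_hasDerivWithin_le
    (fun v hv => (hG v (hsub hv)).hasDerivWithinAt) hη hw.1 hz.1).trans ?_
  refine mul_le_mul_of_nonneg_left ?_ hη0
  have h1 := mem_closedBall_zero_iff.1 hz.1
  have h2 := mem_closedBall_zero_iff.1 hw.1
  linarith [norm_sub_le z w]

end LocallyUnivalent

/-! ### Approximation on two disjoint conformal discs. -/

namespace LocallyUnivalent

open Metric Polynomial

/-- Two disjoint compact sets have points joined by a segment that meets the sets in its end points
only. -/
theorem exists_segment_inter_subset {E : Type*} [NormedAddCommGroup E] [NormedSpace ℝ E]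
    {A B : Set E} (hA : IsCompact A) (hB : IsCompact B) (hA0 : A.Nonempty) (hB0 : B.Nonempty) :
    ∃ x ∈ A, ∃ y ∈ B, segment ℝ x y ∩ A ⊆ {x} ∧ segment ℝ x y ∩ B ⊆ {y} := by
  -- A pair at minimal distance: another point of `A` or `B` on the segment would give a closer
  -- pair.
  obtain ⟨⟨x, y⟩, ⟨hx, hy⟩, hmin⟩ := (hA.prod hB).exists_isMinOn (hA0.prod hB0)
    (f := fun p : E × E => dist p.1 p.2) (by fun_prop)
  refine ⟨x, hx, y, hy, ?_, ?_⟩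
  · rintro z ⟨hz, hzA⟩
    have h1 := dist_add_dist_of_mem_segment hz
    have h2 : dist x y ≤ dist z y := hmin (mk_mem_prod hzA hy)
    have h3 : dist x z = 0 := le_antisymm (by linarith) dist_nonneg
    exact (dist_eq_zero.1 h3).symm
  · rintro z ⟨hz, hzB⟩
    have h1 := dist_add_dist_of_mem_segment hz
    have h2 : dist x y ≤ dist x z := hmin (mk_mem_prod hx hzB)
    have h3 : dist z y = 0 := le_antisymm (by linarith) dist_nonneg
    exact dist_eq_zero.1 h3

/-- The poles will lie in the interiors of the two discs, so this keeps them off the joining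
segment. -/
theorem notMem_interior_of_segment_inter_subset {E : Type*} [NormedAddCommGroup E]
    [NormedSpace ℝ E] {A : Set E} {x y : E} (hxy : x ≠ y) (h : segment ℝ x y ∩ A ⊆ {x}) :
    x ∉ interior A := by
  intro hx
  have hc : Tendsto (fun t : ℝ => AffineMap.lineMap x y t) (𝓝[>] (0 : ℝ)) (𝓝 x) := by
    have h1 : Continuous fun t : ℝ => (AffineMap.lineMap x y t : E) :=
      AffineMap.lineMap_continuous
    have h2 := h1.tendsto 0
    rw [AffineMap.lineMap_apply_zero] at h2
    exact h2.mono_left nhdsWithin_le_nhds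
  have h2 : ∀ᶠ t : ℝ in 𝓝[>] 0, t ∈ Ioo (0 : ℝ) 1 := Ioo_mem_nhdsGT zero_lt_one
  obtain ⟨t, htA, ht0, ht1⟩ :=
    ((hc.eventually (mem_interior_iff_mem_nhds.1 hx)).and h2).exists
  have hseg : (AffineMap.lineMap x y t : E) ∈ segment ℝ x y := by
    rw [segment_eq_image_lineMap]
    exact ⟨t, ⟨ht0.le, ht1.le⟩, rfl⟩
  have h3 : (AffineMap.lineMap x y t : E) = x := h ⟨hseg, htA⟩
  rw [AffineMap.lineMap_apply, vsub_eq_sub, vadd_eq_add, add_eq_right, smul_eq_zero, sub_eq_zero]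
    at h3
  exact h3.elim (fun h => ht0.ne' h) fun h => hxy h.symm

/-- The entire function (exp w - 1) / w serves to write the change of exp(-2h) / p² without division
by p, so that it continues holomorphically across the zeros of the polynomial. -/
theorem differentiable_dslope_exp : Differentiable ℂ (dslope Complex.exp 0) :=
  differentiableOn_univ.1 ((Complex.differentiableOn_dslope univ_mem).2
    Complex.differentiable_exp.differentiableOn)

theorem norm_dslope_exp_le {w : ℂ} (hw : ‖w‖ ≤ 1) : ‖dslope Complex.exp 0 w‖ ≤ 2 := by
  rcases eq_or_ne w 0 with rfl | h
  · simp
  · rw [dslope_of_ne _ h, slope_def_field, sub_zero, Complex.exp_zero, norm_div,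
      div_le_iff₀ (norm_pos_iff.2 h)]
    exact Complex.norm_exp_sub_one_le hw

theorem exp_eq_one_add_mul_dslope (w : ℂ) :
    Complex.exp w = 1 + w * dslope Complex.exp 0 w := by
  have := sub_smul_dslope Complex.exp 0 w
  rw [smul_eq_mul, Complex.exp_zero, sub_zero] at this
  rw [this]; ring

/-- The relative change of `exp (-2 * h) / p ^ 2` when `h` is increased by `p ^ 2 * e`. -/
theorem exp_add_div_sq (h p e : ℂ) (hp : p ≠ 0) :
    Complex.exp (-2 * (h + p ^ 2 * e)) / p ^ 2 = Complex.exp (-2 * h) / p ^ 2 +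
      Complex.exp (-2 * h) * (-2 * e) * dslope Complex.exp 0 (-2 * (p ^ 2 * e)) := by
  rw [mul_add, Complex.exp_add, exp_eq_one_add_mul_dslope (-2 * (p ^ 2 * e))]
  field_simp

theorem sub_eq_integral_of_hasDerivAt_segment {f D : ℂ → ℂ} {x y : ℂ}
    (hf : ∀ z ∈ segment ℝ x y, HasDerivAt f (D z) z) (hD : ContinuousOn D (segment ℝ x y)) :
    f y - f x = ∫ t in (0 : ℝ)..1, D (x + t * (y - x)) * (y - x) := by
  have hmem : ∀ t ∈ uIcc (0 : ℝ) 1, x + t * (y - x) ∈ segment ℝ x y := by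
    intro t ht
    rw [uIcc_of_le zero_le_one] at ht
    rw [segment_eq_image']
    exact ⟨t, ht, by simp⟩
  have h1 := intervalIntegral.integral_eq_sub_of_hasDerivAt (a := 0) (b := 1)
    (f := fun t : ℝ => f (x + t * (y - x))) (f' := fun t : ℝ => D (x + t * (y - x)) * (y - x))
    (fun t ht => ?_) ?_
  · rw [h1]; simp
  · have h2 : HasDerivAt (fun s : ℂ => x + s * (y - x)) (y - x) (t : ℂ) := by
      simpa using ((hasDerivAt_id (t : ℂ)).mul_const (y - x)).const_add x
    exact ((hf _ (hmem t ht)).comp (t : ℂ) h2).comp_ofReal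
  · refine ContinuousOn.intervalIntegrable (ContinuousOn.mul ?_ continuousOn_const)
    exact hD.comp (by fun_prop) hmem

/-- Approximation of a locally univalent meromorphic function on two disjoint conformal discs by a
locally univalent meromorphic function on the plane. -/
theorem exists_isLocUnivAt_dist_lt {ρ R : ℝ} (hρ : 0 < ρ) (hρR : ρ < R) {θ₁ θ₂ : ℂ → ℂ}
    (h₁ : IsConformalEmbedding θ₁ (ball 0 R)) (h₂ : IsConformalEmbedding θ₂ (ball 0 R))
    (hd : Disjoint (θ₁ '' ball 0 R) (θ₂ '' ball 0 R)) {H : ℂ → OnePoint ℂ}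
    (hH : ∀ z ∈ θ₁ '' ball 0 R ∪ θ₂ '' ball 0 R, IsLocUnivAt H z) {T : Finset ℂ}
    (hT : ∀ z ∈ θ₁ '' ball 0 R ∪ θ₂ '' ball 0 R, H z = ∞ ↔ z ∈ T)
    (hT' : (T : Set ℂ) ⊆ θ₁ '' ball 0 ρ ∪ θ₂ '' ball 0 ρ) {ε : ℝ} (hε : 0 < ε) :
    ∃ F : ℂ → OnePoint ℂ, (∀ z, IsLocUnivAt F z) ∧
      ∀ z ∈ θ₁ '' closedBall 0 ρ ∪ θ₂ '' closedBall 0 ρ, dist (F z) (H z) < ε := by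
  have hsub : closedBall (0 : ℂ) ρ ⊆ ball 0 R := closedBall_subset_ball hρR
  have hBsc : IsSimplyConnected (ball (0 : ℂ) R) :=
    (convex_ball 0 R).isSimplyConnected ⟨0, mem_ball_self (hρ.trans hρR)⟩
  set V₁ := θ₁ '' ball 0 R with hV₁
  set V₂ := θ₂ '' ball 0 R with hV₂
  set A₁ := θ₁ '' closedBall 0 ρ with hA₁
  set A₂ := θ₂ '' closedBall 0 ρ with hA₂
  have hV₁o : IsOpen V₁ := h₁.isOpen_image isOpen_ball
  have hV₂o : IsOpen V₂ := h₂.isOpen_image isOpen_ball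
  have hVo : IsOpen (V₁ ∪ V₂) := hV₁o.union hV₂o
  have hAV₁ : A₁ ⊆ V₁ := image_mono hsub
  have hAV₂ : A₂ ⊆ V₂ := image_mono hsub
  have hAV : A₁ ∪ A₂ ⊆ V₁ ∪ V₂ := union_subset_union hAV₁ hAV₂
  have hA₁c : IsCompact A₁ := (isCompact_closedBall 0 ρ).image_of_continuousOn
    (h₁.differentiableOn.continuousOn.mono hsub)
  have hA₂c : IsCompact A₂ := (isCompact_closedBall 0 ρ).image_of_continuousOn
    (h₂.differentiableOn.continuousOn.mono hsub)
  have h0 : (0 : ℂ) ∈ closedBall (0 : ℂ) ρ := mem_closedBall_self hρ.le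
  have hAd : Disjoint A₁ A₂ := hd.mono hAV₁ hAV₂
  obtain ⟨x, hx, y, hy, hsx, hsy⟩ := exists_segment_inter_subset hA₁c hA₂c
    ⟨_, mem_image_of_mem _ h0⟩ ⟨_, mem_image_of_mem _ h0⟩
  have hxy : x ≠ y := fun h => hAd.ne_of_mem hx hy h
  have hi₁ : θ₁ '' ball 0 ρ ⊆ interior A₁ := interior_maximal (image_mono ball_subset_closedBall)
    ((h₁.mono (ball_subset_ball hρR.le)).isOpen_image isOpen_ball)
  have hi₂ : θ₂ '' ball 0 ρ ⊆ interior A₂ := interior_maximal (image_mono ball_subset_closedBall)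
    ((h₂.mono (ball_subset_ball hρR.le)).isOpen_image isOpen_ball)
  have hTs : ∀ z ∈ segment ℝ x y, z ∉ T := by
    intro z hz hzT
    rcases hT' hzT with h | h
    · have hzx : z = x := hsx ⟨hz, interior_subset (hi₁ h)⟩
      exact notMem_interior_of_segment_inter_subset hxy hsx (hzx ▸ hi₁ h)
    · have hzy : z = y := hsy ⟨hz, interior_subset (hi₂ h)⟩
      rw [segment_symm] at hsy
      exact notMem_interior_of_segment_inter_subset hxy.symm hsy (hzy ▸ hi₂ h)
  set P : ℂ[X] := ∏ a ∈ T, (X - C a) with hPdef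
  have hP0 : ∀ z, P.eval z = 0 ↔ z ∈ T := fun z => by
    rw [hPdef, eval_prod, Finset.prod_eq_zero_iff]
    simp [sub_eq_zero]
  have hPsep : P.Separable := separable_prod_X_sub_C_iff'.2 fun _ _ _ _ h => h
  have hP' : ∀ z, P.eval z = 0 → P.derivative.eval z ≠ 0 := fun z hz =>
    hPsep.eval₂_derivative_ne_zero (RingHom.id ℂ) hz
  have hPH : ∀ z ∈ V₁ ∪ V₂, P.eval z = 0 ↔ H z = ∞ := fun z hz => (hP0 z).trans (hT z hz).symm
  obtain ⟨l₁, hl₁d, hl₁⟩ := exists_hasDerivAt_exp_div hV₁o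
    (h₁.isSimplyConnected_image isOpen_ball hBsc) (fun z hz => hH z (Or.inl hz)) P
    (fun z hz => hPH z (Or.inl hz)) fun z _ => hP' z
  obtain ⟨l₂, hl₂d, hl₂⟩ := exists_hasDerivAt_exp_div hV₂o
    (h₂.isSimplyConnected_image isOpen_ball hBsc) (fun z hz => hH z (Or.inr hz)) P
    (fun z hz => hPH z (Or.inr hz)) fun z _ => hP' z
  obtain ⟨l, hld, hl⟩ : ∃ l : ℂ → ℂ, DifferentiableOn ℂ l (V₁ ∪ V₂) ∧ ∀ z ∈ V₁ ∪ V₂, z ∉ T →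
      HasDerivAt (finiteValue H) (Complex.exp (-2 * l z) / P.eval z ^ 2) z := by
    classical
    have e₁ : ∀ z ∈ V₁, V₁.piecewise l₁ l₂ z = l₁ z := fun z hz => piecewise_eq_of_mem _ _ _ hz
    have e₂ : ∀ z ∈ V₂, V₁.piecewise l₁ l₂ z = l₂ z := fun z hz =>
      piecewise_eq_of_notMem _ _ _ fun h => hd.ne_of_mem h hz rfl
    refine ⟨V₁.piecewise l₁ l₂,
      (hl₁d.congr e₁).union_of_isOpen (hl₂d.congr e₂) hV₁o hV₂o, ?_⟩
    rintro z hz hzT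
    have hzH : H z ≠ ∞ := fun h => hzT ((hT z hz).1 h)
    rcases hz with hz | hz
    · rw [e₁ z hz]; exact hl₁ z hz hzH
    · rw [e₂ z hz]; exact hl₂ z hz hzH
  have hTV : (T : Set ℂ) ⊆ V₁ ∪ V₂ := hT'.trans (union_subset_union
    (image_mono (ball_subset_ball hρR.le)) (image_mono (ball_subset_ball hρR.le)))
  -- Each pole is listed twice, so the division is by P².
  obtain ⟨q, k, hk, hlq⟩ := exists_eq_eval_add_mul hVo hld (T.val + T.val) fun a ha => by
    rw [Multiset.mem_add, or_self] at ha
    exact hTV ha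
  have hlq' : ∀ z, l z = q.eval z + P.eval z ^ 2 * k z := fun z => by
    rw [hlq z, Multiset.map_add, Multiset.prod_add, eval_mul, ← sq]
    rfl
  have hAc : IsCompact (A₁ ∪ A₂) := hA₁c.union hA₂c
  obtain ⟨M₁, hM₁⟩ := hAc.exists_bound_of_continuousOn (f := fun z => Complex.exp (-2 * l z))
    (((continuousOn_const.mul hld.continuousOn).mono hAV).cexp)
  obtain ⟨M₂, hM₂⟩ := hAc.exists_bound_of_continuousOn (f := fun z => P.eval z ^ 2)
    (P.continuous.pow 2).continuousOn
  obtain ⟨N₁, hN₁⟩ := (isCompact_closedBall (0 : ℂ) ρ).exists_bound_of_continuousOn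
    ((h₁.differentiableOn.deriv isOpen_ball).continuousOn.mono hsub)
  obtain ⟨N₂, hN₂⟩ := (isCompact_closedBall (0 : ℂ) ρ).exists_bound_of_continuousOn
    ((h₂.differentiableOn.deriv isOpen_ball).continuousOn.mono hsub)
  have hxV : x ∈ A₁ ∪ A₂ := Or.inl hx
  have hyV : y ∈ A₁ ∪ A₂ := Or.inr hy
  have hM₁0 : 0 ≤ M₁ := (norm_nonneg _).trans (hM₁ x hxV)
  have hM₂0 : 0 ≤ M₂ := (norm_nonneg _).trans (hM₂ x hxV)
  have hN₁0 : 0 ≤ N₁ := (norm_nonneg _).trans (hN₁ 0 h0)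
  have hN₂0 : 0 ≤ N₂ := (norm_nonneg _).trans (hN₂ 0 h0)
  -- With accuracy `L⁻¹`, the argument of `dslope Complex.exp 0` stays in the unit disc (`hε₁`), and
  -- the oscillation of `F - H` on a disc plus its value at a base point is below `ε` (`hε₂`).
  set L : ℝ := 2 * M₂ + (4 * M₁ * (N₁ + N₂) * (2 * ρ) + 1) / ε + 1 with hL
  have hL0 : 0 < L := by positivity
  obtain ⟨u, hu, huc⟩ := exists_polynomial_approx_integral hA₁c hA₂c hVo hAV hAd hk
    (fun a ha => HasLogOn.image_closedBall hρ (h₁.differentiableOn.continuousOn.mono hsub)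
      (h₁.injOn.mono hsub) ha)
    (fun a ha => HasLogOn.image_closedBall hρ (h₂.differentiableOn.continuousOn.mono hsub)
      (h₂.injOn.mono hsub) ha) hx hy hsx hsy P q (fun z hz h => hTs z hz ((hP0 z).1 h))
    (finiteValue H y - finiteValue H x) (inv_pos.2 hL0)
  have hε₁ : 2 * M₂ * L⁻¹ ≤ 1 := by
    rw [← div_eq_mul_inv, div_le_one hL0]
    have : 0 ≤ (4 * M₁ * (N₁ + N₂) * (2 * ρ) + 1) / ε := by positivity
    linarith
  have hε₂ : (4 * M₁ * (N₁ + N₂) * (2 * ρ) + 1) * L⁻¹ < ε := by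
    rw [← div_eq_mul_inv, div_lt_iff₀ hL0, ← div_lt_iff₀' hε]
    linarith
  set D : ℂ → ℂ := fun z =>
    Complex.exp (-2 * (q.eval z + P.eval z ^ 2 * u.eval z)) / P.eval z ^ 2 with hD
  -- `Y` is the difference D - H' away from the poles, in a form that is holomorphic on all of `V₁ ∪
  -- V₂`. Hence `D` inherits the principal parts of H'.
  set Y : ℂ → ℂ := fun z => Complex.exp (-2 * l z) * (-2 * (u.eval z - k z)) *
    dslope Complex.exp 0 (-2 * (P.eval z ^ 2 * (u.eval z - k z))) with hY
  have hYd : DifferentiableOn ℂ Y (V₁ ∪ V₂) := by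
    have hu' := u.differentiable.differentiableOn (s := V₁ ∪ V₂)
    have hP'' := P.differentiable.differentiableOn (s := V₁ ∪ V₂)
    refine ((((differentiableOn_const _).mul hld).cexp).mul
      ((differentiableOn_const _).mul (hu'.sub hk))).mul ?_
    exact differentiable_dslope_exp.comp_differentiableOn
      ((differentiableOn_const _).mul ((hP''.pow 2).mul (hu'.sub hk)))
  have hDY : ∀ z, z ∉ T → D z = Complex.exp (-2 * l z) / P.eval z ^ 2 + Y z := fun z hz => by
    rw [hY, ← exp_add_div_sq _ _ _ fun h => hz ((hP0 z).1 h), hlq' z]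
    simp only [hD]
    congr 3
    ring
  have hYb : ∀ z ∈ A₁ ∪ A₂, ‖Y z‖ ≤ 4 * M₁ * L⁻¹ := fun z hz => by
    have hu1 := (hu z hz).le
    have h1 : ‖-2 * (P.eval z ^ 2 * (u.eval z - k z))‖ ≤ 1 := by
      rw [norm_mul, norm_mul, norm_neg, Complex.norm_ofNat, ← mul_assoc]
      refine le_trans ?_ hε₁
      gcongr
      exact hM₂ z hz
    have h2 := norm_dslope_exp_le h1
    have h3 : ‖-2 * (u.eval z - k z)‖ ≤ 2 * L⁻¹ := by
      rw [norm_mul, norm_neg, Complex.norm_ofNat]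
      gcongr
    rw [hY]
    simp only
    rw [norm_mul, norm_mul]
    calc _ ≤ M₁ * (2 * L⁻¹) * 2 := by
          gcongr
          exact hM₁ z hz
      _ = 4 * M₁ * L⁻¹ := by ring
  have hDan : ∀ z ∉ T, AnalyticAt ℂ D z ∧ D z ≠ 0 := by
    intro z hz
    have hPz : P.eval z ≠ 0 := fun h => hz ((hP0 z).1 h)
    refine ⟨?_, div_ne_zero (Complex.exp_ne_zero _) (pow_ne_zero 2 hPz)⟩
    have hPa : ∀ p : ℂ[X], AnalyticAt ℂ (fun w => p.eval w) z := fun p =>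
      p.differentiable.analyticAt z
    exact ((analyticAt_const.mul ((hPa q).add (((hPa P).pow 2).mul (hPa u)))).cexp).div
      ((hPa P).pow 2) (pow_ne_zero 2 hPz)
  have hDT : ∀ a ∈ T, ∃ (c : ℂ) (β : ℂ → ℂ), c ≠ 0 ∧ AnalyticAt ℂ β a ∧
      D =ᶠ[𝓝[≠] a] fun w => -c / (w - a) ^ 2 + β w := by
    intro a ha
    have haV := hTV ha
    obtain ⟨c, β, hc, hβ, hev⟩ := (hH a haV).exists_deriv_finiteValue ((hT a haV).2 ha)
    refine ⟨c, fun w => β w + Y w, hc, hβ.add (hYd.analyticAt (hVo.mem_nhds haV)), ?_⟩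
    filter_upwards [hev, nhdsWithin_le_nhds (hVo.mem_nhds haV), nhdsWithin_le_nhds
      ((T.erase a).finite_toSet.isClosed.isOpen_compl.mem_nhds (Finset.notMem_erase a T)),
      self_mem_nhdsWithin] with w hw hwV hwT hwa
    have hwT' : w ∉ T := fun h => hwT (Finset.mem_coe.2 (Finset.mem_erase.2 ⟨hwa, h⟩))
    rw [hDY w hwT', ← (hl w hwV hwT').deriv, hw]
    ring
  obtain ⟨F, hF, hFT, hFD, hFx⟩ := exists_isLocUnivAt_of_deriv D T hDan hDT x
    (hTs x (left_mem_segment ℝ x y)) (finiteValue H x)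
  refine ⟨F, hF, ?_⟩
  have hdiff : ∀ z ∈ V₁ ∪ V₂, z ∉ T →
      HasDerivAt (fun w => finiteValue F w - finiteValue H w) (Y z) z := fun z hz hzT =>
    ((hFD z hzT).sub (hl z hz hzT)).congr_deriv (by rw [hDY z hzT]; ring)
  -- In the coordinate of the disc, `F - H` has a small holomorphic derivative off the poles, so it
  -- is nearly constant and closeness at one point `p` suffices. At the poles both functions are
  -- `∞`.
  have key : ∀ (θ : ℂ → ℂ) (N : ℝ), IsConformalEmbedding θ (ball 0 R) →
      θ '' ball 0 R ⊆ V₁ ∪ V₂ → θ '' closedBall 0 ρ ⊆ A₁ ∪ A₂ →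
      (∀ z ∈ closedBall (0 : ℂ) ρ, ‖deriv θ z‖ ≤ N) → N ≤ N₁ + N₂ →
      ∀ p ∈ θ '' closedBall 0 ρ, p ∉ T → ‖finiteValue F p - finiteValue H p‖ ≤ L⁻¹ →
      ∀ z ∈ θ '' closedBall 0 ρ, dist (F z) (H z) < ε := by
    rintro θ N hθ hθV hθA hN hNN _ ⟨p, hp, rfl⟩ hpT hpL _ ⟨z, hz, rfl⟩
    have hzV := hAV (hθA (mem_image_of_mem θ hz))
    by_cases hzT : θ z ∈ T
    · rw [(hFT _).2 hzT, (hT _ hzV).2 hzT, dist_self]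
      exact hε
    have hS : (ball 0 R ∩ θ ⁻¹' (T : Set ℂ)).Finite :=
      Set.Finite.of_finite_image ((T.finite_toSet).subset (by
        rintro _ ⟨w, hw, rfl⟩
        exact hw.2)) (hθ.injOn.mono inter_subset_left)
    have h1 := norm_sub_le_of_hasDerivAt_ball_diff hρ hρR hS
      (f := fun w => finiteValue F (θ w) - finiteValue H (θ w)) (g := fun w => Y (θ w) * deriv θ w)
      ((hYd.comp hθ.differentiableOn fun w hw => hθV (mem_image_of_mem θ hw)).mul
        (hθ.differentiableOn.deriv isOpen_ball))
      (fun w hw => (hdiff (θ w) (hθV (mem_image_of_mem θ hw.1))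
        fun h => hw.2 ⟨hw.1, h⟩).comp w
          (hθ.differentiableOn.differentiableAt (isOpen_ball.mem_nhds hw.1)).hasDerivAt)
      (η := 4 * M₁ * L⁻¹ * (N₁ + N₂)) (fun w hw => by
        rw [norm_mul]
        exact mul_le_mul (hYb _ (hθA (mem_image_of_mem θ hw))) ((hN w hw).trans hNN)
          (norm_nonneg _) (by positivity))
      (z := z) (w := p) ⟨hz, fun h => hzT h.2⟩ ⟨hp, fun h => hpT h.2⟩
    have hFz : F (θ z) ≠ ∞ := fun h => hzT ((hFT _).1 h)
    have hHz : H (θ z) ≠ ∞ := fun h => hzT ((hT _ hzV).1 h)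
    rw [← coe_finiteValue hFz, ← coe_finiteValue hHz]
    refine (dist_coe_le _ _).trans_lt (lt_of_le_of_lt ?_ hε₂)
    have h2 := norm_add_le
      ((finiteValue F (θ z) - finiteValue H (θ z)) - (finiteValue F (θ p) - finiteValue H (θ p)))
      (finiteValue F (θ p) - finiteValue H (θ p))
    rw [sub_add_cancel] at h2
    refine h2.trans ((add_le_add h1 hpL).trans (le_of_eq ?_))
    ring
  rintro z (hz | hz)
  · refine key θ₁ N₁ h₁ subset_union_left subset_union_left hN₁ (by linarith) x hx
      (hTs x (left_mem_segment ℝ x y)) ?_ z hz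
    rw [hFx, sub_self, norm_zero]
    exact (inv_pos.2 hL0).le
  -- At `y` the difference `F - H` equals the integral of `D` along the segment minus `H y - H x`,
  -- which is small by the choice of `u`.
  · refine key θ₂ N₂ h₂ subset_union_right subset_union_right hN₂ (by linarith) y hy
      (hTs y (right_mem_segment ℝ x y)) ?_ z hz
    have h3 := sub_eq_integral_of_hasDerivAt_segment (fun z hz => hFD z (hTs z hz)) (by
      refine ContinuousOn.div ?_ ?_ ?_
      · exact Continuous.continuousOn (Complex.continuous_exp.comp
          (continuous_const.mul (q.continuous.add ((P.continuous.pow 2).mul u.continuous))))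
      · exact (P.continuous.pow 2).continuousOn
      · exact fun z hz => pow_ne_zero 2 fun h => hTs z hz ((hP0 z).1 h))
    have h4 : (∫ t in (0 : ℝ)..1, D (x + t * (y - x)) * (y - x)) =
        ∫ t in (0 : ℝ)..1, Complex.exp (-2 * (q.eval (x + t * (y - x)) +
          P.eval (x + t * (y - x)) ^ 2 * u.eval (x + t * (y - x)))) *
          ((y - x) / P.eval (x + t * (y - x)) ^ 2) := by
      refine intervalIntegral.integral_congr fun t _ => ?_
      simp only [hD]
      ring
    rw [← h4, ← h3, hFx] at huc
    refine le_of_eq_of_le ?_ huc.le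
    congr 1
    ring

end LocallyUnivalent

/-! ### Transfer of the approximation to a simply connected domain. -/

namespace LocallyUnivalent

open Metric

theorem IsLocUnivAt.eventually_ne_infty {F : ℂ → OnePoint ℂ} {z : ℂ} (hF : IsLocUnivAt F z) :
    ∀ᶠ w in 𝓝[≠] z, F w ≠ ∞ := by
  by_cases hz : F z = ∞
  · obtain ⟨c, β, -, -, h⟩ := hF.exists_polar_part hz
    filter_upwards [h] with w hw
    rw [hw]
    exact OnePoint.coe_ne_infty _
  · obtain ⟨g, -, -, h⟩ := hF.exists_eventuallyEq_coe hz
    filter_upwards [nhdsWithin_le_nhds h] with w hw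
    rw [hw]
    exact OnePoint.coe_ne_infty _

theorem finite_setOf_eq_infty {F : ℂ → OnePoint ℂ} {K : Set ℂ} (hK : IsCompact K)
    (hF : ∀ z ∈ K, IsLocUnivAt F z) : {z ∈ K | F z = ∞}.Finite := by
  obtain ⟨t, -, ht⟩ := hK.elim_nhds_subcover (fun z => {w | w ≠ z → F w ≠ ∞} ∪ Kᶜ) fun z hz =>
    mem_of_superset (eventually_nhdsWithin_iff.1 (hF z hz).eventually_ne_infty) subset_union_left
  refine t.finite_toSet.subset ?_
  rintro w ⟨hwK, hw⟩
  obtain ⟨z, hz, hwz⟩ := mem_iUnion₂.1 (ht hwK)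
  rcases hwz with hwz | hwz
  · by_cases h : w = z
    · exact h ▸ hz
    · exact absurd hw (hwz h)
  · exact absurd hwK hwz

/-- Simultaneous approximation of two locally univalent meromorphic functions on discs, after
transplanting the discs to disjoint subsets of the plane. -/
theorem exists_isLocUnivAt_dist_comp_lt {r R₀ : ℝ} (hr : r < R₀) (hR₀ : 0 < R₀)
    {θ₁ θ₂ : ℂ → ℂ} (h₁ : IsConformalEmbedding θ₁ (ball 0 R₀))
    (h₂ : IsConformalEmbedding θ₂ (ball 0 R₀))
    (hd : Disjoint (θ₁ '' ball 0 R₀) (θ₂ '' ball 0 R₀)) {F₁ F₂ : ℂ → OnePoint ℂ}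
    (hF₁ : ∀ z ∈ ball (0 : ℂ) R₀, IsLocUnivAt F₁ z) (hF₂ : ∀ z ∈ ball (0 : ℂ) R₀, IsLocUnivAt F₂ z)
    {ε : ℝ} (hε : 0 < ε) : ∃ F : ℂ → OnePoint ℂ, (∀ z, IsLocUnivAt F z) ∧
      ∀ z ∈ closedBall (0 : ℂ) r, dist (F (θ₁ z)) (F₁ z) < ε ∧ dist (F (θ₂ z)) (F₂ z) < ε := by
  classical
  obtain ⟨R₁, hrR₁, hR₁⟩ := exists_between (max_lt hr hR₀)
  have hsub₁ : closedBall (0 : ℂ) R₁ ⊆ ball 0 R₀ := closedBall_subset_ball hR₁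
  have hS : ∀ F : ℂ → OnePoint ℂ, (∀ z ∈ ball (0 : ℂ) R₀, IsLocUnivAt F z) →
      {z ∈ closedBall (0 : ℂ) R₁ | F z = ∞}.Finite := fun F hF =>
    finite_setOf_eq_infty (isCompact_closedBall 0 R₁) fun z hz => hF z (hsub₁ hz)
  set S₁ := {z ∈ closedBall (0 : ℂ) R₁ | F₁ z = ∞}
  set S₂ := {z ∈ closedBall (0 : ℂ) R₁ | F₂ z = ∞}
  have hS₁ : S₁.Finite := hS F₁ hF₁
  have hS₂ : S₂.Finite := hS F₂ hF₂
  set N : Set ℝ := norm '' (S₁ ∪ S₂)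
  have hN : N.Finite := (hS₁.union hS₂).image _
  set r₀ := max r 0
  -- There are finitely many poles of modulus at most `R₁`, so an interval just above `r₀` contains
  -- no modulus of a pole. With ρ < R in it, all poles in the disc of radius `R` lie in the open
  -- disc of radius `ρ`. A pole of modulus `r₀` itself does no harm.
  have hNr : (N \ {r₀})ᶜ ∩ Iio R₁ ∈ 𝓝[>] r₀ := nhdsWithin_le_nhds (inter_mem
    ((hN.subset sdiff_subset).isClosed.isOpen_compl.mem_nhds fun h => h.2 rfl) (Iio_mem_nhds hrR₁))
  obtain ⟨R, hr₀R, hR⟩ := mem_nhdsGT_iff_exists_Ioo_subset.1 hNr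
  obtain ⟨ρ, hρ, hρR⟩ := exists_between (show r₀ < R from hr₀R)
  have hρ0 : 0 < ρ := (le_max_right r 0).trans_lt hρ
  have hRR₁ : R ≤ R₁ := by
    by_contra! h
    exact lt_irrefl R₁ (hR (show R₁ ∈ Ioo r₀ R from ⟨hrR₁, h⟩)).2
  have hRsub : ball (0 : ℂ) R ⊆ ball 0 R₀ := ball_subset_ball (hRR₁.trans hR₁.le)
  have hpole : ∀ z ∈ ball (0 : ℂ) R, z ∈ S₁ ∪ S₂ → z ∈ ball (0 : ℂ) ρ := by
    intro z hz hzS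
    rw [mem_ball_zero_iff] at hz ⊢
    by_contra! h
    have h1 : ‖z‖ ∈ Ioo r₀ R := ⟨hρ.trans_le h, hz⟩
    exact (hR h1).1 ⟨mem_image_of_mem _ hzS, ne_of_gt h1.1⟩
  have hmemS : ∀ z ∈ ball (0 : ℂ) R, z ∈ closedBall (0 : ℂ) R₁ := fun z hz =>
    ball_subset_closedBall (ball_subset_ball hRR₁ hz)
  obtain ⟨ψ₁, hψ₁, hψθ₁⟩ := (h₁.mono hRsub).exists_inverse isOpen_ball
  obtain ⟨ψ₂, hψ₂, hψθ₂⟩ := (h₂.mono hRsub).exists_inverse isOpen_ball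
  have hV₁ := (h₁.mono hRsub).isOpen_image isOpen_ball
  have hV₂ := (h₂.mono hRsub).isOpen_image isOpen_ball
  have hdR : Disjoint (θ₁ '' ball 0 R) (θ₂ '' ball 0 R) :=
    hd.mono (image_mono hRsub) (image_mono hRsub)
  set H : ℂ → OnePoint ℂ := fun p => if p ∈ θ₁ '' ball 0 R then F₁ (ψ₁ p) else F₂ (ψ₂ p)
    with hH
  have hH₁' : ∀ p ∈ θ₁ '' ball 0 R, H p = F₁ (ψ₁ p) := fun p hp => if_pos hp
  have hH₂' : ∀ p ∈ θ₂ '' ball 0 R, H p = F₂ (ψ₂ p) := fun p hp =>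
    if_neg fun h => hdR.ne_of_mem h hp rfl
  have hH₁ : ∀ z ∈ ball (0 : ℂ) R, H (θ₁ z) = F₁ z := fun z hz => by
    rw [hH₁' _ (mem_image_of_mem _ hz), hψθ₁ z hz]
  have hH₂ : ∀ z ∈ ball (0 : ℂ) R, H (θ₂ z) = F₂ z := fun z hz => by
    rw [hH₂' _ (mem_image_of_mem _ hz), hψθ₂ z hz]
  have hTf : (θ₁ '' (S₁ ∩ ball 0 ρ) ∪ θ₂ '' (S₂ ∩ ball 0 ρ)).Finite :=
    ((hS₁.inter_of_left _).image _).union ((hS₂.inter_of_left _).image _)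
  have hθsub : ball (0 : ℂ) ρ ⊆ ball 0 R := ball_subset_ball hρR.le
  have hHU : ∀ p ∈ θ₁ '' ball 0 R ∪ θ₂ '' ball 0 R, IsLocUnivAt H p := by
    rintro p (hp | hp)
    · have h3 : IsLocUnivAt (fun w => F₁ (ψ₁ w)) p := by
        refine IsLocUnivAt.comp ?_ (hψ₁.differentiableOn.analyticAt (hV₁.mem_nhds hp))
          (hψ₁.deriv_ne_zero p hp)
        obtain ⟨z, hz, rfl⟩ := hp
        rw [hψθ₁ z hz]
        exact hF₁ z (hRsub hz)
      exact h3.congr (eventually_of_mem (hV₁.mem_nhds hp) fun w hw => (hH₁' w hw).symm)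
    · have h3 : IsLocUnivAt (fun w => F₂ (ψ₂ w)) p := by
        refine IsLocUnivAt.comp ?_ (hψ₂.differentiableOn.analyticAt (hV₂.mem_nhds hp))
          (hψ₂.deriv_ne_zero p hp)
        obtain ⟨z, hz, rfl⟩ := hp
        rw [hψθ₂ z hz]
        exact hF₂ z (hRsub hz)
      exact h3.congr (eventually_of_mem (hV₂.mem_nhds hp) fun w hw => (hH₂' w hw).symm)
  have hHT : ∀ p ∈ θ₁ '' ball 0 R ∪ θ₂ '' ball 0 R, H p = ∞ ↔ p ∈ hTf.toFinset := by
    rintro p (⟨z, hz, rfl⟩ | ⟨z, hz, rfl⟩)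
    · rw [hH₁ z hz, Finite.mem_toFinset]
      constructor
      · intro h
        have hzS : z ∈ S₁ := ⟨hmemS z hz, h⟩
        exact Or.inl (mem_image_of_mem _ ⟨hzS, hpole z hz (Or.inl hzS)⟩)
      · rintro (⟨w, hw, hwz⟩ | ⟨w, hw, hwz⟩)
        · rw [← h₁.injOn (hRsub (hθsub hw.2)) (hRsub hz) hwz]
          exact hw.1.2
        · exact absurd hwz.symm (hdR.ne_of_mem (mem_image_of_mem _ hz)
            (mem_image_of_mem _ (hθsub hw.2)))
    · rw [hH₂ z hz, Finite.mem_toFinset]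
      constructor
      · intro h
        have hzS : z ∈ S₂ := ⟨hmemS z hz, h⟩
        exact Or.inr (mem_image_of_mem _ ⟨hzS, hpole z hz (Or.inr hzS)⟩)
      · rintro (⟨w, hw, hwz⟩ | ⟨w, hw, hwz⟩)
        · exact absurd hwz (hdR.ne_of_mem (mem_image_of_mem _ (hθsub hw.2))
            (mem_image_of_mem _ hz))
        · rw [← h₂.injOn (hRsub (hθsub hw.2)) (hRsub hz) hwz]
          exact hw.1.2
  have hTsub : (hTf.toFinset : Set ℂ) ⊆ θ₁ '' ball 0 ρ ∪ θ₂ '' ball 0 ρ := by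
    rw [Finite.coe_toFinset]
    exact union_subset_union (image_mono inter_subset_right) (image_mono inter_subset_right)
  obtain ⟨F, hF, hFH⟩ := exists_isLocUnivAt_dist_lt hρ0 hρR (h₁.mono hRsub) (h₂.mono hRsub) hdR
    (H := H) (T := hTf.toFinset) hHU hHT hTsub hε
  refine ⟨F, hF, fun z hz => ?_⟩
  have hzρ : z ∈ closedBall (0 : ℂ) ρ :=
    closedBall_subset_closedBall ((le_max_left r 0).trans hρ.le) hz
  have hzR : z ∈ ball (0 : ℂ) R := closedBall_subset_ball hρR hzρ
  rw [← hH₁ z hzR, ← hH₂ z hzR]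
  exact ⟨hFH _ (Or.inl (mem_image_of_mem _ hzρ)), hFH _ (Or.inr (mem_image_of_mem _ hzρ))⟩

/-- A simply connected domain has a conformal map onto a disc or the plane. -/
theorem exists_isConformalEmbedding {Ω : Set ℂ} (hΩ : IsOpen Ω) (hsc : IsSimplyConnected Ω) :
    ∃ ψ : ℂ → ℂ, IsConformalEmbedding ψ Ω ∧ ∀ K ⊆ Ω, IsCompact K → ∃ r R : ℝ, r < R ∧ 0 < R ∧
      ψ '' K ⊆ closedBall 0 r ∧ closedBall 0 R ⊆ ψ '' Ω := by
  by_cases hne : Ω = univ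
  · refine ⟨id, ⟨differentiableOn_id, injOn_id _, fun z _ => by simp⟩, fun K _ hK => ?_⟩
    obtain ⟨r, hr⟩ := hK.isBounded.subset_closedBall 0
    refine ⟨r, max r 0 + 1, ?_, ?_, by rwa [image_id], by simp [hne]⟩
    · linarith [le_max_left r 0]
    · linarith [le_max_right r 0]
  · obtain ⟨ψ, hψ, hbij, hder⟩ := exists_riemann_map hΩ hsc hne
    refine ⟨ψ, ⟨hψ, hbij.injOn, hder⟩, fun K hKΩ hK => ?_⟩
    have hKc : IsCompact (ψ '' K) := hK.image_of_continuousOn (hψ.continuousOn.mono hKΩ)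
    obtain ⟨r, hr, hKr⟩ := exists_lt_subset_ball hKc.isClosed
      ((image_mono hKΩ).trans hbij.image_eq.subset)
    obtain ⟨R, hR, hR1⟩ := exists_between (max_lt hr zero_lt_one)
    refine ⟨r, R, (le_max_left r 0).trans_lt hR, (le_max_right r 0).trans_lt hR,
      hKr.trans ball_subset_closedBall, ?_⟩
    rw [hbij.image_eq]
    exact closedBall_subset_ball hR1

/-- In a run-away sequence, the index that moves `K` off itself can be taken as large as
desired. -/
theorem exists_ge_image_inter_eq_empty {Ω : Set ℂ} (hne : Ω.Nonempty) {φ : ℕ → Ω → Ω}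
    (hrun : IsRunAway φ) {K : Set Ω} (hK : IsCompact K) (N : ℕ) :
    ∃ n ≥ N, φ n '' K ∩ K = ∅ := by
  obtain ⟨z, hz⟩ := hne
  set z₀ : Ω := ⟨z, hz⟩
  -- For an index `n < N` the point `φ n z₀` would lie both in the enlarged compact set and in its
  -- image.
  obtain ⟨n, hn⟩ := hrun (K ∪ (insert z₀ ((fun m => φ m z₀) '' Iio N)))
    (hK.union (((finite_Iio N).image _).insert _).isCompact)
  refine ⟨n, ?_, subset_empty_iff.1 (hn ▸ inter_subset_inter (image_mono subset_union_left)
    subset_union_left)⟩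
  by_contra! h
  have h1 : φ n z₀ ∈ (∅ : Set Ω) := hn ▸ ⟨mem_image_of_mem _ (Or.inr (mem_insert _ _)),
    Or.inr (mem_insert_of_mem _ ⟨n, h, rfl⟩)⟩
  exact h1

theorem extendInfty_eventuallyEq {Ω : Set ℂ} (hΩ : IsOpen Ω) {f : SphereMap Ω}
    {F : ℂ → OnePoint ℂ} (h : ∀ z : Ω, f.toFun z = F z) {z : ℂ} (hz : z ∈ Ω) :
    F =ᶠ[𝓝 z] extendInfty f :=
  eventually_of_mem (hΩ.mem_nhds hz) fun w hw => ((extendInfty_apply f ⟨w, hw⟩).trans (h _)).symm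

theorem comp_mem_locallyUnivalentMeromorphic {Ω : Set ℂ} (hΩ : IsOpen Ω) {f : SphereMap Ω}
    (hf : f ∈ locallyUnivalentMeromorphic Ω) {φ : Ω → Ω} (hφ : IsLocallyUnivalentSelfMap φ) :
    f.comp φ ∈ locallyUnivalentMeromorphic Ω := by
  rw [mem_locallyUnivalentMeromorphic_iff hΩ] at hf ⊢
  intro z hz
  have h1 : extendZero (fun w => (φ w : ℂ)) z = φ ⟨z, hz⟩ := extendZero_apply _ ⟨z, hz⟩
  refine IsLocUnivAt.congr (IsLocUnivAt.comp (F := extendInfty f) ?_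
    (hφ.1.analyticAt (hΩ.mem_nhds hz)) (hφ.2 z hz)) (extendInfty_eventuallyEq hΩ (fun w => ?_) hz)
  · rw [h1]
    exact hf _ (φ ⟨z, hz⟩).2
  · rw [extendZero_apply, extendInfty_apply]
    rfl

/-- Any two members of the family can be approximated on a compact set by `f` and by a composition
`f ∘ φ n`. -/
theorem exists_mem_dist_lt {Ω : Set ℂ} (hΩ : IsOpen Ω) (hsc : IsSimplyConnected Ω)
    {φ : ℕ → Ω → Ω} (hφ : ∀ n, IsLocallyUnivalentSelfMap (φ n)) (hrun : IsRunAway φ)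
    (hinj : IsEventuallyInjective φ) {f g : SphereMap Ω} (hf : f ∈ locallyUnivalentMeromorphic Ω)
    (hg : g ∈ locallyUnivalentMeromorphic Ω) {K : Set Ω} (hK : IsCompact K) {ε : ℝ} (hε : 0 < ε) :
    ∃ F ∈ locallyUnivalentMeromorphic Ω, ∃ n, ∀ z ∈ K,
      dist (F.toFun z) (f.toFun z) < ε ∧ dist ((F.comp (φ n)).toFun z) (g.toFun z) < ε := by
  obtain ⟨ψ, hψ, hψK⟩ := exists_isConformalEmbedding hΩ hsc
  obtain ⟨r, R, hrR, hR0, hKr, hRΩ⟩ := hψK (Subtype.val '' K) (by rintro _ ⟨z, -, rfl⟩; exact z.2)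
    (hK.image continuous_subtype_val)
  obtain ⟨χ, hχ, hχψ⟩ := hψ.exists_inverse hΩ
  have hψχ : ∀ w ∈ closedBall (0 : ℂ) R, χ w ∈ Ω ∧ ψ (χ w) = w := fun w hw => by
    obtain ⟨z, hz, rfl⟩ := hRΩ hw
    rw [hχψ z hz]
    exact ⟨hz, rfl⟩
  have hBR : ball (0 : ℂ) R ⊆ closedBall 0 R := ball_subset_closedBall
  -- Injectivity and disjointness are needed on a full conformal disc around `K`, not only on `K`.
  set K' : Set Ω := Subtype.val ⁻¹' (χ '' closedBall 0 R)
  have hK' : IsCompact K' := by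
    rw [Subtype.isCompact_iff, image_preimage_eq_of_subset]
    · exact (isCompact_closedBall 0 R).image_of_continuousOn
        (hχ.differentiableOn.continuousOn.mono hRΩ)
    · rintro _ ⟨w, hw, rfl⟩
      rw [Subtype.range_coe]
      exact (hψχ w hw).1
  obtain ⟨N, hN⟩ := hinj K' hK'
  obtain ⟨n, hnN, hn⟩ := exists_ge_image_inter_eq_empty hsc.nonempty hrun hK' N
  set Φ : ℂ → ℂ := extendZero fun z => (φ n z : ℂ)
  have hΦ : ∀ z : Ω, Φ z = φ n z := fun z => extendZero_apply _ z
  have hΦΩ : ∀ z ∈ Ω, Φ z ∈ Ω := fun z hz => by rw [hΦ ⟨z, hz⟩]; exact (φ n ⟨z, hz⟩).2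
  have hχB : IsConformalEmbedding χ (ball 0 R) := hχ.mono (hBR.trans hRΩ)
  -- This is `φ n` in the coordinate `ψ`. The approximation takes place in that coordinate plane, on
  -- the disc itself and on its image under this map.
  have hθ : IsConformalEmbedding (fun w => ψ (Φ (χ w))) (ball 0 R) := by
    have hdχ : ∀ w ∈ ball (0 : ℂ) R, HasDerivAt χ (deriv χ w) w := fun w hw =>
      (hχB.differentiableOn.differentiableAt (isOpen_ball.mem_nhds hw)).hasDerivAt
    have hdΦ : ∀ z ∈ Ω, HasDerivAt Φ (deriv Φ z) z := fun z hz =>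
      ((hφ n).1.differentiableAt (hΩ.mem_nhds hz)).hasDerivAt
    have hdψ : ∀ z ∈ Ω, HasDerivAt ψ (deriv ψ z) z := fun z hz =>
      (hψ.differentiableOn.differentiableAt (hΩ.mem_nhds hz)).hasDerivAt
    have hdθ : ∀ w ∈ ball (0 : ℂ) R, HasDerivAt (fun w => ψ (Φ (χ w)))
        (deriv ψ (Φ (χ w)) * (deriv Φ (χ w) * deriv χ w)) w := fun w hw => by
      have hwΩ := (hψχ w (hBR hw)).1
      exact (hdψ _ (hΦΩ _ hwΩ)).comp w ((hdΦ _ hwΩ).comp w (hdχ w hw))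
    refine ⟨fun w hw => (hdθ w hw).differentiableAt.differentiableWithinAt, ?_, ?_⟩
    · intro v hv w hw hvw
      have hvΩ := (hψχ v (hBR hv)).1
      have hwΩ := (hψχ w (hBR hw)).1
      have h1 := hψ.injOn (hΦΩ _ hvΩ) (hΦΩ _ hwΩ) hvw
      rw [hΦ ⟨_, hvΩ⟩, hΦ ⟨_, hwΩ⟩] at h1
      have h2 := hN n hnN (show (⟨_, hvΩ⟩ : Ω) ∈ K' from mem_image_of_mem _ (hBR hv))
        (show (⟨_, hwΩ⟩ : Ω) ∈ K' from mem_image_of_mem _ (hBR hw)) (Subtype.ext h1)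
      exact hχB.injOn hv hw (Subtype.ext_iff.1 h2)
    · intro w hw
      have hwΩ := (hψχ w (hBR hw)).1
      rw [(hdθ w hw).deriv]
      exact mul_ne_zero (hψ.deriv_ne_zero _ (hΦΩ _ hwΩ))
        (mul_ne_zero ((hφ n).2 _ hwΩ) (hχB.deriv_ne_zero w hw))
  have hdisj : Disjoint (id '' ball (0 : ℂ) R) ((fun w => ψ (Φ (χ w))) '' ball 0 R) := by
    rw [image_id, Set.disjoint_left]
    rintro _ hv ⟨w, hw, rfl⟩
    simp only at hv
    have hwΩ := (hψχ w (hBR hw)).1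
    have h1 : φ n ⟨_, hwΩ⟩ ∈ K' := by
      refine ⟨_, hBR hv, ?_⟩
      rw [hχψ _ (hΦΩ _ hwΩ), hΦ ⟨_, hwΩ⟩]
    have h2 : φ n ⟨_, hwΩ⟩ ∈ (∅ : Set Ω) := hn ▸
      ⟨mem_image_of_mem _ (show (⟨_, hwΩ⟩ : Ω) ∈ K' from mem_image_of_mem _ (hBR hw)), h1⟩
    exact h2
  have hLU : ∀ f ∈ locallyUnivalentMeromorphic Ω, ∀ w ∈ ball (0 : ℂ) R,
      IsLocUnivAt (fun w => extendInfty f (χ w)) w := fun f hf w hw =>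
    ((mem_locallyUnivalentMeromorphic_iff hΩ f).1 hf _ (hψχ w (hBR hw)).1).comp
      (hχB.differentiableOn.analyticAt (isOpen_ball.mem_nhds hw)) (hχB.deriv_ne_zero w hw)
  obtain ⟨F, hF, hFd⟩ := exists_isLocUnivAt_dist_comp_lt hrR hR0
    (⟨differentiableOn_id, injOn_id _, fun z _ => by simp⟩ : IsConformalEmbedding id (ball 0 R))
    hθ hdisj (hLU f hf) (hLU g hg) hε
  refine ⟨UniformOnFun.ofFun _ fun z : Ω => F (ψ z), ?_, n, fun z hz => ?_⟩
  · rw [mem_locallyUnivalentMeromorphic_iff hΩ]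
    intro z hz
    exact ((hF (ψ z)).comp (hψ.differentiableOn.analyticAt (hΩ.mem_nhds hz))
      (hψ.deriv_ne_zero z hz)).congr (extendInfty_eventuallyEq hΩ (fun w => rfl) hz)
  · obtain ⟨h1, h2⟩ := hFd (ψ z) (hKr (mem_image_of_mem _ (mem_image_of_mem _ hz)))
    simp only [hχψ z z.2, extendInfty_apply, hΦ] at h1 h2
    exact ⟨h1, h2⟩

end LocallyUnivalent

/-! ### Inversion of the sphere and chordal limits of locally univalent functions. -/

namespace LocallyUnivalent

open Metric

/-- The inversion of the Riemann sphere. -/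
noncomputable def sphereInv (x : OnePoint ℂ) : OnePoint ℂ := x.elim (0 : ℂ) cinv

@[simp] theorem sphereInv_infty : sphereInv ∞ = ((0 : ℂ) : OnePoint ℂ) := rfl

@[simp] theorem sphereInv_coe (w : ℂ) : sphereInv (w : OnePoint ℂ) = cinv w := rfl

theorem sphereInv_cinv (w : ℂ) : sphereInv (cinv w) = w := by
  by_cases h : w = 0
  · rw [h, cinv_zero, sphereInv_infty]
  · rw [cinv_of_ne_zero h, sphereInv_coe, cinv_of_ne_zero (inv_ne_zero h), inv_inv]

theorem sphereInv_sphereInv (x : OnePoint ℂ) : sphereInv (sphereInv x) = x := by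
  induction x with
  | infty => rw [sphereInv_infty, sphereInv_coe, cinv_zero]
  | coe w => rw [sphereInv_coe, sphereInv_cinv]

theorem dist_coe_coe (z w : ℂ) : dist (z : OnePoint ℂ) (w : OnePoint ℂ) =
    ‖z - w‖ / (√(1 + ‖z‖ ^ 2) * √(1 + ‖w‖ ^ 2)) := rfl

theorem dist_coe_infty (z : ℂ) : dist (z : OnePoint ℂ) ∞ = 1 / √(1 + ‖z‖ ^ 2) := rfl

theorem sqrt_one_add_norm_inv_sq {z : ℂ} (hz : z ≠ 0) :
    √(1 + ‖z⁻¹‖ ^ 2) = √(1 + ‖z‖ ^ 2) / ‖z‖ := by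
  have h : 0 < ‖z‖ := norm_pos_iff.2 hz
  rw [← Real.sqrt_sq h.le, ← Real.sqrt_div' _ (by positivity), Real.sqrt_sq h.le, norm_inv]
  congr 1
  field_simp
  ring

theorem dist_sphereInv_coe_infty (z : ℂ) :
    dist (sphereInv z) (sphereInv ∞) = dist (z : OnePoint ℂ) ∞ := by
  rw [sphereInv_coe, sphereInv_infty]
  by_cases hz : z = 0
  · rw [hz, cinv_zero, dist_comm]
  · have h : 0 < ‖z‖ := norm_pos_iff.2 hz
    rw [cinv_of_ne_zero hz, dist_coe_coe, dist_coe_infty, sqrt_one_add_norm_inv_sq hz]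
    simp only [sub_zero, norm_inv, norm_zero, ne_eq, OfNat.ofNat_ne_zero, not_false_eq_true,
      zero_pow, add_zero, Real.sqrt_one, mul_one]
    field_simp

/-- Inversion exchanges poles and zeros without changing chordal distances, so limits near a pole
reduce to limits near a finite value. -/
theorem isometry_sphereInv : Isometry sphereInv := by
  refine Isometry.of_dist_eq fun x y => ?_
  induction x with
  | infty =>
    induction y with
    | infty => rw [dist_self, dist_self]
    | coe w => rw [dist_comm, dist_sphereInv_coe_infty, dist_comm]
  | coe z =>
    induction y with
    | infty => exact dist_sphereInv_coe_infty z
    | coe w =>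
      have h0 : ∀ w : ℂ, dist (sphereInv (0 : ℂ)) (sphereInv w) =
          dist ((0 : ℂ) : OnePoint ℂ) (w : OnePoint ℂ) := fun w => by
        by_cases hw : w = 0
        · rw [hw, dist_self, dist_self]
        · have h : 0 < ‖w‖ := norm_pos_iff.2 hw
          rw [sphereInv_coe, sphereInv_coe, cinv_zero, cinv_of_ne_zero hw, dist_comm,
            dist_coe_infty, dist_coe_coe, sqrt_one_add_norm_inv_sq hw]
          simp
      by_cases hz : z = 0
      · rw [hz]; exact h0 w
      by_cases hw : w = 0
      · rw [hw, dist_comm, dist_comm (z : OnePoint ℂ)]; exact h0 z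
      have hz' : 0 < ‖z‖ := norm_pos_iff.2 hz
      have hw' : 0 < ‖w‖ := norm_pos_iff.2 hw
      rw [sphereInv_coe, sphereInv_coe, cinv_of_ne_zero hz, cinv_of_ne_zero hw, dist_coe_coe,
        dist_coe_coe, sqrt_one_add_norm_inv_sq hz, sqrt_one_add_norm_inv_sq hw,
        inv_sub_inv hz hw, norm_div, norm_mul, norm_sub_rev w z]
      field_simp

theorem continuous_cinv : Continuous cinv :=
  isometry_sphereInv.continuous.comp OnePoint.continuous_coe

theorem IsLocUnivAt.continuousAt {F : ℂ → OnePoint ℂ} {z : ℂ} (hF : IsLocUnivAt F z) :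
    ContinuousAt F z := by
  obtain ⟨g, hg, -, h | h⟩ := hF
  · exact (OnePoint.continuous_coe.continuousAt.comp hg.continuousAt).congr h.symm
  · exact (continuous_cinv.continuousAt.comp hg.continuousAt).congr h.symm

theorem IsLocUnivAt.sphereInv_comp {F : ℂ → OnePoint ℂ} {z : ℂ} (hF : IsLocUnivAt F z) :
    IsLocUnivAt (fun w => sphereInv (F w)) z := by
  obtain ⟨g, hg, hg', h | h⟩ := hF
  · exact ⟨g, hg, hg', Or.inr (h.mono fun w hw => by simp only [hw, sphereInv_coe])⟩
  · exact ⟨g, hg, hg', Or.inl (h.mono fun w hw => by simp only [hw, sphereInv_cinv])⟩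

/-- On bounded sets chordal convergence is Euclidean convergence, which makes the theorems on
holomorphic limits available. -/
theorem norm_sub_le_mul_dist {a b : ℂ} {M : ℝ} (ha : ‖a‖ ≤ M) (hb : ‖b‖ ≤ M) :
    ‖a - b‖ ≤ (1 + M ^ 2) * dist (a : OnePoint ℂ) (b : OnePoint ℂ) := by
  have hM : 0 ≤ M := (norm_nonneg a).trans ha
  have hs : ∀ c : ℂ, ‖c‖ ≤ M → √(1 + ‖c‖ ^ 2) ≤ √(1 + M ^ 2) := fun c hc =>
    Real.sqrt_le_sqrt (by gcongr)
  have h0 : ∀ c : ℂ, 0 < √(1 + ‖c‖ ^ 2) := fun c => by positivity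
  rw [dist_coe_coe, ← mul_div_assoc, le_div_iff₀ (mul_pos (h0 a) (h0 b)), mul_comm]
  refine mul_le_mul_of_nonneg_right ?_ (norm_nonneg _)
  calc _ ≤ √(1 + M ^ 2) * √(1 + M ^ 2) := mul_le_mul (hs a ha) (hs b hb) (h0 b).le (by positivity)
    _ = 1 + M ^ 2 := Real.mul_self_sqrt (by positivity)

/-- A locally uniform limit of locally univalent functions is, near a point where it is finite,
locally univalent or constant. -/
theorem isLocUnivAt_or_eventually_eq_of_ne_infty {ι : Type*} {p : Filter ι} [NeBot p]
    {G : ι → ℂ → OnePoint ℂ} {F : ℂ → OnePoint ℂ} {U : Set ℂ} (hU : IsOpen U)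
    (h : TendstoLocallyUniformlyOn G F p U) (hG : ∀ᶠ i in p, ∀ z ∈ U, IsLocUnivAt (G i) z)
    (hF : ContinuousOn F U) {z : ℂ} (hz : z ∈ U) (hFz : F z ≠ ∞) :
    IsLocUnivAt F z ∨ ∀ᶠ w in 𝓝 z, F w = F z := by
  set a := finiteValue F z
  have ha : (a : OnePoint ℂ) = F z := coe_finiteValue hFz
  have hW : ((↑) : ℂ → OnePoint ℂ) '' ball a 1 ∈ 𝓝 (F z) := by
    rw [← ha]
    exact OnePoint.isOpenEmbedding_coe.isOpenMap.image_mem_nhds (ball_mem_nhds a one_pos)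
  obtain ⟨η, hη, hηW⟩ := Metric.mem_nhds_iff.1 hW
  obtain ⟨δ, hδ, hδU⟩ := nhds_basis_closedBall.mem_iff.1 (inter_mem (hU.mem_nhds hz)
    ((hF.continuousAt (hU.mem_nhds hz)).preimage_mem_nhds (ball_mem_nhds (F z) (half_pos hη))))
  set M := ‖a‖ + 1
  have hfin : ∀ x : OnePoint ℂ, x ∈ ball (F z) η → ∃ b : ℂ, x = b ∧ ‖b‖ ≤ M := by
    intro x hx
    obtain ⟨b, hb, rfl⟩ := hηW hx
    refine ⟨b, rfl, ?_⟩
    have h1 := norm_le_norm_add_norm_sub' b a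
    rw [mem_ball, dist_eq_norm] at hb
    linarith
  have hFB : ∀ w ∈ closedBall z δ, dist (F w) (F z) < η / 2 := fun w hw => (hδU hw).2
  have hunif := (tendstoLocallyUniformlyOn_iff_forall_isCompact hU).1 h (closedBall z δ)
    (fun w hw => (hδU hw).1) (isCompact_closedBall z δ)
  rw [Metric.tendstoUniformlyOn_iff] at hunif
  have hG' : ∀ i w, w ∈ closedBall z δ → dist (F w) (G i w) < η / 2 → G i w ∈ ball (F z) η := by
    intro i w hw hi
    rw [mem_ball]
    have := hFB w hw
    rw [dist_comm] at hi
    linarith [dist_triangle (G i w) (F w) (F z)]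
  have hFB' : ∀ w ∈ closedBall z δ, F w ∈ ball (F z) η := fun w hw =>
    (hFB w hw).trans (half_lt_self hη)
  have hconv : TendstoLocallyUniformlyOn (fun i => finiteValue (G i)) (finiteValue F) p
      (ball z δ) := by
    refine (TendstoUniformlyOn.mono ?_ ball_subset_closedBall).tendstoLocallyUniformlyOn
    rw [Metric.tendstoUniformlyOn_iff]
    intro ε hε
    have hM : 0 < 1 + M ^ 2 := by positivity
    filter_upwards [hunif _ (half_pos hη), hunif _ (div_pos hε hM)] with i h1 h2 w hw
    obtain ⟨b, hb, hbM⟩ := hfin _ (hFB' w hw)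
    obtain ⟨c, hc, hcM⟩ := hfin _ (hG' i w hw (h1 w hw))
    have h3 := h2 w hw
    rw [finiteValue_of_eq_coe hb, finiteValue_of_eq_coe hc, dist_eq_norm]
    rw [hb, hc, lt_div_iff₀' hM] at h3
    exact (norm_sub_le_mul_dist hbM hcM).trans_lt h3
  have hGan : ∀ᶠ i in p, ∀ w ∈ ball z δ, AnalyticAt ℂ (finiteValue (G i)) w ∧
      deriv (finiteValue (G i)) w ≠ 0 := by
    filter_upwards [hG, hunif _ (half_pos hη)] with i h1 h2 w hw
    have hw' := ball_subset_closedBall hw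
    refine (h1 w (hδU hw').1).analyticAt_finiteValue ?_
    obtain ⟨c, hc, -⟩ := hfin _ (hG' i w hw' (h2 w hw'))
    rw [hc]
    exact OnePoint.coe_ne_infty c
  have hGd : ∀ᶠ i in p, DifferentiableOn ℂ (finiteValue (G i)) (ball z δ) := hGan.mono
    fun i hi w hw => (hi w hw).1.differentiableAt.differentiableWithinAt
  have hFd : DifferentiableOn ℂ (finiteValue F) (ball z δ) := hconv.differentiableOn hGd isOpen_ball
  have hzδ : z ∈ ball z δ := mem_ball_self hδ
  have hFcoe : F =ᶠ[𝓝 z] fun w => (finiteValue F w : OnePoint ℂ) :=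
    eventually_of_mem (isOpen_ball.mem_nhds hzδ) fun w hw => by
      obtain ⟨b, hb, -⟩ := hfin _ (hFB' w (ball_subset_closedBall hw))
      simp only [finiteValue_of_eq_coe hb, hb]
  -- Hurwitz's theorem for the derivatives: a zero of the limit derivative forces it to vanish
  -- identically near `z`.
  by_cases hd : deriv (finiteValue F) z = 0
  · right
    have h1 := eventually_eq_zero_of_tendstoLocallyUniformlyOn isOpen_ball
      (hconv.deriv hGd isOpen_ball)
      (hGd.mono fun i hi => hi.deriv isOpen_ball)
      (hGan.mono fun i hi w hw => (hi w hw).2) hzδ hd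
    obtain ⟨r, hr, hrd⟩ := Metric.mem_nhds_iff.1 (inter_mem h1 (isOpen_ball.mem_nhds hzδ))
    filter_upwards [hFcoe, ball_mem_nhds z hr] with w hw hwr
    rw [hw, ← ha]
    congr 1
    exact isOpen_ball.is_const_of_deriv_eq_zero (convex_ball z r).isPreconnected
      (hFd.mono fun v hv => (hrd hv).2) (fun v hv => (hrd hv).1) hwr (mem_ball_self hr)
  · left
    exact (isLocUnivAt_coe (hFd.analyticAt (isOpen_ball.mem_nhds hzδ)) hd).congr hFcoe.symm

theorem isLocUnivAt_or_eventually_eq {ι : Type*} {p : Filter ι} [NeBot p]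
    {G : ι → ℂ → OnePoint ℂ} {F : ℂ → OnePoint ℂ} {U : Set ℂ} (hU : IsOpen U)
    (h : TendstoLocallyUniformlyOn G F p U) (hG : ∀ᶠ i in p, ∀ z ∈ U, IsLocUnivAt (G i) z)
    (hF : ContinuousOn F U) {z : ℂ} (hz : z ∈ U) :
    IsLocUnivAt F z ∨ ∀ᶠ w in 𝓝 z, F w = F z := by
  by_cases hFz : F z = ∞
  · have h1 := isLocUnivAt_or_eventually_eq_of_ne_infty hU
      (isometry_sphereInv.uniformContinuous.comp_tendstoLocallyUniformlyOn h)
      (hG.mono fun i hi z hz => (hi z hz).sphereInv_comp)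
      (isometry_sphereInv.continuous.comp_continuousOn hF) hz
      (by simp only [Function.comp_apply, hFz, sphereInv_infty]; exact OnePoint.coe_ne_infty _)
    refine h1.imp (fun h2 => ?_) fun h2 => h2.mono fun w hw => isometry_sphereInv.injective hw
    have h3 := h2.sphereInv_comp
    simpa only [Function.comp_apply, sphereInv_sphereInv] using h3
  · exact isLocUnivAt_or_eventually_eq_of_ne_infty hU h hG hF hz hFz

theorem IsLocUnivAt.not_eventually_eq {F : ℂ → OnePoint ℂ} {z : ℂ} (hF : IsLocUnivAt F z) :
    ¬ ∀ᶠ w in 𝓝 z, F w = F z := by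
  intro h
  by_cases hz : F z = ∞
  · obtain ⟨w, hw, hw'⟩ := (hF.eventually_ne_infty.and (h.filter_mono nhdsWithin_le_nhds)).exists
    exact hw (hw'.trans hz)
  · obtain ⟨-, hd⟩ := hF.analyticAt_finiteValue hz
    have h1 : finiteValue F =ᶠ[𝓝 z] fun _ => finiteValue F z := h.mono fun w hw => by
      simp only [finiteValue, hw]
    rw [h1.deriv_eq, deriv_const] at hd
    exact hd rfl

theorem IsLocUnivAt.eventually {F : ℂ → OnePoint ℂ} {z : ℂ} (hF : IsLocUnivAt F z) :
    ∀ᶠ w in 𝓝 z, IsLocUnivAt F w := by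
  obtain ⟨g, hg, hg', h⟩ := hF
  rcases h with h | h
  all_goals
    filter_upwards [hg.eventually_analyticAt, hg.deriv.continuousAt.eventually_ne hg',
      h.eventually_nhds] with w h1 h2 h3
  · exact ⟨g, h1, h2, Or.inl h3⟩
  · exact ⟨g, h1, h2, Or.inr h3⟩

/-- A locally uniform limit of locally univalent functions on a domain is locally univalent or
constant. -/
theorem forall_isLocUnivAt_or_eqOn {ι : Type*} {p : Filter ι} [NeBot p]
    {G : ι → ℂ → OnePoint ℂ} {F : ℂ → OnePoint ℂ} {U : Set ℂ} (hU : IsOpen U)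
    (hUc : IsPreconnected U) (h : TendstoLocallyUniformlyOn G F p U)
    (hG : ∀ᶠ i in p, ∀ z ∈ U, IsLocUnivAt (G i) z) (hF : ContinuousOn F U) :
    (∀ z ∈ U, IsLocUnivAt F z) ∨ ∀ z ∈ U, ∀ w ∈ U, F z = F w := by
  have hdich := fun z (hz : z ∈ U) => isLocUnivAt_or_eventually_eq hU h hG hF hz
  set A := {z | IsLocUnivAt F z}
  set B := {z | ∀ᶠ w in 𝓝 z, F w = F z}
  have hAo : IsOpen A := isOpen_iff_mem_nhds.2 fun z hz => hz.eventually
  have hBo : IsOpen B := isOpen_iff_mem_nhds.2 fun z hz => by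
    filter_upwards [hz.eventually_nhds, hz] with w hw hwz
    exact hw.mono fun v hv => hv.trans hwz.symm
  -- The points of local univalence and those of local constancy are disjoint open sets that cover
  -- `U`, so connectedness leaves only one kind.
  have hAB : Disjoint A B := Set.disjoint_left.2 fun z hz hz' => hz.not_eventually_eq hz'
  rcases hUc.subset_or_subset hAo hBo hAB fun z hz => hdich z hz with h1 | h1
  · exact Or.inl fun z hz => h1 hz
  · right
    intro z hz w hw
    have h2 : IsOpen {v | v ∈ U ∧ F v = F w} := isOpen_iff_mem_nhds.2 fun v hv => by
      filter_upwards [h1 hv.1, hU.mem_nhds hv.1] with u hu huU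
      exact ⟨huU, hu.trans hv.2⟩
    have h3 : IsOpen {v | v ∈ U ∧ F v ≠ F w} := isOpen_iff_mem_nhds.2 fun v hv => by
      filter_upwards [h1 hv.1, hU.mem_nhds hv.1] with u hu huU
      exact ⟨huU, fun h => hv.2 (hu.symm.trans h)⟩
    rcases hUc.subset_or_subset h2 h3 (Set.disjoint_left.2 fun v hv hv' => hv'.2 hv.2)
      (fun v hv => (em (F v = F w)).imp (fun h => ⟨hv, h⟩) fun h => ⟨hv, h⟩) with h4 | h4
    · exact (h4 hz).2
    · exact absurd rfl (h4 hw).2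

end LocallyUnivalent

/-! ### The Baire property of the family and the transitivity of the compositions. -/

namespace LocallyUnivalent

open Metric

/-- A subset of a completely metrizable space is a Baire space if all its missing limit points lie
in a closed set disjoint from it. -/
theorem baireSpace_of_closure_subset_union {X : Type*} [TopologicalSpace X] [PolishSpace X]
    {s c : Set X} (hc : IsClosed c) (hsc : Disjoint s c) (h : closure s ⊆ s ∪ c) :
    BaireSpace s := by
  have : PolishSpace (closure s) := isClosed_closure.polishSpace
  -- Within its closure `s` is the complement of the closed set `c`, hence open.
  have ho : IsOpen ((↑) ⁻¹' s : Set (closure s)) := by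
    have h1 : ((↑) ⁻¹' s : Set (closure s)) = (((↑) : closure s → X) ⁻¹' c)ᶜ := by
      ext x
      exact ⟨fun hx hxc => hsc.ne_of_mem hx hxc rfl, fun hx => (h x.2).resolve_right hx⟩
    rw [h1]
    exact (hc.preimage continuous_subtype_val).isOpen_compl
  have : BaireSpace ((↑) ⁻¹' s : Set (closure s)) := ho.isGδ.baireSpace_of_dense
    (by simp [Subtype.dense_iff, inter_eq_right.mpr subset_closure])
  have e : ((↑) ⁻¹' s : Set (closure s)) ≃ₜ s := ⟨⟨fun x => ⟨x, x.2⟩,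
    fun x => ⟨⟨x, subset_closure x.2⟩, x.2⟩, fun _ => rfl, fun _ => rfl⟩, by fun_prop, by fun_prop⟩
  exact e.baireSpace

theorem continuous_of_mem {Ω : Set ℂ} (hΩ : IsOpen Ω) {f : SphereMap Ω}
    (hf : f ∈ locallyUnivalentMeromorphic Ω) : Continuous f.toFun := by
  rw [mem_locallyUnivalentMeromorphic_iff hΩ] at hf
  refine continuous_iff_continuousAt.2 fun z => ?_
  have h := (hf z z.2).continuousAt.comp (f := fun w : Ω => (w : ℂ))
    continuous_subtype_val.continuousAt
  exact h.congr (Eventually.of_forall fun w => extendInfty_apply f w)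

/-- The continuous maps that are meromorphic and locally univalent. -/
def continuousLocallyUnivalent (Ω : Set ℂ) : Set C(Ω, OnePoint ℂ) :=
  ContinuousMap.toUniformOnFunIsCompact ⁻¹' locallyUnivalentMeromorphic Ω

theorem subset_range_toUniformOnFunIsCompact {Ω : Set ℂ} (hΩ : IsOpen Ω) :
    locallyUnivalentMeromorphic Ω ⊆
      range (ContinuousMap.toUniformOnFunIsCompact : C(Ω, OnePoint ℂ) → SphereMap Ω) := by
  rw [ContinuousMap.range_toUniformOnFunIsCompact]
  exact fun f hf => continuous_of_mem hΩ hf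

/-- The topology of locally uniform convergence on the family agrees with the compact-open
topology. -/
noncomputable def continuousLocallyUnivalentHomeomorph {Ω : Set ℂ} (hΩ : IsOpen Ω) :
    continuousLocallyUnivalent Ω ≃ₜ locallyUnivalentMeromorphic Ω :=
  ContinuousMap.isUniformEmbedding_toUniformOnFunIsCompact.isEmbedding.homeomorphOfSubsetRange
    (subset_range_toUniformOnFunIsCompact hΩ)

/-- Hurwitz's dichotomy for the limit along the filter of neighbourhoods of `f` within the family.
-/
theorem closure_continuousLocallyUnivalent_subset {Ω : Set ℂ} (hΩ : IsOpen Ω)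
    (hc : IsPreconnected Ω) : closure (continuousLocallyUnivalent Ω) ⊆
      continuousLocallyUnivalent Ω ∪ {f | ∀ z w, f z = f w} := by
  have : LocallyCompactSpace Ω := hΩ.locallyCompactSpace
  intro f hf
  rw [mem_closure_iff_nhdsWithin_neBot] at hf
  have hconv : TendstoLocallyUniformlyOn
      (fun g : C(Ω, OnePoint ℂ) => extendInfty g.toUniformOnFunIsCompact)
      (extendInfty f.toUniformOnFunIsCompact) (𝓝[continuousLocallyUnivalent Ω] f) Ω := by
    rw [tendstoLocallyUniformlyOn_iff_tendstoLocallyUniformly_comp_coe]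
    have h1 := ContinuousMap.tendsto_iff_tendstoLocallyUniformly.1
      (tendsto_id.mono_left (nhdsWithin_le_nhds (s := continuousLocallyUnivalent Ω) (a := f)))
    convert h1 using 1
    · ext g z
      exact extendInfty_apply _ z
    · ext z
      exact extendInfty_apply _ z
  have hcont : ContinuousOn (extendInfty f.toUniformOnFunIsCompact) Ω := by
    rw [continuousOn_iff_continuous_domRestrict]
    exact f.continuous.congr fun z => (extendInfty_apply _ z).symm
  rcases forall_isLocUnivAt_or_eqOn hΩ hc hconv (eventually_of_mem self_mem_nhdsWithin
    fun g hg => (mem_locallyUnivalentMeromorphic_iff hΩ _).1 hg) hcont with h | h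
  · exact Or.inl ((mem_locallyUnivalentMeromorphic_iff hΩ _).2 h)
  · refine Or.inr fun z w => ?_
    have h1 := h z z.2 w w.2
    rwa [extendInfty_apply, extendInfty_apply] at h1

theorem polishSpace_continuousMap {Ω : Set ℂ} (hΩ : IsOpen Ω) :
    PolishSpace C(Ω, OnePoint ℂ) := by
  have : LocallyCompactSpace Ω := hΩ.locallyCompactSpace
  infer_instance

/-- The only missing limit points are constant maps. These form a closed set, and no constant map is
locally univalent since Ω is nonempty. -/
theorem baireSpace_locallyUnivalentMeromorphic {Ω : Set ℂ} (hΩ : IsOpen Ω)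
    (hc : IsConnected Ω) : BaireSpace (locallyUnivalentMeromorphic Ω) := by
  have := polishSpace_continuousMap hΩ
  have hclosed : IsClosed {f : C(Ω, OnePoint ℂ) | ∀ z w, f z = f w} := by
    simp only [ofPred_forall]
    exact isClosed_iInter fun z => isClosed_iInter fun w =>
      isClosed_eq (continuous_eval_const z) (continuous_eval_const w)
  have hdisj : Disjoint (continuousLocallyUnivalent Ω) {f | ∀ z w, f z = f w} := by
    rw [Set.disjoint_left]
    intro f hf hf'
    obtain ⟨z, hz⟩ := hc.nonempty
    refine ((mem_locallyUnivalentMeromorphic_iff hΩ _).1 hf z hz).not_eventually_eq ?_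
    filter_upwards [hΩ.mem_nhds hz] with w hw
    rw [extendInfty_apply _ ⟨w, hw⟩, extendInfty_apply _ ⟨z, hz⟩]
    exact hf' _ _
  have := baireSpace_of_closure_subset_union hclosed hdisj
    (closure_continuousLocallyUnivalent_subset hΩ hc.isPreconnected)
  exact (continuousLocallyUnivalentHomeomorph hΩ).baireSpace

theorem secondCountableTopology_locallyUnivalentMeromorphic {Ω : Set ℂ} (hΩ : IsOpen Ω) :
    SecondCountableTopology (locallyUnivalentMeromorphic Ω) := by
  have := polishSpace_continuousMap hΩ
  exact (continuousLocallyUnivalentHomeomorph hΩ).symm.secondCountableTopology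

theorem IsLocallyUnivalentSelfMap.continuous {Ω : Set ℂ} {φ : Ω → Ω}
    (hφ : IsLocallyUnivalentSelfMap φ) : Continuous φ := by
  refine continuous_induced_rng.2 ?_
  exact (continuousOn_iff_continuous_domRestrict.1 hφ.1.continuousOn).congr fun z =>
    extendZero_apply _ z

theorem continuous_sphereMap_comp {Ω : Set ℂ} {φ : Ω → Ω} (hφ : Continuous φ) :
    Continuous fun f : SphereMap Ω => f.comp φ :=
  (UniformOnFun.precomp_uniformContinuous (𝔖 := {K : Set Ω | IsCompact K})
    (𝔗 := {K : Set Ω | IsCompact K}) fun _ hK => IsCompact.image hK hφ).continuous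

/-- Basic neighbourhoods for locally uniform convergence. -/
theorem exists_isCompact_forall_dist_lt_imp_mem {Ω : Set ℂ} {U : Set (SphereMap Ω)}
    {f : SphereMap Ω} (hU : U ∈ 𝓝 f) : ∃ K : Set Ω, IsCompact K ∧ ∃ ε > 0, ∀ g : SphereMap Ω,
      (∀ z ∈ K, dist (g.toFun z) (f.toFun z) < ε) → g ∈ U := by
  obtain ⟨⟨K, ε⟩, ⟨hK, hε⟩, h⟩ := (UniformOnFun.hasBasis_nhds_of_basis Ω (OnePoint ℂ)
    {K : Set Ω | IsCompact K} f ⟨∅, isCompact_empty⟩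
    (fun K hK L hL => ⟨K ∪ L, IsCompact.union hK hL, subset_union_left, subset_union_right⟩)
    Metric.uniformity_basis_dist).mem_iff.1 hU
  exact ⟨K, hK, ε, hε, fun g hg => h hg⟩

/-- Composition with a self-map, as a map of the family into itself. -/
def compSelfMap {Ω : Set ℂ} (hΩ : IsOpen Ω) {φ : Ω → Ω} (hφ : IsLocallyUnivalentSelfMap φ)
    (f : locallyUnivalentMeromorphic Ω) : locallyUnivalentMeromorphic Ω :=
  ⟨f.1.comp φ, comp_mem_locallyUnivalentMeromorphic hΩ f.2 hφ⟩

theorem continuous_compSelfMap {Ω : Set ℂ} (hΩ : IsOpen Ω) {φ : Ω → Ω}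
    (hφ : IsLocallyUnivalentSelfMap φ) : Continuous (compSelfMap hΩ hφ) :=
  ((continuous_sphereMap_comp (IsLocallyUnivalentSelfMap.continuous hφ)).comp
    continuous_subtype_val).subtype_mk _

theorem isUniversalIn_iff_dense {Ω : Set ℂ} (hΩ : IsOpen Ω) {Φ : Set (Ω → Ω)}
    (hΦ : ∀ φ ∈ Φ, IsLocallyUnivalentSelfMap φ) (f : locallyUnivalentMeromorphic Ω) :
    IsUniversalIn Φ (locallyUnivalentMeromorphic Ω) (f : SphereMap Ω) ↔
      Dense (range fun φ : Φ => compSelfMap hΩ (hΦ φ φ.2) f) := by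
  have himg : (Subtype.val '' range fun φ : Φ => compSelfMap hΩ (hΦ φ φ.2) f) =
      {h | ∃ φ ∈ Φ, h = (f : SphereMap Ω).comp φ} := by
    ext h
    constructor
    · rintro ⟨_, ⟨φ, rfl⟩, rfl⟩
      exact ⟨φ, φ.2, rfl⟩
    · rintro ⟨φ, hφ, rfl⟩
      exact ⟨_, ⟨⟨φ, hφ⟩, rfl⟩, rfl⟩
  rw [Subtype.dense_iff, himg]
  refine ⟨fun h => h.2.2, fun h => ⟨f.2, ?_, h⟩⟩
  rintro _ ⟨φ, hφ, rfl⟩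
  exact comp_mem_locallyUnivalentMeromorphic hΩ f.2 (hΦ φ hφ)

theorem nonempty_locallyUnivalentMeromorphic {Ω : Set ℂ} (hΩ : IsOpen Ω) :
    (locallyUnivalentMeromorphic Ω).Nonempty := by
  refine ⟨UniformOnFun.ofFun _ fun z : Ω => ((z : ℂ) : OnePoint ℂ), ?_⟩
  rw [mem_locallyUnivalentMeromorphic_iff hΩ]
  intro z hz
  exact (isLocUnivAt_coe analyticAt_id (by simp)).congr
    (extendInfty_eventuallyEq hΩ (F := fun w => ((id w : ℂ) : OnePoint ℂ)) (fun w => rfl) hz)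

/-- Topological transitivity: the simultaneous approximation on `K ∪ L` puts `F` into `V` and `F ∘ φ
n` into `U`. -/
theorem dense_setOf_exists_compSelfMap_mem {Ω : Set ℂ} (hΩ : IsOpen Ω) (hsc : IsSimplyConnected Ω)
    {Φ : Set (Ω → Ω)} (hΦ : ∀ φ ∈ Φ, IsLocallyUnivalentSelfMap φ) {φ : ℕ → Ω → Ω}
    (hmem : ∀ n, φ n ∈ Φ) (hrun : IsRunAway φ) (hinj : IsEventuallyInjective φ)
    {U : Set (locallyUnivalentMeromorphic Ω)} (hU : IsOpen U) (hne : U.Nonempty) :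
    Dense (⋃ φ : Φ, compSelfMap hΩ (hΦ φ φ.2) ⁻¹' U) := by
  rw [dense_iff_inter_open]
  rintro V hV ⟨f, hf⟩
  obtain ⟨g, hg⟩ := hne
  obtain ⟨U', hU', rfl⟩ := isOpen_induced_iff.1 hU
  obtain ⟨V', hV', rfl⟩ := isOpen_induced_iff.1 hV
  obtain ⟨K, hK, ε, hε, hKU⟩ := exists_isCompact_forall_dist_lt_imp_mem (hU'.mem_nhds hg)
  obtain ⟨L, hL, δ, hδ, hLV⟩ := exists_isCompact_forall_dist_lt_imp_mem (hV'.mem_nhds hf)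
  obtain ⟨F, hF, n, hFn⟩ := exists_mem_dist_lt hΩ hsc (fun n => hΦ _ (hmem n)) hrun hinj f.2 g.2
    (hK.union hL) (lt_min hε hδ)
  refine ⟨⟨F, hF⟩, hLV F fun z hz => (hFn z (Or.inr hz)).1.trans_le (min_le_right _ _),
    mem_iUnion.2 ⟨⟨φ n, hmem n⟩, hKU _ fun z hz =>
      (hFn z (Or.inl hz)).2.trans_le (min_le_left _ _)⟩⟩

end LocallyUnivalent

/-! ### The category argument. -/

open LocallyUnivalent

theorem mainTheorem8 (Ω : Set ℂ) (hΩ : IsOpen Ω) (hsc : IsSimplyConnected Ω)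
    (Φ : Set (Ω → Ω)) (hΦ : ∀ φ ∈ Φ, IsLocallyUnivalentSelfMap φ)
    (φ : ℕ → Ω → Ω) (hmem : ∀ n, φ n ∈ Φ)
    (hrun : IsRunAway φ) (hinj : IsEventuallyInjective φ) :
    (∃ f, IsUniversalIn Φ (locallyUnivalentMeromorphic Ω) f) ∧
      Dense {f : locallyUnivalentMeromorphic Ω |
        IsUniversalIn Φ (locallyUnivalentMeromorphic Ω) f} ∧
      IsGδ {f : locallyUnivalentMeromorphic Ω |
        IsUniversalIn Φ (locallyUnivalentMeromorphic Ω) f} := by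
  have hc : IsConnected Ω := hsc.isPathConnected.isConnected
  have := baireSpace_locallyUnivalentMeromorphic hΩ hc
  have := secondCountableTopology_locallyUnivalentMeromorphic hΩ
  have := (nonempty_locallyUnivalentMeromorphic hΩ).to_subtype
  set B := TopologicalSpace.countableBasis (locallyUnivalentMeromorphic Ω)
  have hB := TopologicalSpace.isBasis_countableBasis (locallyUnivalentMeromorphic Ω)
  have hBc : B.Countable := TopologicalSpace.countable_countableBasis _
  -- Density of the set of compositions need only be tested on the countable basis, whose members
  -- are nonempty. This turns universality into a countable intersection of open conditions.
  have heq : {f : locallyUnivalentMeromorphic Ω |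
      IsUniversalIn Φ (locallyUnivalentMeromorphic Ω) f} =
      ⋂ U ∈ B, ⋃ φ : Φ, compSelfMap hΩ (hΦ φ φ.2) ⁻¹' U := by
    ext f
    rw [mem_ofPred_eq, isUniversalIn_iff_dense hΩ hΦ, hB.dense_iff, mem_iInter₂]
    refine forall₂_congr fun U hU => ?_
    have hUne := TopologicalSpace.nonempty_of_mem_countableBasis hU
    simp only [hUne, forall_const, mem_iUnion, mem_preimage]
    exact ⟨by rintro ⟨_, hx, φ, rfl⟩; exact ⟨φ, hx⟩, fun ⟨φ, hx⟩ => ⟨_, hx, φ, rfl⟩⟩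
  have hopen : ∀ U ∈ B, IsOpen (⋃ φ : Φ, compSelfMap hΩ (hΦ φ φ.2) ⁻¹' U) := fun U hU =>
    isOpen_iUnion fun φ => (hB.isOpen hU).preimage (continuous_compSelfMap hΩ _)
  have hdense : Dense {f : locallyUnivalentMeromorphic Ω |
      IsUniversalIn Φ (locallyUnivalentMeromorphic Ω) f} := by
    rw [heq]
    exact dense_biInter_of_isOpen hopen hBc fun U hU =>
      dense_setOf_exists_compSelfMap_mem hΩ hsc hΦ hmem hrun hinj (hB.isOpen hU)
        (TopologicalSpace.nonempty_of_mem_countableBasis hU)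
  refine ⟨?_, hdense, ?_⟩
  · obtain ⟨f, hf⟩ := hdense.nonempty
    exact ⟨f, hf⟩
  · rw [heq]
    exact IsGδ.biInter_of_isOpen hBc hopen
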